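/- Proposition 1.3. Let \(M\) be a compact complex manifold of dimension \(n\ge 1\), \(\omega_0\) a smooth Kähler form on \(M\), \((L,h)\) a holomorphic line bundle on \(M\) with a smooth Hermitian metric, \(s\) a holomorphic section of \(L\), and \(D=\{s=0\}\). Assume that \(s\) vanishes to first order along \(D\), i.e. the differential of \(s\) in a local trivialisation has no zero on \(D\); so \(D\) is a smooth complex hypersurface. Write \(dd^c=i\partial\bar\partial\), let \(0<\tau<\tau'<1\), and on \(M\setminus D\) put \[\omega_\tau=\omega_0+\mathfrak a\,dd^c|s|_h^{2\tau},\qquad \tilde\omega=\omega_0+\mathfrak a\,dd^c|s|_h^{2\tau}-\mathfrak c\,dd^c|s|_h^{2\tau'} .\] Definitions. A holomorphic chart \((z_1,\dots,z_n)\) on \(U\) is adapted if \(D\cap U=\{z_1=0\}\); put \(\varepsilon=\tau|z_1|^{\tau}\,dz_1/z_1=d|z_1|^\tau+i\tau|z_1|^\tau d\arg z_1\). An edge-cone Kähler metric of angle \(\tau\) (total angle \(2\pi\tau\)) along \(D\) is a smooth Kähler form on \(M\setminus D\) such that in every adapted chart: (i) on \(K\setminus D\), for each compact \(K\subset U\),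 it is bounded above and below by positive multiples of \(\tau^2|z_1|^{2\tau-2}i\,dz_1\wedge d\bar z_1+\sum_{j\ge2}i\,dz_j\wedge d\bar z_j\); (ii) at every point of \(D\cap U\) its coefficients in the coframe \(\varepsilon,dz_2,\dots,dz_n\) have limits from \(M\setminus D\), which form a positive definite Hermitian matrix, the limits of the mixed coefficients of \(\varepsilon\wedge d\bar z_j\) and \(dz_j\wedge\bar\varepsilon\), \(j\ge2\), being zero, and these limits are the restriction to \(D\cap U\) of smooth functions on \(U\). The space \(C^\theta_\tau\), \(0<\theta<1\), consists of the \((1,1)\)-forms on \(M\setminus D\) whose coefficients in these coframes have finite norm \(\sup|f|+\sup|f(x)-f(y)|/|\xi(x)-\xi(y)|^{\theta}\), where \(\xi=(|z_1|^{\tau-1}z_1,z_2,\dots,z_n)\), and whose mixed coefficients tend to zero at \(D\). Its norm is the largest of these norms over the pieces \(K_i\setminus D\) and over the coefficients, for a choice of finitely many adapted charts \(U_i\) and compact sets \(K_i\subset U_i\) covering \(M\). Claim. (a) There is \(\mathfrak a_0>0\) such that \(\omega_\tau\) is an edge-cone Kähler metric of angle \(\tau\) along \(D\) for all \(0<\mathfrak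 a<\mathfrak a_0\). (b) Let \(\mathfrak a>0\) be such that \(\omega_\tau\) is an edge-cone Kähler metric of angle \(\tau\) along \(D\). Then there is \(\mathfrak c_0>0\) such that for all \(0<\mathfrak c<\mathfrak c_0\): \(\tilde\omega\) is an edge-cone Kähler metric of angle \(\tau\) along \(D\); it is uniformly equivalent to \(\omega_\tau\), i.e. \(C^{-1}\omega_\tau\le\tilde\omega\le C\omega_\tau\) on \(M\setminus D\) for some \(C>0\); and its bisectional curvature is bounded from below, i.e. there is a constant \(C\) with \(R(v,\bar v,w,\bar w)\ge -C|v|^2_{\tilde\omega}|w|^2_{\tilde\omega}\) for all tangent vectors \(v,w\) of type \((1,0)\) at all points of \(M\setminus D\), where \(R_{\alpha\bar\beta\gamma\bar\delta}=-\partial_\gamma\partial_{\bar\delta}g_{\alpha\bar\beta}+g^{\mu\bar\nu}\partial_\gamma g_{\alpha\bar\nu}\,\partial_{\bar\delta}g_{\mu\bar\beta}\) for \(\tilde\omega=i\sum g_{\alpha\bar\beta}dz_\alpha\wedge d\bar z_\beta\). (c) For \(\mathfrak a\) as in (b), every \(\theta\in(0,1)\) with \(\theta\le 2(\tau'/\tau-1)\),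 every choice of charts \(U_i\) and compact sets \(K_i\) as above, and every \(\epsilon>0\), there is \(\mathfrak c_1>0\) such that for all \(0<\mathfrak c<\mathfrak c_1\) one has \(\tilde\omega-\omega_\tau\in C^\theta_\tau\) and \(\|\tilde\omega-\omega_\tau\|_{C^\theta_\tau}<\epsilon\). -/

import Mathlib

open Set Filter Topology
open scoped Manifold ContDiff ENNReal ComplexConjugate ComplexOrder

noncomputable section

/-- The model space `ℂⁿ`, with its Euclidean norm. The coordinate `z 0` plays the role of the
first coordinate (the one transversal to the divisor). -/
abbrev Cn (n : ℕ) : Type := EuclideanSpace ℂ (Fin n)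

namespace EdgeCone

/-! ### Calculus on `ℂⁿ` -/

/-- The coordinate vector `e_α`. -/
def basisVec {n : ℕ} (α : Fin n) : Cn n := EuclideanSpace.single α 1

/-- The Wirtinger derivative `∂f/∂z^α = (∂f/∂x^α - i ∂f/∂y^α) / 2`. -/
def wirt {n : ℕ} (α : Fin n) (f : Cn n → ℂ) (z : Cn n) : ℂ :=
  (fderiv ℝ f z (basisVec α) - Complex.I * fderiv ℝ f z (Complex.I • basisVec α)) / 2

/-- The Wirtinger derivative `∂f/∂z̄^α = (∂f/∂x^α + i ∂f/∂y^α) / 2`. -/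
def wirtBar {n : ℕ} (α : Fin n) (f : Cn n → ℂ) (z : Cn n) : ℂ :=
  (fderiv ℝ f z (basisVec α) + Complex.I * fderiv ℝ f z (Complex.I • basisVec α)) / 2

/-- The complex Hessian `∂²f/∂z^α∂z̄^β`. -/
def complexHessian {n : ℕ} (f : Cn n → ℂ) (z : Cn n) : Matrix (Fin n) (Fin n) ℂ :=
  Matrix.of fun α β => wirt α (wirtBar β f) z

/-- The sesquilinear form `(v, w) ↦ ∑ G_{αβ̄} v^α conj(w^β)` of a matrix. -/
def sesq {n : ℕ} (G : Matrix (Fin n) (Fin n) ℂ) : Cn n →ₗ[ℂ] Cn n →ₗ⋆[ℂ] ℂ :=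
  LinearMap.mk₂'ₛₗ (RingHom.id ℂ) (starRingEnd ℂ)
    (fun v w => ∑ α, ∑ β, G α β * v α * conj (w β))
    (fun v v' w => by
      simp only [PiLp.add_apply, mul_add, add_mul, Finset.sum_add_distrib])
    (fun c v w => by
      simp only [PiLp.smul_apply, smul_eq_mul, RingHom.id_apply, Finset.mul_sum]
      exact Finset.sum_congr rfl fun α _ => Finset.sum_congr rfl fun β _ => by ring)
    (fun v w w' => by
      simp only [PiLp.add_apply, map_add, mul_add, Finset.sum_add_distrib])
    (fun c v w => by
      simp only [PiLp.smul_apply, smul_eq_mul, map_mul, Finset.mul_sum]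
      exact Finset.sum_congr rfl fun α _ => Finset.sum_congr rfl fun β _ => by ring)

/-- The curvature tensor of a Kähler metric with coefficients `g = (g_{αβ̄})`:
`R_{αβ̄γδ̄} = - ∂_γ ∂_δ̄ g_{αβ̄} + ∑ g^{μν̄} (∂_γ g_{αν̄}) (∂_δ̄ g_{μβ̄})`.
Here `∑_ν g_{κν̄} g^{μν̄} = δ_κ^μ`, that is, `g^{μν̄} = (g⁻¹)_{νμ}` for the matrix inverse. -/
def curvature {n : ℕ} (g : Cn n → Matrix (Fin n) (Fin n) ℂ) (z : Cn n) (α β γ δ : Fin n) : ℂ :=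
  - wirt γ (wirtBar δ fun y => g y α β) z
    + ∑ μ, ∑ ν, (g z)⁻¹ ν μ * wirt γ (fun y => g y α ν) z * wirtBar δ (fun y => g y μ β) z

/-- `R(v, v̄, w, w̄) = ∑ R_{αβ̄γδ̄} v^α v̄^β w^γ w̄^δ` (a real number when `g` is Kähler). -/
def bisectional {n : ℕ} (g : Cn n → Matrix (Fin n) (Fin n) ℂ) (z v w : Cn n) : ℝ :=
  (∑ α, ∑ β, ∑ γ, ∑ δ,
    curvature g z α β γ δ * v α * conj (v β) * w γ * conj (w δ)).re

/-! ### The flat edge model of angle `τ` along `z 0 = 0` -/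

/-- The coefficients of the model
`τ² |z₁|^{2τ-2} i dz₁ ∧ dz̄₁ + ∑_{j ≥ 2} i dz_j ∧ dz̄_j`. -/
def modelEdge {n : ℕ} [NeZero n] (τ : ℝ) (z : Cn n) : Matrix (Fin n) (Fin n) ℂ :=
  Matrix.diagonal fun α => if α = 0 then ((τ ^ 2 * ‖z 0‖ ^ (2 * τ - 2) : ℝ) : ℂ) else 1

/-- The coordinates `(ξ, z₂, …, z_n)` with `ξ = |z₁|^{τ-1} z₁`, in which the cone distance is
comparable to the Euclidean one. -/
def xiCoord {n : ℕ} [NeZero n] (τ : ℝ) (z : Cn n) : Cn n :=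
  WithLp.toLp 2 fun α => if α = 0 then ((‖z 0‖ ^ (τ - 1) : ℝ) : ℂ) * z 0 else z α

/-- With `r = |z₁|^τ` and `ε = dr + i τ r d(arg z₁) = τ |z₁|^τ dz₁ / z₁`, one has
`dz₁ = (z₁ / (τ |z₁|^τ)) ε`. This is the factor of the `α`-th coordinate in the passage from the
coframe `dz₁, …, dz_n` to the coframe `ε, dz₂, …, dz_n`, which is unitary for the model. -/
def frameFactor {n : ℕ} [NeZero n] (τ : ℝ) (z : Cn n) (α : Fin n) : ℂ :=
  if α = 0 then z 0 / ((τ * ‖z 0‖ ^ τ : ℝ) : ℂ) else 1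

/-- The coefficients of the form `∑ i G_{αβ̄} dz_α ∧ dz̄_β` in the coframe
`ε, dz₂, …, dz_n`. -/
def edgeCoeff {n : ℕ} [NeZero n] (τ : ℝ) (G : Cn n → Matrix (Fin n) (Fin n) ℂ) (z : Cn n) :
    Matrix (Fin n) (Fin n) ℂ :=
  Matrix.of fun α β => frameFactor τ z α * G z α β * conj (frameFactor τ z β)

/-- The norm `sup |f| + sup |f(x) - f(y)| / |ξ(x) - ξ(y)|^θ` over `S` of a function on `S`,
i.e. the usual Hölder norm of `f` seen as a function of `(ξ, z₂, …, z_n)`.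
It is infinite when `f` is not of class `C^θ_τ` on `S`. -/
def holderNormOn {n : ℕ} [NeZero n] (τ θ : ℝ) (S : Set (Cn n)) (f : Cn n → ℂ) : ℝ≥0∞ :=
  (⨆ x ∈ S, ‖f x‖ₑ) +
    ⨆ x ∈ S, ⨆ y ∈ S, ‖f x - f y‖ₑ / edist (xiCoord τ x) (xiCoord τ y) ^ θ

/-! ### Real (1,1)-forms on complex manifolds -/

section Manifold

variable {n : ℕ} {M : Type*} [TopologicalSpace M] [ChartedSpace (Cn n) M]

/-- Fields of sesquilinear forms on the holomorphic tangent bundle, `ℂ`-linear in the first and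
conjugate linear in the second variable. The form `i ∑ g_{αβ̄} dz_α ∧ dz̄_β` is identified with
`(v, w) ↦ ∑ g_{αβ̄} v^α conj(w^β)`. -/
abbrev FormField (n : ℕ) (M : Type*) [TopologicalSpace M] [ChartedSpace (Cn n) M] : Type _ :=
  ∀ x : M, TangentSpace 𝓘(ℂ, Cn n) x →ₗ[ℂ] TangentSpace 𝓘(ℂ, Cn n) x →ₗ⋆[ℂ] ℂ

/-- The holomorphic charts of `M`. -/
def holoCharts (n : ℕ) (M : Type*) [TopologicalSpace M] [ChartedSpace (Cn n) M] :
    Set (OpenPartialHomeomorph M (Cn n)) :=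
  IsManifold.maximalAtlas 𝓘(ℂ, Cn n) ω M

/-- The coefficients `g_{αβ̄} = g(∂_α, ∂_β)` in a holomorphic chart. -/
def coeff (g : FormField n M) (e : OpenPartialHomeomorph M (Cn n)) (y : Cn n) :
    Matrix (Fin n) (Fin n) ℂ :=
  Matrix.of fun α β =>
    g (e.symm y) (mfderiv 𝓘(ℂ, Cn n) 𝓘(ℂ, Cn n) e.symm y (basisVec α))
      (mfderiv 𝓘(ℂ, Cn n) 𝓘(ℂ, Cn n) e.symm y (basisVec β))

/-- `dd^c f = i ∂∂̄ f`, i.e. the form with coefficients `∂²f/∂z^α∂z̄^β`. The tangent space at `x`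
is identified with `ℂⁿ` by the preferred chart at `x`. -/
def ddc (f : M → ℝ) : FormField n M := fun x =>
  sesq (complexHessian (fun y => ((f ((chartAt (Cn n) x).symm y) : ℝ) : ℂ)) (chartAt (Cn n) x x))

/-- `g` is (the metric of) a smooth Kähler form on the open set `U`: a smooth positive definite
Hermitian form such that the associated (1,1)-form is closed. -/
structure IsKaehlerOn (g : FormField n M) (U : Set M) : Prop where
  hermitian : ∀ x ∈ U, ∀ v w, g x v w = conj (g x w v)
  pos : ∀ x ∈ U, ∀ v, v ≠ 0 → 0 < (g x v v).re
  smooth : ∀ e ∈ holoCharts n M, ∀ α β,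
    ContDiffOn ℝ ∞ (fun y => coeff g e y α β) (e.target ∩ e.symm ⁻¹' U)
  closed : ∀ e ∈ holoCharts n M, ∀ y ∈ e.target, e.symm y ∈ U → ∀ α β γ,
    wirt γ (fun z => coeff g e z α β) y = wirt α (fun z => coeff g e z γ β) y

/-- `C⁻¹ g' ≤ g ≤ C g'` on the complement of `D`, for some constant `C > 0`. -/
def UniformlyEquivalent (D : Set M) (g g' : FormField n M) : Prop :=
  ∃ C : ℝ, 0 < C ∧ ∀ x, x ∉ D → ∀ v,
    C⁻¹ * (g' x v v).re ≤ (g x v v).re ∧ (g x v v).re ≤ C * (g' x v v).re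

/-- The bisectional curvature of `g` is bounded from below on the complement of `D`:
`R(v, v̄, w, w̄) ≥ - C |v|² |w|²`, with one constant for all holomorphic charts. -/
def BisectionalBoundedBelow (D : Set M) (g : FormField n M) : Prop :=
  ∃ C : ℝ, ∀ e ∈ holoCharts n M, ∀ y ∈ e.target, e.symm y ∉ D → ∀ v w : Cn n,
    - C * ((sesq (coeff g e y) v v).re * (sesq (coeff g e y) w w).re)
      ≤ bisectional (coeff g e) y v w

variable [NeZero n]

/-- Holomorphic charts in which `D` is the hyperplane `z₁ = 0` (charts whose domain does not
meet `D` and on which `z₁` has no zero included). -/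
def IsAdapted (D : Set M) (e : OpenPartialHomeomorph M (Cn n)) : Prop :=
  e ∈ holoCharts n M ∧ ∀ x ∈ e.source, x ∈ D ↔ e x 0 = 0

/-- Edge-cone Kähler metrics of angle `τ` (total angle `2πτ`) along `D`:
smooth Kähler metrics on `M ∖ D` which, in every chart adapted to `D`, are equivalent to the
flat edge model on compact sets, and which at `D` are asymptotic to the product of a cone of total
angle `2πτ` in the normal direction and of a metric on `D`; the limit, a positive definite form
without mixed terms, is smooth along `D`. -/
structure IsEdgeConeKaehler (D : Set M) (τ : ℝ) (g : FormField n M) : Prop where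
  kaehler : IsKaehlerOn g Dᶜ
  model_equiv : ∀ e, IsAdapted D e → ∀ K ⊆ e.source, IsCompact K →
    ∃ C : ℝ, 0 < C ∧ ∀ y ∈ e.target, e.symm y ∈ K → e.symm y ∉ D → ∀ v : Cn n,
      C⁻¹ * (sesq (modelEdge τ y) v v).re ≤ (sesq (coeff g e y) v v).re ∧
        (sesq (coeff g e y) v v).re ≤ C * (sesq (modelEdge τ y) v v).re
  asymptotic : ∀ e, IsAdapted D e → ∃ G : Cn n → Matrix (Fin n) (Fin n) ℂ,
    (∀ α β, ContDiffOn ℝ ∞ (fun y => G y α β) e.target) ∧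
    ∀ y ∈ e.target, y 0 = 0 →
      (G y).PosDef ∧ (∀ α, α ≠ 0 → G y 0 α = 0 ∧ G y α 0 = 0) ∧
      ∀ α β, Tendsto (fun z => edgeCoeff τ (coeff g e) z α β) (𝓝[{z | z 0 ≠ 0}] y) (𝓝 (G y α β))

/-- Finitely many charts adapted to `D` together with compact subsets of their domains that
cover `M`. Such a choice fixes the norm of `C^θ_τ`; two choices give equivalent norms. -/
structure EdgeAtlas (n : ℕ) [NeZero n] {M : Type*} [TopologicalSpace M] [ChartedSpace (Cn n) M]
    (D : Set M) where
  size : ℕ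
  chart : Fin size → OpenPartialHomeomorph M (Cn n)
  adapted : ∀ i, IsAdapted D (chart i)
  core : Fin size → Set M
  core_compact : ∀ i, IsCompact (core i)
  core_subset : ∀ i, core i ⊆ (chart i).source
  core_cover : ⋃ i, core i = univ

/-- The `C^θ_τ` norm of a (1,1)-form on `M ∖ D`: the largest of the `C^θ_τ` norms of its
coefficients in the coframes `ε, dz₂, …, dz_n`. -/
def edgeHolderNorm {D : Set M} (A : EdgeAtlas n D) (τ θ : ℝ) (g : FormField n M) : ℝ≥0∞ :=
  ⨆ i, ⨆ α, ⨆ β,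
    holderNormOn τ θ {y | y ∈ (A.chart i).target ∧ (A.chart i).symm y ∈ A.core i \ D}
      (fun y => edgeCoeff τ (coeff g (A.chart i)) y α β)

/-- The (1,1)-forms of class `C^θ_τ`: the norm is finite, and the coefficients of the mixed terms
`ε ∧ dz̄_j`, `dz_j ∧ ε̄` (`j ≥ 2`) tend to zero at `D`. -/
def MemEdgeHolder {D : Set M} (A : EdgeAtlas n D) (τ θ : ℝ) (g : FormField n M) : Prop :=
  edgeHolderNorm A τ θ g < ⊤ ∧
  ∀ i, ∀ y ∈ (A.chart i).target, y 0 = 0 → ∀ α, α ≠ 0 →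
    Tendsto (fun z => edgeCoeff τ (coeff g (A.chart i)) z 0 α) (𝓝[{z | z 0 ≠ 0}] y) (𝓝 0) ∧
    Tendsto (fun z => edgeCoeff τ (coeff g (A.chart i)) z α 0) (𝓝[{z | z 0 ≠ 0}] y) (𝓝 0)

end Manifold

/-! ### Hermitian line bundles -/

section LineBundle

variable {n : ℕ} {M : Type*} [TopologicalSpace M] [ChartedSpace (Cn n) M]
  (L : M → Type*) [TopologicalSpace (Bundle.TotalSpace ℂ L)] [∀ x, AddCommGroup (L x)]
  [∀ x, Module ℂ (L x)] [∀ x, TopologicalSpace (L x)] [FiberBundle ℂ L] [VectorBundle ℂ ℂ L]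

/-- Smooth Hermitian metrics on a line bundle `L`. Smoothness (in the real sense) is that of
`h(σ, σ)` for the frames `σ` given by the local trivialisations. -/
structure HermitianMetric (n : ℕ) {M : Type*} [TopologicalSpace M] [ChartedSpace (Cn n) M]
    (L : M → Type*) [TopologicalSpace (Bundle.TotalSpace ℂ L)] [∀ x, AddCommGroup (L x)]
    [∀ x, Module ℂ (L x)] [∀ x, TopologicalSpace (L x)] [FiberBundle ℂ L]
    [VectorBundle ℂ ℂ L] where
  form : ∀ x, L x →ₗ[ℂ] L x →ₗ⋆[ℂ] ℂ
  hermitian : ∀ x v w, form x v w = conj (form x w v)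
  pos : ∀ x v, v ≠ 0 → 0 < (form x v v).re
  smooth : ∀ x₀ : M, ContMDiffOn 𝓘(ℝ, Cn n) 𝓘(ℝ, ℂ) ∞
    (fun x => form x ((trivializationAt ℂ L x₀).symm x 1) ((trivializationAt ℂ L x₀).symm x 1))
    (trivializationAt ℂ L x₀).baseSet

variable {L}

/-- The function `|s|_h^{2τ} = (|s|_h²)^τ`. -/
def normPow (h : HermitianMetric n L) (s : ∀ x, L x) (τ : ℝ) (x : M) : ℝ :=
  (h.form x (s x) (s x)).re ^ τ

/-- `s` is a holomorphic section of `L`. -/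
def IsHolomorphicSection (n : ℕ) {M : Type*} [TopologicalSpace M] [ChartedSpace (Cn n) M]
    {L : M → Type*} [TopologicalSpace (Bundle.TotalSpace ℂ L)] [∀ x, AddCommGroup (L x)]
    [∀ x, Module ℂ (L x)] [∀ x, TopologicalSpace (L x)] [FiberBundle ℂ L]
    [VectorBundle ℂ ℂ L] (s : ∀ x, L x) : Prop :=
  ContMDiff 𝓘(ℂ, Cn n) (𝓘(ℂ, Cn n).prod 𝓘(ℂ, ℂ)) ω
    (fun x => (⟨x, s x⟩ : Bundle.TotalSpace ℂ L))

/-- `D` is the zero set of the section `s`, and `s` vanishes to first order along `D`: in a local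
trivialisation its differential has no zero on `D`. In particular `D` is a smooth complex
hypersurface. -/
def VanishesSimplyAlong (n : ℕ) {M : Type*} [TopologicalSpace M] [ChartedSpace (Cn n) M]
    {L : M → Type*} [TopologicalSpace (Bundle.TotalSpace ℂ L)] [∀ x, AddCommGroup (L x)]
    [∀ x, Module ℂ (L x)] [∀ x, TopologicalSpace (L x)] [FiberBundle ℂ L]
    [VectorBundle ℂ ℂ L] (s : ∀ x, L x) (D : Set M) : Prop :=
  D = {x | s x = 0} ∧
  ∀ x ∈ D, mfderiv 𝓘(ℂ, Cn n) 𝓘(ℂ, ℂ)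
    (fun y => (trivializationAt ℂ L x (⟨y, s y⟩ : Bundle.TotalSpace ℂ L)).2) x ≠ 0

/-- `ω_τ = ω₀ + 𝔞 dd^c |s|_h^{2τ}`. -/
def edgeForm (ω₀ : FormField n M) (h : HermitianMetric n L) (s : ∀ x, L x) (τ 𝔞 : ℝ) :
    FormField n M :=
  ω₀ + 𝔞 • ddc (normPow h s τ)

/-- `ω̃ = ω₀ + 𝔞 dd^c |s|_h^{2τ} - 𝔠 dd^c |s|_h^{2τ'}`. -/
def goodForm (ω₀ : FormField n M) (h : HermitianMetric n L) (s : ∀ x, L x) (τ τ' 𝔞 𝔠 : ℝ) :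
    FormField n M :=
  ω₀ + 𝔞 • ddc (normPow h s τ) - 𝔠 • ddc (normPow h s τ')

end LineBundle

end EdgeCone

end

open Set Filter Topology
open scoped Manifold ContDiff ENNReal ComplexConjugate ComplexOrder

noncomputable section

/-! Put φ = log |s|_h². In an adapted chart φ = log |z₁|² + log H with H smooth and positive
(`exists_factor`). As log |z₁|² is pluriharmonic off D, ∂∂̄φ extends smoothly across D
(`levi_logN`), and all the singularity sits in ∂φ = dz₁/z₁ + ∂ log H. Since |s|_h^{2σ} = e^{σφ}, the
metric is ω̃ = ω₀ + F'(φ) ∂∂̄φ + F''(φ) ∂φ ⊗ ∂̄φ with F(t) = 𝔞 e^{τt} - 𝔠 e^{τ't}.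

The edge-cone property follows from this formula. The form |v|² + e^{τφ} |∂φ(v)|² is comparable with
the flat edge model (`exists_edgeSq_le_model`, `exists_model_le_edgeSq`). The Levi term is dominated
by ω₀, hence harmless for small 𝔞, and dd^c |s|^{2τ'} is dominated by ω_τ because e^{τ'φ} is at most
a constant times e^{τφ}. In the coframe ε, dz₂, …, dz_n the coefficients of dd^c |s|^{2σ} are
|z₁|^{2σ-2τ} times functions continuous up to D (`edgeCoeff_eq_powerExpr`). This gives the limits at
D. It also gives the Hölder estimate: |z₁|^{2τ'-2τ} is θ-Hölder in (ξ, z₂, …, z_n) as soon as τθ ≤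
2τ' - 2τ, and the difference of the two metrics is -𝔠 times a fixed form.

The curvature bound rests on a variational principle (`neg_discHessian_le_bisectional`). Completing
the square in the inverse metric shows that R(v, v̄, w, w̄) is at least minus the mixed second
derivative at 0 of g(V, V) along the disc ζ ↦ z + ζw, where V = v + ζb and b is free. It therefore
suffices to exhibit, for all v and w, one b for which this derivative is at most K |v|² |w|². No
inverse matrix has to be estimated.

Write q = ∂φ(w), u = ∂φ(v) and κ = ∂_w(∂φ(v)) + ∂φ(b). The dangerous terms are F''''|q|²|u|² + 2F'''
Re(q u κ̄) + F''|κ|² = F'' |κ + (F'''/F'') q u|² + (F'''' - F'''²/F'') |q|²|u|². A multiple b of z₁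
∂/∂z₁ makes κ + (F'''/F'') q u equal to the bounded quantity ∂ log H(b). The price is an error in
|b|², of size |z₁|² |q|²|u|² ~ e^φ |q|²|u|² at worst. For 𝔠 = 0 the last coefficient vanishes, and
this error need not be dominated by the available e^{2τφ}|q|²|u|² when τ > 1/2. The term with 𝔠
makes that coefficient at most a negative multiple of e^{τ'φ} (`expDiff_concavity`). As τ' < 1, e^φ
is negligible against e^{τ'φ} near D, and the error is absorbed (`exists_exp_absorb`,
`discHessian_edge_le`). Compactness and the transformation law `discHessian_pullback` carry the
local bound to all holomorphic charts. -/

namespace EdgeCone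

/-! ### Directional Wirtinger operators -/

section Wirtinger

variable {n m : ℕ}

/-- The derivative of type `(1,0)` in the direction `w`. -/
def dH (w : Cn n) (f : Cn n → ℂ) (z : Cn n) : ℂ :=
  (fderiv ℝ f z w - Complex.I * fderiv ℝ f z (Complex.I • w)) / 2

/-- The derivative of type `(0,1)` in the direction `w`, conjugate linear in `w`. -/
def dB (w : Cn n) (f : Cn n → ℂ) (z : Cn n) : ℂ :=
  (fderiv ℝ f z w + Complex.I * fderiv ℝ f z (Complex.I • w)) / 2

theorem wirt_eq_dH (α : Fin n) (f : Cn n → ℂ) : wirt α f = dH (basisVec α) f := rfl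

theorem wirtBar_eq_dB (α : Fin n) (f : Cn n → ℂ) : wirtBar α f = dB (basisVec α) f := rfl

theorem complexHessian_apply (f : Cn n → ℂ) (z : Cn n) (α β : Fin n) :
    complexHessian f z α β = dH (basisVec α) (dB (basisVec β) f) z := rfl

theorem dH_congr {f g : Cn n → ℂ} {z : Cn n} (h : f =ᶠ[𝓝 z] g) (w : Cn n) :
    dH w f z = dH w g z := by
  simp only [dH, h.fderiv_eq]

theorem dB_congr {f g : Cn n → ℂ} {z : Cn n} (h : f =ᶠ[𝓝 z] g) (w : Cn n) :
    dB w f z = dB w g z := by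
  simp only [dB, h.fderiv_eq]

theorem dH_congr_on {f g : Cn n → ℂ} {U : Set (Cn n)} (hU : IsOpen U) (h : EqOn f g U)
    {z : Cn n} (hz : z ∈ U) (w : Cn n) : dH w f z = dH w g z :=
  dH_congr (h.eventuallyEq_of_mem (hU.mem_nhds hz)) w

theorem dB_congr_on {f g : Cn n → ℂ} {U : Set (Cn n)} (hU : IsOpen U) (h : EqOn f g U)
    {z : Cn n} (hz : z ∈ U) (w : Cn n) : dB w f z = dB w g z :=
  dB_congr (h.eventuallyEq_of_mem (hU.mem_nhds hz)) w

theorem smul_eq_re_im (c : ℂ) (w : Cn n) : c • w = c.re • w + c.im • (Complex.I • w) := by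
  ext i
  simp only [PiLp.smul_apply, PiLp.add_apply, smul_eq_mul, Complex.real_smul]
  linear_combination (-(w i)) * Complex.re_add_im c

theorem I_smul_I_smul (w : Cn n) : Complex.I • (Complex.I • w) = -w := by
  rw [smul_smul, Complex.I_mul_I, neg_one_smul]

theorem dH_dir_add (w w' : Cn n) (f : Cn n → ℂ) (z : Cn n) :
    dH (w + w') f z = dH w f z + dH w' f z := by
  simp only [dH, smul_add, map_add]; ring

theorem dB_dir_add (w w' : Cn n) (f : Cn n → ℂ) (z : Cn n) :
    dB (w + w') f z = dB w f z + dB w' f z := by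
  simp only [dB, smul_add, map_add]; ring

theorem dH_dir_smul (c : ℂ) (w : Cn n) (f : Cn n → ℂ) (z : Cn n) :
    dH (c • w) f z = c * dH w f z := by
  have h2 : Complex.I • (c • w) = c.re • (Complex.I • w) + c.im • (-w) := by
    rw [smul_comm, smul_eq_re_im c (Complex.I • w), I_smul_I_smul]
  simp only [dH, h2]
  rw [smul_eq_re_im c w]
  simp only [map_add, map_smul, map_neg, Complex.real_smul]
  set a := fderiv ℝ f z w
  set b := fderiv ℝ f z (Complex.I • w)
  linear_combination (1 / 2 : ℂ) * (a - Complex.I * b) * (Complex.re_add_im c)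
    + ((c.im : ℂ) * b / 2) * Complex.I_mul_I

theorem dB_dir_smul (c : ℂ) (w : Cn n) (f : Cn n → ℂ) (z : Cn n) :
    dB (c • w) f z = conj c * dB w f z := by
  have h2 : Complex.I • (c • w) = c.re • (Complex.I • w) + c.im • (-w) := by
    rw [smul_comm, smul_eq_re_im c (Complex.I • w), I_smul_I_smul]
  have h3 : conj c = c.re - c.im * Complex.I := by
    apply Complex.ext <;> simp
  simp only [dB, h2]
  rw [smul_eq_re_im c w, h3]
  simp only [map_add, map_smul, map_neg, Complex.real_smul]
  set a := fderiv ℝ f z w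
  set b := fderiv ℝ f z (Complex.I • w)
  linear_combination ((c.im : ℂ) * b / 2) * Complex.I_mul_I

theorem sum_smul_basisVec (w : Cn n) : ∑ α, w α • (basisVec α : Cn n) = w := by
  ext i
  simp [basisVec, Finset.sum_apply, Pi.single_apply]

/-- `dH` as a linear map in the direction. -/
def dHLin (f : Cn n → ℂ) (z : Cn n) : Cn n →ₗ[ℂ] ℂ where
  toFun w := dH w f z
  map_add' w w' := dH_dir_add w w' f z
  map_smul' c w := dH_dir_smul c w f z

/-- `dB` as a conjugate linear map in the direction. -/
def dBLin (f : Cn n → ℂ) (z : Cn n) : Cn n →ₗ⋆[ℂ] ℂ where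
  toFun w := dB w f z
  map_add' w w' := dB_dir_add w w' f z
  map_smul' c w := dB_dir_smul c w f z

theorem dH_eq_sum (w : Cn n) (f : Cn n → ℂ) (z : Cn n) :
    dH w f z = ∑ α, w α * dH (basisVec α) f z := by
  conv_lhs => rw [← sum_smul_basisVec w]
  change dHLin f z _ = _
  simp only [map_sum, map_smul, smul_eq_mul]; rfl

theorem dB_eq_sum (w : Cn n) (f : Cn n → ℂ) (z : Cn n) :
    dB w f z = ∑ α, conj (w α) * dB (basisVec α) f z := by
  conv_lhs => rw [← sum_smul_basisVec w]
  change dBLin f z _ = _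
  simp only [map_sum, LinearMap.map_smulₛₗ, smul_eq_mul]; rfl

section Rules

variable {f g : Cn n → ℂ} {z : Cn n} (w : Cn n)

theorem dH_add (hf : DifferentiableAt ℝ f z) (hg : DifferentiableAt ℝ g z) :
    dH w (fun y => f y + g y) z = dH w f z + dH w g z := by
  simp only [dH, fderiv_fun_add hf hg, _root_.add_apply]; ring

theorem dB_add (hf : DifferentiableAt ℝ f z) (hg : DifferentiableAt ℝ g z) :
    dB w (fun y => f y + g y) z = dB w f z + dB w g z := by
  simp only [dB, fderiv_fun_add hf hg, _root_.add_apply]; ring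

theorem dH_mul (hf : DifferentiableAt ℝ f z) (hg : DifferentiableAt ℝ g z) :
    dH w (fun y => f y * g y) z = dH w f z * g z + f z * dH w g z := by
  simp only [dH, fderiv_fun_mul hf hg, _root_.add_apply,
    _root_.smul_apply, smul_eq_mul]; ring

theorem dB_mul (hf : DifferentiableAt ℝ f z) (hg : DifferentiableAt ℝ g z) :
    dB w (fun y => f y * g y) z = dB w f z * g z + f z * dB w g z := by
  simp only [dB, fderiv_fun_mul hf hg, _root_.add_apply,
    _root_.smul_apply, smul_eq_mul]; ring

theorem dH_const (c : ℂ) : dH w (fun _ => c) z = 0 := by simp [dH]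

theorem dB_const (c : ℂ) : dB w (fun _ => c) z = 0 := by simp [dB]

theorem dH_const_mul (c : ℂ) (hf : DifferentiableAt ℝ f z) :
    dH w (fun y => c * f y) z = c * dH w f z := by
  rw [dH_mul w (differentiableAt_const c) hf, dH_const, zero_mul, zero_add]

theorem fderiv_conj_apply (hf : DifferentiableAt ℝ f z) (v : Cn n) :
    fderiv ℝ (fun y => conj (f y)) z v = conj (fderiv ℝ f z v) := by
  have h := (Complex.conjCLE.toContinuousLinearMap.hasFDerivAt (x := f z)).comp z hf.hasFDerivAt
  have h' : fderiv ℝ (fun y => conj (f y)) z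
      = (Complex.conjCLE.toContinuousLinearMap).comp (fderiv ℝ f z) := by
    simpa [Function.comp_def] using h.fderiv
  rw [h']; simp

theorem dH_conj (hf : DifferentiableAt ℝ f z) :
    dH w (fun y => conj (f y)) z = conj (dB w f z) := by
  simp only [dH, dB, fderiv_conj_apply hf, map_div₀, map_add, map_mul, Complex.conj_I, map_ofNat]
  ring

theorem dB_conj (hf : DifferentiableAt ℝ f z) :
    dB w (fun y => conj (f y)) z = conj (dH w f z) := by
  simp only [dH, dB, fderiv_conj_apply hf, map_div₀, map_sub, map_mul, Complex.conj_I, map_ofNat]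
  ring

theorem dH_finsum {ι : Type*} (s : Finset ι) {F : ι → Cn n → ℂ}
    (hF : ∀ i ∈ s, DifferentiableAt ℝ (F i) z) :
    dH w (fun y => ∑ i ∈ s, F i y) z = ∑ i ∈ s, dH w (F i) z := by
  simp only [dH, fderiv_fun_sum hF, _root_.sum_apply, Finset.mul_sum,
    ← Finset.sum_sub_distrib, ← Finset.sum_div]

theorem dB_finsum {ι : Type*} (s : Finset ι) {F : ι → Cn n → ℂ}
    (hF : ∀ i ∈ s, DifferentiableAt ℝ (F i) z) :
    dB w (fun y => ∑ i ∈ s, F i y) z = ∑ i ∈ s, dB w (F i) z := by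
  simp only [dB, fderiv_fun_sum hF, _root_.sum_apply, Finset.mul_sum,
    ← Finset.sum_add_distrib, ← Finset.sum_div]

/-- The chain rule for a real function of a real function. -/
theorem fderiv_ofReal_comp {φ : Cn n → ℝ} {F : ℝ → ℝ} {F' : ℝ} (hF : HasDerivAt F F' (φ z))
    (hφ : DifferentiableAt ℝ φ z) (v : Cn n) :
    fderiv ℝ (fun y => ((F (φ y) : ℝ) : ℂ)) z v
      = (F' : ℂ) * fderiv ℝ (fun y => ((φ y : ℝ) : ℂ)) z v := by
  have h1 := Complex.ofRealCLM.hasFDerivAt.comp z (hF.hasFDerivAt.comp z hφ.hasFDerivAt)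
  have h2 := Complex.ofRealCLM.hasFDerivAt.comp z hφ.hasFDerivAt
  have h1' : fderiv ℝ (fun y => ((F (φ y) : ℝ) : ℂ)) z = _ := h1.fderiv
  have h2' : fderiv ℝ (fun y => ((φ y : ℝ) : ℂ)) z = _ := h2.fderiv
  rw [h1', h2']
  simp [mul_comm]

theorem dH_ofReal_comp {φ : Cn n → ℝ} {F : ℝ → ℝ} {F' : ℝ} (hF : HasDerivAt F F' (φ z))
    (hφ : DifferentiableAt ℝ φ z) :
    dH w (fun y => ((F (φ y) : ℝ) : ℂ)) z = (F' : ℂ) * dH w (fun y => ((φ y : ℝ) : ℂ)) z := by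
  simp only [dH, fderiv_ofReal_comp hF hφ]; ring

theorem dB_ofReal_comp {φ : Cn n → ℝ} {F : ℝ → ℝ} {F' : ℝ} (hF : HasDerivAt F F' (φ z))
    (hφ : DifferentiableAt ℝ φ z) :
    dB w (fun y => ((F (φ y) : ℝ) : ℂ)) z = (F' : ℂ) * dB w (fun y => ((φ y : ℝ) : ℂ)) z := by
  simp only [dB, fderiv_ofReal_comp hF hφ]; ring

theorem dB_holo {f : Cn n → ℂ} (hf : DifferentiableAt ℂ f z) : dB w f z = 0 := by
  simp only [dB, hf.fderiv_restrictScalars ℝ, ContinuousLinearMap.coe_restrictScalars', map_smul,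
    smul_eq_mul]
  linear_combination (fderiv ℂ f z w / 2) * Complex.I_mul_I

theorem dH_holo {f : Cn n → ℂ} (hf : DifferentiableAt ℂ f z) : dH w f z = fderiv ℂ f z w := by
  simp only [dH, hf.fderiv_restrictScalars ℝ, ContinuousLinearMap.coe_restrictScalars', map_smul,
    smul_eq_mul]
  linear_combination (-(fderiv ℂ f z w) / 2) * Complex.I_mul_I

theorem fderiv_comp_holo {Φ : Cn n → Cn m} {f : Cn m → ℂ} (hΦ : DifferentiableAt ℂ Φ z)
    (hf : DifferentiableAt ℝ f (Φ z)) (v : Cn n) :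
    fderiv ℝ (fun y => f (Φ y)) z v = fderiv ℝ f (Φ z) (fderiv ℂ Φ z v) := by
  have h := hf.hasFDerivAt.comp z (hΦ.hasFDerivAt.restrictScalars ℝ)
  have h' : fderiv ℝ (fun y => f (Φ y)) z = _ := h.fderiv
  rw [h']; rfl

theorem dH_comp_holo {Φ : Cn n → Cn m} {f : Cn m → ℂ} (hΦ : DifferentiableAt ℂ Φ z)
    (hf : DifferentiableAt ℝ f (Φ z)) :
    dH w (fun y => f (Φ y)) z = dH (fderiv ℂ Φ z w) f (Φ z) := by
  simp only [dH, fderiv_comp_holo hΦ hf, map_smul]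

theorem dB_comp_holo {Φ : Cn n → Cn m} {f : Cn m → ℂ} (hΦ : DifferentiableAt ℂ Φ z)
    (hf : DifferentiableAt ℝ f (Φ z)) :
    dB w (fun y => f (Φ y)) z = dB (fderiv ℂ Φ z w) f (Φ z) := by
  simp only [dB, fderiv_comp_holo hΦ hf, map_smul]

end Rules

section Smooth

variable {f : Cn n → ℂ} {U : Set (Cn n)}

theorem contDiffOn_fderiv_apply (hU : IsOpen U) (hf : ContDiffOn ℝ ∞ f U) (v : Cn n) :
    ContDiffOn ℝ ∞ (fun z => fderiv ℝ f z v) U :=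
  (hf.fderiv_of_isOpen hU (by simp)).clm_apply contDiffOn_const

theorem contDiffOn_dH (hU : IsOpen U) (hf : ContDiffOn ℝ ∞ f U) (w : Cn n) :
    ContDiffOn ℝ ∞ (dH w f) U :=
  ((contDiffOn_fderiv_apply hU hf w).sub
    (contDiffOn_const.mul (contDiffOn_fderiv_apply hU hf _))).div_const 2

theorem contDiffOn_dB (hU : IsOpen U) (hf : ContDiffOn ℝ ∞ f U) (w : Cn n) :
    ContDiffOn ℝ ∞ (dB w f) U :=
  ((contDiffOn_fderiv_apply hU hf w).add
    (contDiffOn_const.mul (contDiffOn_fderiv_apply hU hf _))).div_const 2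

theorem contDiffOn_conj (hf : ContDiffOn ℝ ∞ f U) :
    ContDiffOn ℝ ∞ (fun z => conj (f z)) U :=
  Complex.conjCLE.contDiff.comp_contDiffOn hf

theorem contDiffOn_ofReal {φ : Cn n → ℝ} (hf : ContDiffOn ℝ ∞ φ U) :
    ContDiffOn ℝ ∞ (fun z => ((φ z : ℝ) : ℂ)) U :=
  Complex.ofRealCLM.contDiff.comp_contDiffOn hf

theorem differentiableAt_of_smooth {E F : Type*} [NormedAddCommGroup E] [NormedSpace ℝ E]
    [NormedAddCommGroup F] [NormedSpace ℝ F] {f : E → F} {U : Set E} (hU : IsOpen U)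
    (hf : ContDiffOn ℝ ∞ f U) {z : E} (hz : z ∈ U) :
    DifferentiableAt ℝ f z :=
  (hf.contDiffAt (hU.mem_nhds hz)).differentiableAt (by simp)

theorem fderiv_fderiv_comm (hU : IsOpen U) (hf : ContDiffOn ℝ ∞ f U) {z : Cn n} (hz : z ∈ U)
    (v w : Cn n) :
    fderiv ℝ (fun y => fderiv ℝ f y v) z w = fderiv ℝ (fun y => fderiv ℝ f y w) z v := by
  have hd : DifferentiableAt ℝ (fderiv ℝ f) z :=
    differentiableAt_of_smooth hU (hf.fderiv_of_isOpen hU (by simp)) hz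
  have h (v w : Cn n) : fderiv ℝ (fun y => fderiv ℝ f y v) z w
      = fderiv ℝ (fderiv ℝ f) z w v := by
    rw [fderiv_clm_apply hd (differentiableAt_const v)]; simp
  rw [h, h]
  have hs : IsSymmSndFDerivAt ℝ f z :=
    (hf.contDiffAt (hU.mem_nhds hz)).isSymmSndFDerivAt (by
      simp only [minSmoothness_of_isRCLikeNormedField]
      exact WithTop.coe_le_coe.2 le_top)
  exact hs w v

theorem fderiv_lin_comb (hU : IsOpen U) (hf : ContDiffOn ℝ ∞ f U) {z : Cn n} (hz : z ∈ U)
    (c : ℂ) (v v' w : Cn n) :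
    fderiv ℝ (fun y => (fderiv ℝ f y v + c * fderiv ℝ f y v') / 2) z w
      = (fderiv ℝ (fun y => fderiv ℝ f y v) z w
        + c * fderiv ℝ (fun y => fderiv ℝ f y v') z w) / 2 := by
  have h1 := differentiableAt_of_smooth hU (contDiffOn_fderiv_apply hU hf v) hz
  have h2 := differentiableAt_of_smooth hU (contDiffOn_fderiv_apply hU hf v') hz
  have h3 : HasFDerivAt (fun y => (fderiv ℝ f y v + c * fderiv ℝ f y v') / 2)
      ((2 : ℂ)⁻¹ • (fderiv ℝ (fun y => fderiv ℝ f y v) z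
        + c • fderiv ℝ (fun y => fderiv ℝ f y v') z)) z := by
    have := (h1.hasFDerivAt.add (h2.hasFDerivAt.const_mul c)).const_mul (2 : ℂ)⁻¹
    refine this.congr_of_eventuallyEq (Eventually.of_forall fun y => ?_)
    simp [div_eq_inv_mul]
  rw [h3.fderiv]
  simp [div_eq_inv_mul, mul_add]

theorem dH_dB_comm (hU : IsOpen U) (hf : ContDiffOn ℝ ∞ f U) {z : Cn n} (hz : z ∈ U)
    (v w : Cn n) : dH v (dB w f) z = dB w (dH v f) z := by
  have e1 : dB w f = fun y => (fderiv ℝ f y w + Complex.I * fderiv ℝ f y (Complex.I • w)) / 2 := rfl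
  have e2 : dH v f = fun y => (fderiv ℝ f y v + (-Complex.I) * fderiv ℝ f y (Complex.I • v)) / 2 := by
    ext y; simp only [dH]; ring
  rw [e1, e2]
  simp only [dH, dB, fderiv_lin_comb hU hf hz]
  rw [fderiv_fderiv_comm hU hf hz w v, fderiv_fderiv_comm hU hf hz (Complex.I • w) v,
    fderiv_fderiv_comm hU hf hz w (Complex.I • v),
    fderiv_fderiv_comm hU hf hz (Complex.I • w) (Complex.I • v)]
  ring

theorem dH_dH_comm (hU : IsOpen U) (hf : ContDiffOn ℝ ∞ f U) {z : Cn n} (hz : z ∈ U)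
    (v w : Cn n) : dH v (dH w f) z = dH w (dH v f) z := by
  have e2 (v : Cn n) :
      dH v f = fun y => (fderiv ℝ f y v + (-Complex.I) * fderiv ℝ f y (Complex.I • v)) / 2 := by
    ext y; simp only [dH]; ring
  rw [e2 v, e2 w]
  simp only [dH, fderiv_lin_comb hU hf hz]
  rw [fderiv_fderiv_comm hU hf hz w v, fderiv_fderiv_comm hU hf hz (Complex.I • w) v,
    fderiv_fderiv_comm hU hf hz w (Complex.I • v),
    fderiv_fderiv_comm hU hf hz (Complex.I • w) (Complex.I • v)]
  ring

end Smooth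

/-! ### Sesquilinear forms -/

theorem sesq_apply (G : Matrix (Fin n) (Fin n) ℂ) (v w : Cn n) :
    sesq G v w = ∑ α, ∑ β, G α β * v α * conj (w β) := rfl

theorem sesq_basisVec (G : Matrix (Fin n) (Fin n) ℂ) (α β : Fin n) :
    sesq G (basisVec α) (basisVec β) = G α β := by
  rw [sesq_apply, Finset.sum_eq_single α, Finset.sum_eq_single β]
  · simp [basisVec]
  · intro b _ hb; simp [basisVec, hb]
  · simp
  · intro b _ hb; simp [basisVec, hb]
  · simp

theorem sesq_add (G G' : Matrix (Fin n) (Fin n) ℂ) (v w : Cn n) :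
    sesq (G + G') v w = sesq G v w + sesq G' v w := by
  simp only [sesq_apply, Matrix.add_apply, add_mul, Finset.sum_add_distrib]

theorem sesq_smul (c : ℂ) (G : Matrix (Fin n) (Fin n) ℂ) (v w : Cn n) :
    sesq (c • G) v w = c * sesq G v w := by
  simp only [sesq_apply, Matrix.smul_apply, smul_eq_mul, Finset.mul_sum, mul_assoc]

theorem sesq_of_form (B : Cn n →ₗ[ℂ] Cn n →ₗ⋆[ℂ] ℂ) (v w : Cn n) :
    sesq (Matrix.of fun α β => B (basisVec α) (basisVec β)) v w = B v w := by
  conv_rhs => rw [← sum_smul_basisVec v, ← sum_smul_basisVec w]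
  simp only [map_sum, LinearMap.map_smulₛₗ, map_smul, LinearMap.sum_apply, LinearMap.smul_apply,
    smul_eq_mul, sesq_apply, Matrix.of_apply, Finset.mul_sum]
  rw [Finset.sum_comm]
  refine Finset.sum_congr rfl fun α _ => Finset.sum_congr rfl fun β _ => by ring

theorem sesq_conj_of_hermitian {G : Matrix (Fin n) (Fin n) ℂ} (hG : ∀ α β, G α β = conj (G β α))
    (v w : Cn n) : sesq G v w = conj (sesq G w v) := by
  simp only [sesq_apply, map_sum, map_mul, Complex.conj_conj]
  rw [Finset.sum_comm]
  refine Finset.sum_congr rfl fun α _ => Finset.sum_congr rfl fun β _ => ?_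
  rw [hG β α]; ring

theorem sesq_self_im {G : Matrix (Fin n) (Fin n) ℂ} (hG : ∀ α β, G α β = conj (G β α))
    (v : Cn n) : ((sesq G v v).re : ℂ) = sesq G v v := by
  have h := sesq_conj_of_hermitian hG v v
  exact (Complex.conj_eq_iff_re.1 h.symm)

/-- The complex Hessian of the definitions is expanded in coordinate vectors. Passing to arbitrary
directions allows the later computations to avoid indices. -/
theorem sesq_complexHessian {f : Cn n → ℂ} {U : Set (Cn n)} (hU : IsOpen U)
    (hf : ContDiffOn ℝ ∞ f U) {z : Cn n} (hz : z ∈ U) (v w : Cn n) :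
    sesq (complexHessian f z) v w = dH v (dB w f) z := by
  have e : dB w f = fun y => ∑ β, conj (w β) * dB (basisVec β) f y := funext fun y => dB_eq_sum w f y
  rw [dH_eq_sum, sesq_apply]
  refine Finset.sum_congr rfl fun α _ => ?_
  rw [e, dH_finsum _ _ fun β _ => ?_, Finset.mul_sum]
  · refine Finset.sum_congr rfl fun β _ => ?_
    rw [dH_const_mul, complexHessian_apply]
    · ring
    · exact differentiableAt_of_smooth hU (contDiffOn_dB hU hf _) hz
  · exact (differentiableAt_of_smooth hU (contDiffOn_dB hU hf _) hz).const_mul _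

end Wirtinger

/-! ### Functions of a real potential -/

section Potential

variable {n : ℕ} {φ : Cn n → ℝ} {W : Set (Cn n)} {z : Cn n}

/-- The `(1,0)`-form `∂φ` of a real function. -/
def del (φ : Cn n → ℝ) (v z : Cn n) : ℂ := dH v (fun y => (φ y : ℂ)) z

/-- The sesquilinear form of `∂∂̄φ` for a real function `φ`. -/
def levi (φ : Cn n → ℝ) (v w z : Cn n) : ℂ := dB w (del φ v) z

theorem contDiffOn_del (hW : IsOpen W) (hφ : ContDiffOn ℝ ∞ φ W) (v : Cn n) :
    ContDiffOn ℝ ∞ (del φ v) W := contDiffOn_dH hW (contDiffOn_ofReal hφ) v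

theorem contDiffOn_levi (hW : IsOpen W) (hφ : ContDiffOn ℝ ∞ φ W) (v w : Cn n) :
    ContDiffOn ℝ ∞ (levi φ v w) W := contDiffOn_dB hW (contDiffOn_del hW hφ v) w

theorem dB_ofReal (hW : IsOpen W) (hφ : ContDiffOn ℝ ∞ φ W) (hz : z ∈ W) (w : Cn n) :
    dB w (fun y => (φ y : ℂ)) z = conj (del φ w z) := by
  rw [del, ← dB_conj _ (differentiableAt_of_smooth hW (contDiffOn_ofReal hφ) hz)]
  simp

theorem levi_eq (hW : IsOpen W) (hφ : ContDiffOn ℝ ∞ φ W) (hz : z ∈ W) (v w : Cn n) :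
    levi φ v w z = dH v (dB w (fun y => (φ y : ℂ))) z :=
  (dH_dB_comm hW (contDiffOn_ofReal hφ) hz v w).symm

theorem sesq_complexHessian_eq_levi (hW : IsOpen W) (hφ : ContDiffOn ℝ ∞ φ W) (hz : z ∈ W)
    (v w : Cn n) : sesq (complexHessian (fun y => (φ y : ℂ)) z) v w = levi φ v w z := by
  rw [sesq_complexHessian hW (contDiffOn_ofReal hφ) hz, levi_eq hW hφ hz]

theorem dB_conj_del (hW : IsOpen W) (hφ : ContDiffOn ℝ ∞ φ W) (hz : z ∈ W) (v w : Cn n) :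
    dB w (fun y => conj (del φ v y)) z = conj (dH w (del φ v) z) :=
  dB_conj _ (differentiableAt_of_smooth hW (contDiffOn_del hW hφ v) hz)

theorem dH_conj_del (hW : IsOpen W) (hφ : ContDiffOn ℝ ∞ φ W) (hz : z ∈ W) (v w : Cn n) :
    dH w (fun y => conj (del φ v y)) z = conj (levi φ v w z) :=
  dH_conj _ (differentiableAt_of_smooth hW (contDiffOn_del hW hφ v) hz)

/-- A real function has ∂̄φ = conj ∂φ, and ∂ commutes with ∂̄, so conjugation swaps the two
directions. -/
theorem levi_conj (hW : IsOpen W) (hφ : ContDiffOn ℝ ∞ φ W) (hz : z ∈ W) (v w : Cn n) :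
    conj (levi φ v w z) = levi φ w v z := by
  rw [levi_eq hW hφ hz w v, ← dH_conj_del hW hφ hz]
  exact dH_congr_on hW (fun y hy => (dB_ofReal hW hφ hy v).symm) hz w

theorem del_comp (hW : IsOpen W) (hφ : ContDiffOn ℝ ∞ φ W) (hz : z ∈ W) {E E' : ℝ → ℝ}
    (hE : ∀ t, HasDerivAt E (E' t) t) (v : Cn n) :
    del (fun y => E (φ y)) v z = (E' (φ z) : ℂ) * del φ v z :=
  dH_ofReal_comp v (hE _) (differentiableAt_of_smooth hW hφ hz)

theorem dB_real_comp (hW : IsOpen W) (hφ : ContDiffOn ℝ ∞ φ W) (hz : z ∈ W) {E E' : ℝ → ℝ}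
    (hE : ∀ t, HasDerivAt E (E' t) t) (v : Cn n) :
    dB v (fun y => (E (φ y) : ℂ)) z = (E' (φ z) : ℂ) * conj (del φ v z) := by
  rw [dB_ofReal_comp v (hE _) (differentiableAt_of_smooth hW hφ hz), dB_ofReal hW hφ hz]

theorem contDiffOn_exp_mul (hφ : ContDiffOn ℝ ∞ φ W) (σ : ℝ) :
    ContDiffOn ℝ ∞ (fun y => Real.exp (σ * φ y)) W :=
  Real.contDiff_exp.comp_contDiffOn (contDiffOn_const.mul hφ)

/-- With φ = log |s|² this computes dd^c |s|^{2σ} for every exponent σ at once, as a Levi term plus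
a rank one term. -/
theorem levi_exp (hW : IsOpen W) (hφ : ContDiffOn ℝ ∞ φ W) (hz : z ∈ W) (σ : ℝ) (v w : Cn n) :
    levi (fun y => Real.exp (σ * φ y)) v w z = (Real.exp (σ * φ z) : ℂ) *
      (σ * levi φ v w z + σ ^ 2 * (del φ v z * conj (del φ w z))) := by
  have hE (t : ℝ) : HasDerivAt (fun t => Real.exp (σ * t)) (σ * Real.exp (σ * t)) t := by
    have := ((hasDerivAt_id t).const_mul σ).exp
    simpa [mul_comm] using this
  have hE' (t : ℝ) : HasDerivAt (fun t => σ * Real.exp (σ * t)) (σ * (σ * Real.exp (σ * t))) t :=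
    (hE t).const_mul σ
  have h1 : EqOn (del (fun y => Real.exp (σ * φ y)) v)
      (fun y => ((σ * Real.exp (σ * φ y) : ℝ) : ℂ) * del φ v y) W :=
    fun y hy => del_comp hW hφ hy hE v
  rw [levi, dB_congr_on hW h1 hz, dB_mul, dB_real_comp hW hφ hz hE', levi]
  · push_cast; ring
  · exact differentiableAt_of_smooth hW
      (contDiffOn_ofReal (contDiffOn_const.mul (contDiffOn_exp_mul hφ σ))) hz
  · exact differentiableAt_of_smooth hW (contDiffOn_del hW hφ v) hz

end Potential

/-! ### The potential `log (|z₁|² H)` -/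

section LogPotential

variable {n : ℕ} {H : Cn n → ℝ} {U : Set (Cn n)} {z : Cn n}

/-- The function `log H`. -/
def logH (H : Cn n → ℝ) (z : Cn n) : ℝ := Real.log (H z)

theorem contDiff_coord (α : Fin n) : ContDiff ℝ ∞ (fun z : Cn n => z α) :=
  ((EuclideanSpace.proj (𝕜 := ℂ) α).restrictScalars ℝ).contDiff

theorem fderiv_coord (α : Fin n) (z v : Cn n) : fderiv ℂ (fun z : Cn n => z α) z v = v α := by
  have h := (EuclideanSpace.proj (𝕜 := ℂ) α).hasFDerivAt (x := z)
  have h' : fderiv ℂ (fun z : Cn n => z α) z = _ := h.fderiv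
  rw [h']; rfl

theorem differentiableAt_coord (α : Fin n) (z : Cn n) :
    DifferentiableAt ℂ (fun z : Cn n => z α) z :=
  (EuclideanSpace.proj (𝕜 := ℂ) α).differentiableAt

theorem contDiffOn_logH (hH : ContDiffOn ℝ ∞ H U) (hpos : ∀ z ∈ U, 0 < H z) :
    ContDiffOn ℝ ∞ (logH H) U :=
  hH.log fun z hz => (hpos z hz).ne'

variable [NeZero n]

/-- The complement of the hyperplane `z₁ = 0`. -/
def offZero (n : ℕ) [NeZero n] : Set (Cn n) := {z | z 0 ≠ 0}

/-- The function `log (|z₁|² H)`. -/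
def logN (H : Cn n → ℝ) (z : Cn n) : ℝ := Real.log (‖z 0‖ ^ 2 * H z)

theorem isOpen_offZero : IsOpen (offZero n) :=
  isOpen_ne.preimage (EuclideanSpace.proj (𝕜 := ℂ) (0 : Fin n)).continuous

theorem contDiff_normSq_coord : ContDiff ℝ ∞ (fun z : Cn n => ‖z 0‖ ^ 2) :=
  (contDiff_coord 0).norm_sq ℝ

theorem contDiffOn_logN (hH : ContDiffOn ℝ ∞ H U) (hpos : ∀ z ∈ U, 0 < H z) :
    ContDiffOn ℝ ∞ (logN H) (U ∩ offZero n) := by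
  refine ContDiffOn.log (contDiff_normSq_coord.contDiffOn.mul (hH.mono inter_subset_left)) ?_
  rintro z ⟨hz, hz0⟩
  exact (mul_pos (pow_pos (norm_pos_iff.2 hz0) 2) (hpos z hz)).ne'

theorem logN_eq (hpos : ∀ z ∈ U, 0 < H z) (hz : z ∈ U ∩ offZero n) :
    logN H z = Real.log (‖z 0‖ ^ 2) + logH H z :=
  Real.log_mul (pow_pos (norm_pos_iff.2 hz.2) 2).ne' (hpos z hz.1).ne'

theorem exp_mul_logN (hpos : ∀ z ∈ U, 0 < H z) (hz : z ∈ U ∩ offZero n) (σ : ℝ) :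
    Real.exp (σ * logN H z) = ‖z 0‖ ^ (2 * σ) * H z ^ σ := by
  have h0 : 0 < ‖z 0‖ := norm_pos_iff.2 hz.2
  have h1 := hpos z hz.1
  rw [logN_eq hpos hz, mul_add, Real.exp_add, logH, Real.rpow_def_of_pos h0, Real.rpow_def_of_pos h1,
    Real.log_pow]
  congr 2
  · push_cast; ring
  · ring

theorem del_logN (hU : IsOpen U) (hH : ContDiffOn ℝ ∞ H U) (hpos : ∀ z ∈ U, 0 < H z)
    (hz : z ∈ U ∩ offZero n) (v : Cn n) :
    del (logN H) v z = v 0 / z 0 + del (logH H) v z := by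
  have hW : IsOpen (U ∩ offZero n) := hU.inter isOpen_offZero
  have h0 : z 0 ≠ 0 := hz.2
  have h1 : EqOn (fun y => (logN H y : ℂ))
      (fun y => ((Real.log (‖y 0‖ ^ 2) : ℝ) : ℂ) + (logH H y : ℂ)) (U ∩ offZero n) := by
    intro y hy
    simp only [logN_eq hpos hy]; push_cast; rfl
  have hn : 0 < ‖z 0‖ ^ 2 := pow_pos (norm_pos_iff.2 h0) 2
  have hd : DifferentiableAt ℝ (fun z : Cn n => ‖z 0‖ ^ 2) z :=
    contDiff_normSq_coord.differentiable (by simp) z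
  have hdl : DifferentiableAt ℝ (fun z : Cn n => Real.log (‖z 0‖ ^ 2)) z := hd.log hn.ne'
  have hdz : DifferentiableAt ℝ (fun z : Cn n => z 0) z :=
    (contDiff_coord 0).differentiable (by simp) z
  have hsq : (fun y : Cn n => ((‖y 0‖ ^ 2 : ℝ) : ℂ)) = fun y => y 0 * conj (y 0) := by
    ext y; rw [Complex.mul_conj, Complex.normSq_eq_norm_sq]
  have hdzc : DifferentiableAt ℝ (fun z : Cn n => conj (z 0)) z :=
    differentiableAt_of_smooth isOpen_univ (contDiffOn_conj (contDiff_coord 0).contDiffOn)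
      (mem_univ z)
  rw [del, dH_congr_on hW h1 hz, dH_add, dH_ofReal_comp v (Real.hasDerivAt_log hn.ne') hd, hsq,
    dH_mul _ hdz hdzc, dH_conj _ hdz, dB_holo _ (differentiableAt_coord 0 z),
    dH_holo _ (differentiableAt_coord 0 z), fderiv_coord, map_zero, mul_zero, add_zero, del]
  · congr 1
    have : conj (z 0) ≠ 0 := by simpa using h0
    have h2 : ((‖z 0‖ ^ 2 : ℝ) : ℂ) = z 0 * conj (z 0) := congrFun hsq z
    rw [Complex.ofReal_inv, h2]
    field_simp
  · exact Complex.ofRealCLM.differentiableAt.comp z hdl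
  · exact differentiableAt_of_smooth hU (contDiffOn_ofReal (contDiffOn_logH hH hpos)) hz.1

theorem differentiableAt_inv_coord (h0 : z 0 ≠ 0) (c : ℂ) :
    DifferentiableAt ℂ (fun y : Cn n => c / y 0) z := by
  simp only [div_eq_mul_inv]
  exact ((differentiableAt_coord 0 z).fun_inv h0).const_mul c

/-- The singular part v₁/z₁ of ∂φ is holomorphic in z, so ∂̄ does not see it. Hence the Levi form is
bounded on compact sets up to the hyperplane z₁ = 0. -/
theorem levi_logN (hU : IsOpen U) (hH : ContDiffOn ℝ ∞ H U) (hpos : ∀ z ∈ U, 0 < H z)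
    (hz : z ∈ U ∩ offZero n) (v w : Cn n) :
    levi (logN H) v w z = levi (logH H) v w z := by
  rw [levi, dB_congr_on (hU.inter isOpen_offZero) (fun y hy => del_logN hU hH hpos hy v) hz, dB_add,
    dB_holo _ (differentiableAt_inv_coord hz.2 _), zero_add, levi]
  · exact (differentiableAt_inv_coord hz.2 _).restrictScalars ℝ
  · exact differentiableAt_of_smooth hU (contDiffOn_del hU (contDiffOn_logH hH hpos) v) hz.1

/-- Unlike the Levi form, the (2,0)-Hessian of the potential is singular, like -v₁w₁/z₁². This is
the term that the free vector b must compensate in the curvature estimate. -/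
theorem dH_del_logN (hU : IsOpen U) (hH : ContDiffOn ℝ ∞ H U) (hpos : ∀ z ∈ U, 0 < H z)
    (hz : z ∈ U ∩ offZero n) (v w : Cn n) :
    dH w (del (logN H) v) z = -(v 0 / z 0) * (w 0 / z 0) + dH w (del (logH H) v) z := by
  have h0 : z 0 ≠ 0 := hz.2
  have hd := differentiableAt_inv_coord h0 (v 0)
  rw [dH_congr_on (hU.inter isOpen_offZero) (fun y hy => del_logN hU hH hpos hy v) hz, dH_add,
    dH_holo _ hd]
  · congr 1
    have h1 : HasFDerivAt (fun y : Cn n => v 0 / y 0) _ z :=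
      ((hasDerivAt_inv h0).const_mul (v 0)).comp_hasFDerivAt z
        (differentiableAt_coord (0 : Fin n) z).hasFDerivAt
    rw [h1.fderiv, _root_.smul_apply, fderiv_coord, smul_eq_mul]
    field_simp
  · exact hd.restrictScalars ℝ
  · exact differentiableAt_of_smooth hU (contDiffOn_del hU (contDiffOn_logH hH hpos) v) hz.1

end LogPotential

/-! ### A variational lower bound for the bisectional curvature -/

section Curvature

variable {n m : ℕ} {g : Cn n → Matrix (Fin n) (Fin n) ℂ} {W : Set (Cn n)} {z : Cn n}

/-- The value at `0` of `∂_ζ∂_ζ̄ g(V, V)` along `ζ ↦ z + ζ w` for the vector field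
`V = v + ζ b`. -/
def discHessian (g : Cn n → Matrix (Fin n) (Fin n) ℂ) (z v w b : Cn n) : ℝ :=
  (dH w (dB w fun y => sesq (g y) v v) z).re + 2 * (dH w (fun y => sesq (g y) v b) z).re
    + (sesq (g z) b b).re

theorem contDiffOn_sesq (hg : ∀ α β, ContDiffOn ℝ ∞ (fun y => g y α β) W) (v w : Cn n) :
    ContDiffOn ℝ ∞ (fun y => sesq (g y) v w) W := by
  simp only [sesq_apply]
  exact ContDiffOn.sum fun α _ => ContDiffOn.sum fun β _ =>
    ((hg α β).mul contDiffOn_const).mul contDiffOn_const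

theorem dH_sesq (hW : IsOpen W) (hg : ∀ α β, ContDiffOn ℝ ∞ (fun y => g y α β) W) (hz : z ∈ W)
    (u v w : Cn n) : dH u (fun y => sesq (g y) v w) z
      = ∑ α, ∑ β, dH u (fun y => g y α β) z * v α * conj (w β) := by
  have hd (α β : Fin n) := differentiableAt_of_smooth hW (hg α β) hz
  simp only [sesq_apply, mul_assoc]
  rw [dH_finsum]
  · refine Finset.sum_congr rfl fun α _ => ?_
    rw [dH_finsum]
    · refine Finset.sum_congr rfl fun β _ => ?_
      rw [dH_mul _ (hd α β) (differentiableAt_const _), dH_const, mul_zero, add_zero]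
    · exact fun β _ => (hd α β).mul (differentiableAt_const _)
  · exact fun α _ => DifferentiableAt.fun_sum fun β _ => (hd α β).mul (differentiableAt_const _)

theorem dB_sesq (hW : IsOpen W) (hg : ∀ α β, ContDiffOn ℝ ∞ (fun y => g y α β) W) (hz : z ∈ W)
    (u v w : Cn n) : dB u (fun y => sesq (g y) v w) z
      = ∑ α, ∑ β, dB u (fun y => g y α β) z * v α * conj (w β) := by
  have hd (α β : Fin n) := differentiableAt_of_smooth hW (hg α β) hz
  simp only [sesq_apply, mul_assoc]
  rw [dB_finsum]
  · refine Finset.sum_congr rfl fun α _ => ?_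
    rw [dB_finsum]
    · refine Finset.sum_congr rfl fun β _ => ?_
      rw [dB_mul _ (hd α β) (differentiableAt_const _), dB_const, mul_zero, add_zero]
    · exact fun β _ => (hd α β).mul (differentiableAt_const _)
  · exact fun α _ => DifferentiableAt.fun_sum fun β _ => (hd α β).mul (differentiableAt_const _)

theorem dH_dB_sesq (hW : IsOpen W) (hg : ∀ α β, ContDiffOn ℝ ∞ (fun y => g y α β) W) (hz : z ∈ W)
    (u u' v w : Cn n) : dH u (dB u' fun y => sesq (g y) v w) z
      = ∑ α, ∑ β, dH u (dB u' fun y => g y α β) z * v α * conj (w β) := by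
  rw [dH_congr_on hW (fun y hy => dB_sesq hW hg hy u' v w) hz]
  exact dH_sesq (g := fun y => Matrix.of fun α β => dB u' (fun y => g y α β) y) hW
    (fun α β => contDiffOn_dB hW (hg α β) u') hz u v w

theorem sum_comm_two {ι : Type*} [Fintype ι] (f : ι → ι → ι → ℂ) :
    ∑ a, ∑ b, ∑ c, f a b c = ∑ c, ∑ a, ∑ b, f a b c := by
  rw [Finset.sum_comm]
  rw [show ∑ c, ∑ a, ∑ b, f a b c = ∑ a, ∑ c, ∑ b, f a b c from Finset.sum_comm]
  rw [Finset.sum_comm]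
  exact Finset.sum_congr rfl fun a _ => Finset.sum_comm

theorem sum_comm_four {ι : Type*} [Fintype ι] (f : ι → ι → ι → ι → ι → ℂ) :
    ∑ a, ∑ b, ∑ c, ∑ d, ∑ e, f a b c d e = ∑ e, ∑ a, ∑ b, ∑ c, ∑ d, f a b c d e := by
  calc ∑ a, ∑ b, ∑ c, ∑ d, ∑ e, f a b c d e = ∑ a, ∑ b, ∑ e, ∑ c, ∑ d, f a b c d e :=
        Finset.sum_congr rfl fun a _ => Finset.sum_congr rfl fun b _ => sum_comm_two _
    _ = _ := sum_comm_two fun a b e => ∑ c, ∑ d, f a b c d e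

/-- Contracting all indices turns the curvature into a second derivative in the direction w minus
nothing but the squared dual norm of the covector ∂_w g(v, ·), up to an overall sign. This is the
form to which a completion of the square applies. -/
theorem bisectional_eq (hW : IsOpen W) (hg : ∀ α β, ContDiffOn ℝ ∞ (fun y => g y α β) W)
    (hz : z ∈ W) (v w : Cn n) :
    bisectional g z v w = (- dH w (dB w fun y => sesq (g y) v v) z
      + ∑ μ, ∑ ν, (g z)⁻¹ ν μ * dH w (fun y => sesq (g y) v (basisVec ν)) z
        * dB w (fun y => sesq (g y) (basisVec μ) v) z).re := by
  have e1 : dH w (dB w fun y => sesq (g y) v v) z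
      = ∑ α, ∑ β, ∑ γ, ∑ δ, wirt γ (wirtBar δ fun y => g y α β) z * v α * conj (v β) * w γ
        * conj (w δ) := by
    rw [dH_dB_sesq hW hg hz]
    refine Finset.sum_congr rfl fun α _ => Finset.sum_congr rfl fun β _ => ?_
    rw [← sesq_complexHessian hW (hg α β) hz, sesq_apply, Finset.sum_mul, Finset.sum_mul]
    refine Finset.sum_congr rfl fun γ _ => ?_
    rw [Finset.sum_mul, Finset.sum_mul]
    refine Finset.sum_congr rfl fun δ _ => ?_
    rw [complexHessian_apply, wirt_eq_dH, wirtBar_eq_dB]; ring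
  have e2 (ν : Fin n) : dH w (fun y => sesq (g y) v (basisVec ν)) z
      = ∑ α, ∑ γ, wirt γ (fun y => g y α ν) z * v α * w γ := by
    rw [dH_sesq hW hg hz]
    refine Finset.sum_congr rfl fun α _ => ?_
    rw [Finset.sum_eq_single ν]
    · rw [dH_eq_sum, Finset.sum_mul, Finset.sum_mul]
      refine Finset.sum_congr rfl fun γ _ => ?_
      rw [wirt_eq_dH]; simp [basisVec]; ring
    · intro β _ hβ; simp [basisVec, hβ]
    · simp
  have e3 (μ : Fin n) : dB w (fun y => sesq (g y) (basisVec μ) v) z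
      = ∑ β, ∑ δ, wirtBar δ (fun y => g y μ β) z * conj (v β) * conj (w δ) := by
    rw [dB_sesq hW hg hz, Finset.sum_eq_single μ]
    · refine Finset.sum_congr rfl fun β _ => ?_
      rw [dB_eq_sum, Finset.sum_mul, Finset.sum_mul]
      refine Finset.sum_congr rfl fun δ _ => ?_
      rw [wirtBar_eq_dB]; simp [basisVec]; ring
    · intro β _ hβ; simp [basisVec, hβ]
    · simp
  rw [bisectional, e1]
  congr 1
  simp only [e2, e3, curvature, add_mul, Finset.sum_add_distrib, neg_mul, Finset.sum_neg_distrib]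
  congr 1
  simp only [Finset.sum_mul, Finset.mul_sum]
  rw [sum_comm_four]
  refine Finset.sum_congr rfl fun μ _ => ?_
  rw [sum_comm_four]
  refine Finset.sum_congr rfl fun ν _ => ?_
  calc _ = ∑ β, ∑ α, ∑ γ, ∑ δ, _ := Finset.sum_comm
    _ = ∑ β, ∑ δ, ∑ α, ∑ γ, _ := Finset.sum_congr rfl fun β _ => sum_comm_two _
    _ = _ := ?_
  refine Finset.sum_congr rfl fun β _ => Finset.sum_congr rfl fun δ _ =>
    Finset.sum_congr rfl fun α _ => Finset.sum_congr rfl fun γ _ => ?_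
  ring

theorem sesq_add_left (G : Matrix (Fin n) (Fin n) ℂ) (v v' w : Cn n) :
    sesq G (v + v') w = sesq G v w + sesq G v' w := by
  rw [map_add, LinearMap.add_apply]

theorem sesq_add_right (G : Matrix (Fin n) (Fin n) ℂ) (v w w' : Cn n) :
    sesq G v (w + w') = sesq G v w + sesq G v w' := map_add _ _ _

theorem posDef_sesq_nonneg {G : Matrix (Fin n) (Fin n) ℂ} (hG : G.PosDef) (c : Cn n) :
    0 ≤ (sesq G c c).re := by
  have h := hG.posSemidef.re_dotProduct_nonneg (fun i => conj (c i))
  have e : star (fun i => conj (c i)) ⬝ᵥ G.mulVec (fun i => conj (c i)) = sesq G c c := by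
    simp only [dotProduct, Matrix.mulVec, sesq_apply, Finset.mul_sum, Pi.star_apply,
      RCLike.star_def, Complex.conj_conj]
    refine Finset.sum_congr rfl fun α _ => Finset.sum_congr rfl fun β _ => by ring
  rw [e] at h
  exact h

/-- Completing the square. -/
theorem posDef_inv_completion {G : Matrix (Fin n) (Fin n) ℂ} (hG : G.PosDef) (a : Fin n → ℂ)
    (b : Cn n) :
    0 ≤ (∑ μ, ∑ ν, G⁻¹ ν μ * a ν * conj (a μ)).re + 2 * (∑ ν, a ν * conj (b ν)).re
      + (sesq G b b).re := by
  have hherm (α β : Fin n) : G α β = conj (G β α) := by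
    have := hG.isHermitian.apply α β
    rw [← this]; rfl
  -- The vector c represents the covector a through G, that is, G(c, x) = ∑ a_ν conj(x_ν). The claim
  -- is then the expansion of G(c + b, c + b) ≥ 0.
  have hinv (α β : Fin n) : conj (G⁻¹ α β) = G⁻¹ β α := hG.isHermitian.inv.apply β α
  have hdet : IsUnit G.det := (Matrix.isUnit_iff_isUnit_det G).1 hG.isUnit
  set c : Cn n := WithLp.toLp 2 (Matrix.vecMul a G⁻¹) with hc
  have hc' (x : Cn n) : sesq G c x = ∑ ν, a ν * conj (x ν) := by
    have h1 : Matrix.vecMul (Matrix.vecMul a G⁻¹) G = a := by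
      rw [Matrix.vecMul_vecMul, Matrix.nonsing_inv_mul _ hdet, Matrix.vecMul_one]
    rw [sesq_apply, Finset.sum_comm]
    refine Finset.sum_congr rfl fun β _ => ?_
    rw [← Finset.sum_mul]
    congr 1
    conv_rhs => rw [← h1]
    simp only [Matrix.vecMul, dotProduct, hc]
    exact Finset.sum_congr rfl fun α _ => mul_comm _ _
  have h0 := posDef_sesq_nonneg hG (c + b)
  have h2 : sesq G (c + b) (c + b) = ∑ ν, a ν * conj (c ν) + ∑ ν, a ν * conj (b ν)
      + (conj (∑ ν, a ν * conj (b ν)) + sesq G b b) := by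
    rw [sesq_add_left, sesq_add_right, sesq_add_right, hc', hc', sesq_conj_of_hermitian hherm b c,
      hc']
  have h3 : ∑ ν, a ν * conj (c ν) = ∑ μ, ∑ ν, G⁻¹ ν μ * a ν * conj (a μ) := by
    rw [Finset.sum_comm]
    refine Finset.sum_congr rfl fun ν _ => ?_
    simp only [hc, Matrix.vecMul, dotProduct, map_sum, map_mul, hinv, Finset.mul_sum]
    exact Finset.sum_congr rfl fun μ _ => by ring
  rw [h2, h3] at h0
  simp only [Complex.add_re, Complex.conj_re] at h0 ⊢
  linarith

/-- For the covector a = ∂_w g(v, ·), positivity of g gives |a|² + 2 Re a(b̄) + g(b, b) ≥ 0, the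
norm of a being taken in the inverse metric. So the nonnegative quadratic part of the curvature can
be traded for any choice of b, and an upper bound for `discHessian` with a single well chosen b
bounds the curvature from below. -/
theorem neg_discHessian_le_bisectional (hW : IsOpen W)
    (hg : ∀ α β, ContDiffOn ℝ ∞ (fun y => g y α β) W)
    (hherm : ∀ y ∈ W, ∀ α β, g y α β = conj (g y β α)) (hz : z ∈ W) (hpos : (g z).PosDef)
    (v w b : Cn n) : - discHessian g z v w b ≤ bisectional g z v w := by
  set a : Fin n → ℂ := fun ν => dH w (fun y => sesq (g y) v (basisVec ν)) z with ha
  have h1 (μ : Fin n) : dB w (fun y => sesq (g y) (basisVec μ) v) z = conj (a μ) := by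
    rw [ha, ← dB_conj _ (differentiableAt_of_smooth hW (contDiffOn_sesq hg _ _) hz)]
    exact dB_congr_on hW (fun y hy => sesq_conj_of_hermitian (hherm y hy) _ _) hz w
  have h2 : dH w (fun y => sesq (g y) v b) z = ∑ ν, a ν * conj (b ν) := by
    have e : (fun y => sesq (g y) v b) = fun y => ∑ ν, conj (b ν) * sesq (g y) v (basisVec ν) := by
      ext y
      conv_lhs => rw [← sum_smul_basisVec b]
      simp only [map_sum, LinearMap.map_smulₛₗ, smul_eq_mul]
    have hd (ν : Fin n) := differentiableAt_of_smooth hW (contDiffOn_sesq hg v (basisVec ν)) hz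
    rw [e, dH_finsum _ _ fun ν _ => (hd ν).const_mul _]
    refine Finset.sum_congr rfl fun ν _ => ?_
    rw [dH_const_mul _ _ (hd ν), mul_comm]
  have h3 := posDef_inv_completion hpos a b
  rw [bisectional_eq hW hg hz, discHessian, h2]
  simp only [h1]
  rw [Complex.add_re, Complex.neg_re]
  linarith

end Curvature

/-! ### Behaviour under holomorphic changes of coordinates. -/

section Pullback

variable {n : ℕ} {g g' : Cn n → Matrix (Fin n) (Fin n) ℂ} {W W' : Set (Cn n)} {z : Cn n}
  {Φ : Cn n → Cn n}

theorem dH_mul_holo_conj {f p q : Cn n → ℂ} (hf : DifferentiableAt ℝ f z)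
    (hp : DifferentiableAt ℂ p z) (hq : DifferentiableAt ℂ q z) (w : Cn n) :
    dH w (fun y => f y * p y * conj (q y)) z
      = dH w f z * p z * conj (q z) + f z * fderiv ℂ p z w * conj (q z) := by
  have hp' := hp.restrictScalars ℝ
  have hq' := hq.restrictScalars ℝ
  have hqc : DifferentiableAt ℝ (fun y => conj (q y)) z := Complex.conjCLE.differentiableAt.comp z hq'
  rw [dH_mul _ (hf.fun_mul hp') hqc, dH_mul _ hf hp', dH_conj _ hq', dB_holo _ hq, dH_holo _ hp]
  simp only [map_zero]; ring

theorem dB_mul_holo_conj {f p q : Cn n → ℂ} (hf : DifferentiableAt ℝ f z)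
    (hp : DifferentiableAt ℂ p z) (hq : DifferentiableAt ℂ q z) (w : Cn n) :
    dB w (fun y => f y * p y * conj (q y)) z
      = dB w f z * p z * conj (q z) + f z * p z * conj (fderiv ℂ q z w) := by
  have hp' := hp.restrictScalars ℝ
  have hq' := hq.restrictScalars ℝ
  have hqc : DifferentiableAt ℝ (fun y => conj (q y)) z := Complex.conjCLE.differentiableAt.comp z hq'
  rw [dB_mul _ (hf.fun_mul hp') hqc, dB_mul _ hf hp', dB_conj _ hq', dB_holo _ hp, dH_holo _ hq]
  ring

/-- The second derivatives of type `(1,1)` of `f ∘ Φ` for holomorphic `Φ`. -/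
theorem dH_dB_comp_holo (hW : IsOpen W) (hW' : IsOpen W') (hΦ : ContDiffOn ℂ ω Φ W)
    (hm : MapsTo Φ W W') {f : Cn n → ℂ} (hf : ContDiffOn ℝ ∞ f W') (hz : z ∈ W) (v w : Cn n) :
    dH v (dB w fun y => f (Φ y)) z
      = dH (fderiv ℂ Φ z v) (dB (fderiv ℂ Φ z w) f) (Φ z) := by
  have hdΦ (y : Cn n) (hy : y ∈ W) : DifferentiableAt ℂ Φ y :=
    (hΦ.contDiffAt (hW.mem_nhds hy)).differentiableAt (by simp)
  have hdJ (y : Cn n) (hy : y ∈ W) (k : Fin n) :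
      DifferentiableAt ℂ (fun y => (fderiv ℂ Φ y w) k) y := by
    have h1 : ContDiffOn ℂ ω (fderiv ℂ Φ) W := hΦ.fderiv_of_isOpen hW (by simp)
    have h2 : DifferentiableAt ℂ (fun y => fderiv ℂ Φ y w) y :=
      ((h1.contDiffAt (hW.mem_nhds hy)).differentiableAt (by simp)).clm_apply
        (differentiableAt_const w)
    exact (differentiableAt_coord k _).comp y h2
  have e : EqOn (dB w fun y => f (Φ y))
      (fun y => ∑ k, dB (basisVec k) f (Φ y) * (1 : ℂ) * conj ((fderiv ℂ Φ y w) k)) W := by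
    intro y hy
    rw [dB_comp_holo w (hdΦ y hy) (differentiableAt_of_smooth hW' hf (hm hy)), dB_eq_sum]
    exact Finset.sum_congr rfl fun k _ => by ring
  have hdB (k : Fin n) : DifferentiableAt ℝ (dB (basisVec k) f) (Φ z) :=
    differentiableAt_of_smooth hW' (contDiffOn_dB hW' hf _) (hm hz)
  have hdBc (k : Fin n) : DifferentiableAt ℝ (fun y => dB (basisVec k) f (Φ y)) z :=
    (hdB k).comp z ((hdΦ z hz).restrictScalars ℝ)
  have hconj (k : Fin n) : DifferentiableAt ℝ (fun y => conj ((fderiv ℂ Φ y w) k)) z :=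
    Complex.conjCLE.differentiableAt.comp z ((hdJ z hz k).restrictScalars ℝ)
  rw [dH_congr_on hW e hz, dH_finsum]
  · have e2 : dB (fderiv ℂ Φ z w) f
        = fun y => ∑ k, conj ((fderiv ℂ Φ z w) k) * dB (basisVec k) f y :=
      funext fun y => dB_eq_sum _ _ _
    rw [e2, dH_finsum _ _ fun k _ => (hdB k).const_mul _]
    refine Finset.sum_congr rfl fun k _ => ?_
    rw [dH_mul_holo_conj (hdBc k) (differentiableAt_const _) (hdJ z hz k), dH_const_mul _ _ (hdB k),
      dH_comp_holo v (hdΦ z hz) (hdB k)]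
    simp; ring
  · intro k _
    exact ((hdBc k).mul (differentiableAt_const _)).mul (hconj k)

/-- A holomorphic map carries the disc with direction w and the field v + ζb to a disc with
direction Φ'w and a field with value Φ'v, whose ζ-derivative at 0 is Φ'b + Φ''(v, w). The curvature
of the image disc does not matter, since the mixed derivative ∂_ζ∂_ζ̄ involves only its tangent. As
b is free, estimates in finitely many charts control all others. -/
theorem discHessian_pullback (hW : IsOpen W) (hW' : IsOpen W') (hΦ : ContDiffOn ℂ ω Φ W)
    (hm : MapsTo Φ W W') (hg' : ∀ α β, ContDiffOn ℝ ∞ (fun y => g' y α β) W')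
    (hherm : ∀ y ∈ W', ∀ α β, g' y α β = conj (g' y β α))
    (hpull : ∀ y ∈ W, ∀ v w,
      sesq (g y) v w = sesq (g' (Φ y)) (fderiv ℂ Φ y v) (fderiv ℂ Φ y w))
    (hz : z ∈ W) (v w b : Cn n) :
    discHessian g z v w b = discHessian g' (Φ z) (fderiv ℂ Φ z v) (fderiv ℂ Φ z w)
      (fderiv ℂ Φ z b + fderiv ℂ (fun y => fderiv ℂ Φ y v) z w) := by
  have hdΦ (y : Cn n) (hy : y ∈ W) : DifferentiableAt ℂ Φ y :=
    (hΦ.contDiffAt (hW.mem_nhds hy)).differentiableAt (by simp)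
  have hJ (v : Cn n) : ContDiffOn ℂ ω (fun y => fderiv ℂ Φ y v) W :=
    (hΦ.fderiv_of_isOpen hW (by simp)).clm_apply contDiffOn_const
  have hdJv (v : Cn n) (y : Cn n) (hy : y ∈ W) : DifferentiableAt ℂ (fun y => fderiv ℂ Φ y v) y :=
    ((hJ v).contDiffAt (hW.mem_nhds hy)).differentiableAt (by simp)
  have hJk (v : Cn n) (k : Fin n) : ContDiffOn ℂ ω (fun y => (fderiv ℂ Φ y v) k) W :=
    (EuclideanSpace.proj (𝕜 := ℂ) k).contDiff.comp_contDiffOn (hJ v)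
  have hdJ (v : Cn n) (k : Fin n) (y : Cn n) (hy : y ∈ W) :
      DifferentiableAt ℂ (fun y => (fderiv ℂ Φ y v) k) y :=
    ((hJk v k).contDiffAt (hW.mem_nhds hy)).differentiableAt (by simp)
  have hdJ' (v : Cn n) (k : Fin n) (y : Cn n) (hy : y ∈ W) (u : Cn n) :
      fderiv ℂ (fun y => (fderiv ℂ Φ y v) k) y u = (fderiv ℂ (fun y => fderiv ℂ Φ y v) y u) k := by
    have h := (EuclideanSpace.proj (𝕜 := ℂ) k).hasFDerivAt.comp y (hdJv v y hy).hasFDerivAt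
    have h' : fderiv ℂ (fun y => (fderiv ℂ Φ y v) k) y = _ := h.fderiv
    rw [h']; rfl
  have hdJJ (v : Cn n) (k : Fin n) (u : Cn n) :
      DifferentiableAt ℂ (fun y => fderiv ℂ (fun y => (fderiv ℂ Φ y v) k) y u) z := by
    have : ContDiffOn ℂ ω (fderiv ℂ (fun y => (fderiv ℂ Φ y v) k)) W :=
      (hJk v k).fderiv_of_isOpen hW (by simp)
    exact ((this.contDiffAt (hW.mem_nhds hz)).differentiableAt (by simp)).clm_apply
      (differentiableAt_const u)
  have hdg (k l : Fin n) (y : Cn n) (hy : y ∈ W) : DifferentiableAt ℝ (fun y => g' y k l) (Φ y) :=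
    differentiableAt_of_smooth hW' (hg' k l) (hm hy)
  have hdgΦ (k l : Fin n) (y : Cn n) (hy : y ∈ W) : DifferentiableAt ℝ (fun y => g' (Φ y) k l) y :=
    (hdg k l y hy).comp y ((hdΦ y hy).restrictScalars ℝ)
  have hdBg (k l : Fin n) (u : Cn n) :
      DifferentiableAt ℝ (dB u fun y => g' (Φ y) k l) z := by
    refine differentiableAt_of_smooth hW (contDiffOn_dB hW ?_ u) hz
    exact (hg' k l).comp ((hΦ.of_le (by simp)).restrict_scalars ℝ) hm
  set v' := fderiv ℂ Φ z v
  set w' := fderiv ℂ Φ z w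
  set b' := fderiv ℂ Φ z b
  set d := fderiv ℂ (fun y => fderiv ℂ Φ y v) z w
  have hexp (v w : Cn n) : EqOn (fun y => sesq (g y) v w)
      (fun y => ∑ k, ∑ l, g' (Φ y) k l * (fderiv ℂ Φ y v) k * conj ((fderiv ℂ Φ y w) l)) W :=
    fun y hy => hpull y hy v w
  have hterm (v w : Cn n) (k l : Fin n) (y : Cn n) (hy : y ∈ W) : DifferentiableAt ℝ
      (fun y => g' (Φ y) k l * (fderiv ℂ Φ y v) k * conj ((fderiv ℂ Φ y w) l)) y :=
    ((hdgΦ k l y hy).mul ((hdJ v k y hy).restrictScalars ℝ)).mul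
      (Complex.conjCLE.differentiableAt.comp y ((hdJ w l y hy).restrictScalars ℝ))
  -- first order
  have h1 : dH w (fun y => sesq (g y) v b) z
      = dH w' (fun y => sesq (g' y) v' b') (Φ z) + sesq (g' (Φ z)) d b' := by
    rw [dH_congr_on hW (hexp v b) hz,
      dH_finsum _ _ fun k _ => DifferentiableAt.fun_sum fun l _ => hterm v b k l z hz,
      dH_sesq hW' hg' (hm hz), sesq_apply, ← Finset.sum_add_distrib]
    refine Finset.sum_congr rfl fun k _ => ?_
    rw [dH_finsum _ _ fun l _ => hterm v b k l z hz, ← Finset.sum_add_distrib]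
    refine Finset.sum_congr rfl fun l _ => ?_
    rw [dH_mul_holo_conj (hdgΦ k l z hz) (hdJ v k z hz) (hdJ b l z hz), hdJ' v k z hz,
      dH_comp_holo (f := fun y => g' y k l) w (hdΦ z hz) (hdg k l z hz)]
  -- second order
  have hB : EqOn (dB w fun y => sesq (g y) v v) (fun y => ∑ k, ∑ l,
      ((dB w (fun y => g' (Φ y) k l) y) * (fderiv ℂ Φ y v) k * conj ((fderiv ℂ Φ y v) l)
        + g' (Φ y) k l * (fderiv ℂ Φ y v) k
          * conj (fderiv ℂ (fun y => (fderiv ℂ Φ y v) l) y w))) W := by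
    intro y hy
    rw [dB_congr_on hW (hexp v v) hy,
      dB_finsum _ _ fun k _ => DifferentiableAt.fun_sum fun l _ => hterm v v k l y hy]
    refine Finset.sum_congr rfl fun k _ => ?_
    rw [dB_finsum _ _ fun l _ => hterm v v k l y hy]
    refine Finset.sum_congr rfl fun l _ => ?_
    rw [dB_mul_holo_conj (hdgΦ k l y hy) (hdJ v k y hy) (hdJ v l y hy)]
  have hJR (k : Fin n) := (hdJ v k z hz).restrictScalars ℝ
  have hJRc (k : Fin n) : DifferentiableAt ℝ (fun y => conj ((fderiv ℂ Φ y v) k)) z :=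
    Complex.conjCLE.differentiableAt.comp z (hJR k)
  have hJJRc (k : Fin n) : DifferentiableAt ℝ
      (fun y => conj (fderiv ℂ (fun y => (fderiv ℂ Φ y v) k) y w)) z :=
    Complex.conjCLE.differentiableAt.comp z ((hdJJ v k w).restrictScalars ℝ)
  have ht1 (k l : Fin n) : DifferentiableAt ℝ (fun y => (dB w (fun y => g' (Φ y) k l) y)
      * (fderiv ℂ Φ y v) k * conj ((fderiv ℂ Φ y v) l)) z := ((hdBg k l w).mul (hJR k)).mul (hJRc l)
  have ht2 (k l : Fin n) : DifferentiableAt ℝ (fun y => g' (Φ y) k l * (fderiv ℂ Φ y v) k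
      * conj (fderiv ℂ (fun y => (fderiv ℂ Φ y v) l) y w)) z :=
    ((hdgΦ k l z hz).mul (hJR k)).mul (hJJRc l)
  have h2 : dH w (dB w fun y => sesq (g y) v v) z
      = dH w' (dB w' fun y => sesq (g' y) v' v') (Φ z) + dB w' (fun y => sesq (g' y) d v') (Φ z)
        + (dH w' (fun y => sesq (g' y) v' d) (Φ z) + sesq (g' (Φ z)) d d) := by
    rw [dH_congr_on hW hB hz,
      dH_finsum _ _ fun k _ => DifferentiableAt.fun_sum fun l _ => (ht1 k l).fun_add (ht2 k l),
      dH_dB_sesq hW' hg' (hm hz), dB_sesq hW' hg' (hm hz), dH_sesq hW' hg' (hm hz), sesq_apply,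
      ← Finset.sum_add_distrib, ← Finset.sum_add_distrib, ← Finset.sum_add_distrib]
    refine Finset.sum_congr rfl fun k _ => ?_
    rw [dH_finsum _ _ fun l _ => (ht1 k l).fun_add (ht2 k l),
      ← Finset.sum_add_distrib, ← Finset.sum_add_distrib, ← Finset.sum_add_distrib]
    refine Finset.sum_congr rfl fun l _ => ?_
    rw [dH_add _ (ht1 k l) (ht2 k l),
      dH_mul_holo_conj (hdBg k l w) (hdJ v k z hz) (hdJ v l z hz),
      dH_mul_holo_conj (hdgΦ k l z hz) (hdJ v k z hz) (hdJJ v l w), hdJ' v k z hz,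
      hdJ' v l z hz, dH_comp_holo (f := fun y => g' y k l) w (hdΦ z hz) (hdg k l z hz),
      dB_comp_holo (f := fun y => g' y k l) w (hdΦ z hz) (hdg k l z hz),
      dH_dB_comp_holo (f := fun y => g' y k l) hW hW' hΦ hm (hg' k l) hz]
  have h3 : dB w' (fun y => sesq (g' y) d v') (Φ z)
      = conj (dH w' (fun y => sesq (g' y) v' d) (Φ z)) := by
    rw [← dB_conj _ (differentiableAt_of_smooth hW' (contDiffOn_sesq hg' _ _) (hm hz))]
    exact dB_congr_on hW' (fun y hy => sesq_conj_of_hermitian (hherm y hy) _ _) (hm hz) _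
  have h4 : dH w' (fun y => sesq (g' y) v' (b' + d)) (Φ z)
      = dH w' (fun y => sesq (g' y) v' b') (Φ z) + dH w' (fun y => sesq (g' y) v' d) (Φ z) := by
    simp only [map_add]
    exact dH_add _ (differentiableAt_of_smooth hW' (contDiffOn_sesq hg' _ _) (hm hz))
      (differentiableAt_of_smooth hW' (contDiffOn_sesq hg' _ _) (hm hz))
  have h5 : sesq (g z) b b = sesq (g' (Φ z)) b' b' := hpull z hz b b
  have h6 : sesq (g' (Φ z)) b' d = conj (sesq (g' (Φ z)) d b') :=
    sesq_conj_of_hermitian (hherm _ (hm hz)) _ _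
  rw [discHessian, discHessian, h1, h2, h3, h4, h5, sesq_add_left, sesq_add_right, sesq_add_right,
    h6]
  simp only [Complex.add_re, Complex.conj_re]
  ring

end Pullback

/-! ### Metrics of the form g₀ + ∂∂̄ F(φ). -/

section PotentialMetric

variable {n : ℕ} {φ : Cn n → ℝ} {W : Set (Cn n)} {z : Cn n} {F : ℕ → ℝ → ℝ}

theorem dH_real_mul (hW : IsOpen W) (hφ : ContDiffOn ℝ ∞ φ W) (hz : z ∈ W)
    (hF : ∀ k t, HasDerivAt (F k) (F (k + 1) t) t) (k : ℕ) {f : Cn n → ℂ}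
    (hf : DifferentiableAt ℝ f z) (w : Cn n) :
    dH w (fun y => (F k (φ y) : ℂ) * f y) z
      = (F (k + 1) (φ z) : ℂ) * del φ w z * f z + (F k (φ z) : ℂ) * dH w f z := by
  have hd := differentiableAt_of_smooth hW hφ hz
  have h1 : DifferentiableAt ℝ (fun y => (F k (φ y) : ℂ)) z :=
    Complex.ofRealCLM.differentiableAt.comp z ((hF k _).differentiableAt.comp z hd)
  rw [dH_mul _ h1 hf, dH_ofReal_comp w (hF k _) hd]; rfl

theorem dB_real_mul (hW : IsOpen W) (hφ : ContDiffOn ℝ ∞ φ W) (hz : z ∈ W)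
    (hF : ∀ k t, HasDerivAt (F k) (F (k + 1) t) t) (k : ℕ) {f : Cn n → ℂ}
    (hf : DifferentiableAt ℝ f z) (w : Cn n) :
    dB w (fun y => (F k (φ y) : ℂ) * f y) z
      = (F (k + 1) (φ z) : ℂ) * conj (del φ w z) * f z + (F k (φ z) : ℂ) * dB w f z := by
  have hd := differentiableAt_of_smooth hW hφ hz
  have h1 : DifferentiableAt ℝ (fun y => (F k (φ y) : ℂ)) z :=
    Complex.ofRealCLM.differentiableAt.comp z ((hF k _).differentiableAt.comp z hd)
  rw [dB_mul _ h1 hf, dB_ofReal_comp w (hF k _) hd, dB_ofReal hW hφ hz]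

/-- The second derivative ∂_w(∂φ(v)) enters only together with ∂φ(b), in the combination κ. This
isolates a quadratic expression in κ and q u, with coefficients F'', F''', F''''. Every term of the
last group contains the Levi form or one of its derivatives, which stay bounded near the divisor. -/
theorem discHessian_potential (hW : IsOpen W) (hφ : ContDiffOn ℝ ∞ φ W) (hz : z ∈ W)
    (hF : ∀ k t, HasDerivAt (F k) (F (k + 1) t) t) {g g₀ : Cn n → Matrix (Fin n) (Fin n) ℂ}
    (hg₀ : ∀ α β, ContDiffOn ℝ ∞ (fun y => g₀ y α β) W)
    (hg : ∀ y ∈ W, ∀ v w, sesq (g y) v w = sesq (g₀ y) v w + ((F 1 (φ y) : ℂ) * levi φ v w y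
      + (F 2 (φ y) : ℂ) * (del φ v y * conj (del φ w y))))
    (v w b : Cn n) {q u κ : ℂ} (hq : q = del φ w z) (hu : u = del φ v z)
    (hκ : κ = dH w (del φ v) z + del φ b z) :
    discHessian g z v w b = discHessian g₀ z v w b
      + (F 4 (φ z) * (‖q‖ ^ 2 * ‖u‖ ^ 2) + 2 * F 3 (φ z) * (q * u * conj κ).re
        + F 2 (φ z) * ‖κ‖ ^ 2)
      + (F 3 (φ z) * levi φ w w z * (u * conj u) + 2 * (F 3 (φ z) * q * levi φ v w z * conj u)
        + F 2 (φ z) * (levi φ v w z * conj (levi φ v w z))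
        + 2 * (F 2 (φ z) * conj u * dH w (levi φ v w) z) + 2 * (F 2 (φ z) * u * conj (levi φ b w z))
        + F 3 (φ z) * (q * conj q) * levi φ v v z + F 2 (φ z) * levi φ w w z * levi φ v v z
        + 2 * (F 2 (φ z) * q * dB w (levi φ v v) z) + F 1 (φ z) * dH w (dB w (levi φ v v)) z
        + 2 * (F 2 (φ z) * q * levi φ v b z) + 2 * (F 1 (φ z) * dH w (levi φ v b) z)
        + F 1 (φ z) * levi φ b b z : ℂ).re := by
  have dl (v w y : Cn n) (hy : y ∈ W) : DifferentiableAt ℝ (levi φ v w) y :=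
    differentiableAt_of_smooth hW (contDiffOn_levi hW hφ v w) hy
  have dd (v y : Cn n) (hy : y ∈ W) : DifferentiableAt ℝ (del φ v) y :=
    differentiableAt_of_smooth hW (contDiffOn_del hW hφ v) hy
  have ddc (v y : Cn n) (hy : y ∈ W) : DifferentiableAt ℝ (fun y => conj (del φ v y)) y :=
    Complex.conjCLE.differentiableAt.comp y (dd v y hy)
  have dF (k : ℕ) (y : Cn n) (hy : y ∈ W) : DifferentiableAt ℝ (fun y => (F k (φ y) : ℂ)) y :=
    Complex.ofRealCLM.differentiableAt.comp y
      ((hF k _).differentiableAt.comp y (differentiableAt_of_smooth hW hφ hy))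
  have dBl (y : Cn n) (hy : y ∈ W) : DifferentiableAt ℝ (dB w (levi φ v v)) y :=
    differentiableAt_of_smooth hW (contDiffOn_dB hW (contDiffOn_levi hW hφ v v) w) hy
  have dHd (y : Cn n) (hy : y ∈ W) : DifferentiableAt ℝ (fun y => conj (dH w (del φ v) y)) y :=
    differentiableAt_of_smooth hW
      (contDiffOn_conj (contDiffOn_dH hW (contDiffOn_del hW hφ v) w)) hy
  have ds (v w y : Cn n) (hy : y ∈ W) : DifferentiableAt ℝ (fun y => sesq (g₀ y) v w) y :=
    differentiableAt_of_smooth hW (contDiffOn_sesq hg₀ v w) hy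
  have dp (v w y : Cn n) (hy : y ∈ W) :
      DifferentiableAt ℝ (fun y => del φ v y * conj (del φ w y)) y := (dd v y hy).mul (ddc w y hy)
  have hdHp (v b : Cn n) (y : Cn n) (hy : y ∈ W) : dH w (fun y => del φ v y * conj (del φ b y)) y
      = dH w (del φ v) y * conj (del φ b y) + del φ v y * conj (levi φ b w y) := by
    rw [dH_mul _ (dd v y hy) (ddc b y hy), dH_conj_del hW hφ hy]
  have hdBp (y : Cn n) (hy : y ∈ W) : dB w (fun y => del φ v y * conj (del φ v y)) y
      = levi φ v w y * conj (del φ v y) + del φ v y * conj (dH w (del φ v) y) := by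
    rw [dB_mul _ (dd v y hy) (ddc v y hy), dB_conj_del hW hφ hy, levi]
  have h1 : dH w (fun y => sesq (g y) v b) z = dH w (fun y => sesq (g₀ y) v b) z
      + ((F 2 (φ z) * q * levi φ v b z + F 1 (φ z) * dH w (levi φ v b) z)
        + (F 3 (φ z) * q * (u * conj (del φ b z))
          + F 2 (φ z) * (dH w (del φ v) z * conj (del φ b z) + u * conj (levi φ b w z)))) := by
    rw [dH_congr_on hW (fun y hy => hg y hy v b) hz, dH_add _ (ds v b z hz)
        (((dF 1 z hz).fun_mul (dl v b z hz)).fun_add ((dF 2 z hz).fun_mul (dp v b z hz))),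
      dH_add _ ((dF 1 z hz).fun_mul (dl v b z hz)) ((dF 2 z hz).fun_mul (dp v b z hz)),
      dH_real_mul hW hφ hz hF 1 (dl v b z hz), dH_real_mul hW hφ hz hF 2 (dp v b z hz),
      hdHp v b z hz, hq, hu]
  have hB : EqOn (dB w fun y => sesq (g y) v v) (fun y => dB w (fun y => sesq (g₀ y) v v) y
      + (((F 2 (φ y) : ℂ) * (conj (del φ w y) * levi φ v v y)
          + (F 1 (φ y) : ℂ) * dB w (levi φ v v) y)
        + ((F 3 (φ y) : ℂ) * (conj (del φ w y) * (del φ v y * conj (del φ v y)))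
          + (F 2 (φ y) : ℂ) * (levi φ v w y * conj (del φ v y)
            + del φ v y * conj (dH w (del φ v) y))))) W := by
    intro y hy
    simp only
    rw [dB_congr_on hW (fun y hy => hg y hy v v) hy, dB_add _ (ds v v y hy)
        (((dF 1 y hy).fun_mul (dl v v y hy)).fun_add ((dF 2 y hy).fun_mul (dp v v y hy))),
      dB_add _ ((dF 1 y hy).fun_mul (dl v v y hy)) ((dF 2 y hy).fun_mul (dp v v y hy)),
      dB_real_mul hW hφ hy hF 1 (dl v v y hy), dB_real_mul hW hφ hy hF 2 (dp v v y hy),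
      hdBp y hy]
    ring
  have hdBs : DifferentiableAt ℝ (dB w fun y => sesq (g₀ y) v v) z :=
    differentiableAt_of_smooth hW (contDiffOn_dB hW (contDiffOn_sesq hg₀ v v) w) hz
  have e1 : DifferentiableAt ℝ (fun y => conj (del φ w y) * levi φ v v y) z :=
    (ddc w z hz).mul (dl v v z hz)
  have e2 : DifferentiableAt ℝ (fun y => conj (del φ w y) * (del φ v y * conj (del φ v y))) z :=
    (ddc w z hz).mul (dp v v z hz)
  have e3 : DifferentiableAt ℝ (fun y => levi φ v w y * conj (del φ v y)) z :=
    (dl v w z hz).mul (ddc v z hz)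
  have e4 : DifferentiableAt ℝ (fun y => del φ v y * conj (dH w (del φ v) y)) z :=
    (dd v z hz).mul (dHd z hz)
  have h5 : dH w (fun y => conj (dH w (del φ v) y)) z = conj (dH w (levi φ v w) z) := by
    rw [dH_conj _ (differentiableAt_of_smooth hW (contDiffOn_dH hW (contDiffOn_del hW hφ v) w) hz),
      ← dH_dB_comm hW (contDiffOn_del hW hφ v) hz]
    rfl
  have h2 : dH w (dB w fun y => sesq (g y) v v) z = dH w (dB w fun y => sesq (g₀ y) v v) z
      + (((F 3 (φ z) * q * (conj q * levi φ v v z)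
            + F 2 (φ z) * (conj (levi φ w w z) * levi φ v v z + conj q * dH w (levi φ v v) z))
          + (F 2 (φ z) * q * dB w (levi φ v v) z + F 1 (φ z) * dH w (dB w (levi φ v v)) z))
        + ((F 4 (φ z) * q * (conj q * (u * conj u)) + F 3 (φ z) * (conj (levi φ w w z) * (u * conj u)
              + conj q * (dH w (del φ v) z * conj u + u * conj (levi φ v w z))))
          + (F 3 (φ z) * q * (levi φ v w z * conj u + u * conj (dH w (del φ v) z))
            + F 2 (φ z) * ((dH w (levi φ v w) z * conj u + levi φ v w z * conj (levi φ v w z))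
              + (dH w (del φ v) z * conj (dH w (del φ v) z)
                + u * conj (dH w (levi φ v w) z)))))) := by
    rw [dH_congr_on hW hB hz, dH_add _ hdBs
        ((((dF 2 z hz).fun_mul e1).fun_add ((dF 1 z hz).fun_mul (dBl z hz))).fun_add
          (((dF 3 z hz).fun_mul e2).fun_add ((dF 2 z hz).fun_mul (e3.fun_add e4)))),
      dH_add _ (((dF 2 z hz).fun_mul e1).fun_add ((dF 1 z hz).fun_mul (dBl z hz)))
          (((dF 3 z hz).fun_mul e2).fun_add ((dF 2 z hz).fun_mul (e3.fun_add e4))),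
      dH_add _ ((dF 2 z hz).fun_mul e1) ((dF 1 z hz).fun_mul (dBl z hz)),
      dH_add _ ((dF 3 z hz).fun_mul e2) ((dF 2 z hz).fun_mul (e3.fun_add e4)),
      dH_real_mul hW hφ hz hF 2 e1, dH_real_mul hW hφ hz hF 1 (dBl z hz),
      dH_real_mul hW hφ hz hF 3 e2, dH_real_mul hW hφ hz hF 2 (e3.fun_add e4),
      dH_add _ e3 e4, dH_mul _ (ddc w z hz) (dl v v z hz), dH_mul _ (ddc w z hz) (dp v v z hz),
      dH_mul _ (dl v w z hz) (ddc v z hz), dH_mul _ (dd v z hz) (dHd z hz), hdHp v v z hz,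
      dH_conj_del hW hφ hz, dH_conj_del hW hφ hz, h5, hq, hu]
  have h3 : sesq (g z) b b = sesq (g₀ z) b b + ((F 1 (φ z) : ℂ) * levi φ b b z
      + (F 2 (φ z) : ℂ) * (del φ b z * conj (del φ b z))) := hg z hz b b
  have hr1 : conj (levi φ w w z) = levi φ w w z := levi_conj hW hφ hz w w
  have hr2 : dH w (levi φ v v) z = conj (dB w (levi φ v v) z) := by
    rw [← dH_conj _ (dl v v z hz)]
    exact dH_congr_on hW (fun y hy => (levi_conj hW hφ hy v v).symm) hz w
  have hn (x : ℂ) : ((‖x‖ ^ 2 : ℝ) : ℂ) = x * conj x := by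
    rw [Complex.mul_conj, Complex.normSq_eq_norm_sq]
  have hnr (x : ℂ) : ‖x‖ ^ 2 = (x * conj x).re := by rw [← hn, Complex.ofReal_re]
  rw [discHessian, discHessian, h1, h2, h3, hr1, hr2]
  have hlead : F 4 (φ z) * (‖q‖ ^ 2 * ‖u‖ ^ 2) + 2 * F 3 (φ z) * (q * u * conj κ).re
        + F 2 (φ z) * ‖κ‖ ^ 2 = ((F 4 (φ z) : ℂ) * ((q * conj q) * (u * conj u))
          + 2 * (F 3 (φ z) : ℂ) * (q * u * conj κ) + (F 2 (φ z) : ℂ) * (κ * conj κ)).re := by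
    rw [← hn q, ← hn u, ← hn κ]
    simp only [Complex.add_re, ← Complex.ofReal_mul, Complex.ofReal_re]
    rw [show (2 : ℂ) * (F 3 (φ z) : ℂ) = ((2 * F 3 (φ z) : ℝ) : ℂ) by push_cast; rfl,
      Complex.re_ofReal_mul]
  rw [hlead, hκ]
  set B := dH w (del φ v) z
  set pb := del φ b z
  set A1 := levi φ v w z
  set A2 := levi φ v b z
  set A3 := levi φ b w z
  set d1 := dH w (levi φ v w) z
  set d2 := dB w (levi φ v v) z
  set d3 := dH w (levi φ v b) z
  set d4 := dH w (dB w (levi φ v v)) z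
  set Aw := levi φ w w z
  set Av := levi φ v v z
  set Ab := levi φ b b z
  -- Complex numbers that differ by t - conj t have equal real parts. This permits replacing terms
  -- by their conjugates before a purely algebraic verification.
  have key (x y : ℂ) (h : ∃ t : ℂ, x = y + (t - conj t)) : x.re = y.re := by
    obtain ⟨t, rfl⟩ := h; simp
  have two (x : ℂ) : 2 * x.re = (2 * x).re := by simp
  simp only [two, ← Complex.add_re]
  have hAv : conj Av = Av := levi_conj hW hφ hz v v
  apply key
  -- The summands of t are the terms that occur with their conjugates on the left and are written
  -- twice, in one of the two forms, on the right.
  refine ⟨F 2 (φ z) * conj q * conj d2 + F 3 (φ z) * conj q * (B * conj u + u * conj A1)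
    + F 2 (φ z) * u * conj d1 + F 2 (φ z) * B * conj pb, ?_⟩
  simp only [map_add, map_mul, Complex.conj_conj, Complex.conj_ofReal]
  ring

end PotentialMetric

/-! ### Uniform bounds on compact sets for smooth forms and their derivatives. -/

section Bounds

variable {n : ℕ} {U S : Set (Cn n)} {z : Cn n}

theorem exists_bound_of_smooth {E : Type*} [NormedAddCommGroup E] {f : Cn n → E}
    (hS : IsCompact S) (hSU : S ⊆ U) (hf : ContinuousOn f U) :
    ∃ C : ℝ, 0 ≤ C ∧ ∀ z ∈ S, ‖f z‖ ≤ C := by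
  obtain ⟨C, hC⟩ := hS.exists_bound_of_continuousOn (hf.mono hSU)
  exact ⟨max C 0, le_max_right _ _, fun z hz => (hC z hz).trans (le_max_left _ _)⟩

theorem exists_bound_of_smooth_family {ι E : Type*} [Fintype ι] [NormedAddCommGroup E]
    {f : ι → Cn n → E} (hS : IsCompact S) (hSU : S ⊆ U) (hf : ∀ i, ContinuousOn (f i) U) :
    ∃ C : ℝ, 0 ≤ C ∧ ∀ i, ∀ z ∈ S, ‖f i z‖ ≤ C := by
  choose C hC0 hC using fun i => exists_bound_of_smooth hS hSU (hf i)
  exact ⟨∑ i, C i, Finset.sum_nonneg fun i _ => hC0 i, fun i z hz =>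
    (hC i z hz).trans (Finset.single_le_sum (fun i _ => hC0 i) (Finset.mem_univ i))⟩

theorem norm_sesq_le {G : Matrix (Fin n) (Fin n) ℂ} {C : ℝ} (hG : ∀ α β, ‖G α β‖ ≤ C)
    (v w : Cn n) : ‖sesq G v w‖ ≤ (n * (n * C)) * (‖v‖ * ‖w‖) := by
  rw [sesq_apply]
  have h (α β : Fin n) : ‖G α β * v α * conj (w β)‖ ≤ C * (‖v‖ * ‖w‖) := by
    have hC : 0 ≤ C := (norm_nonneg _).trans (hG α β)
    rw [norm_mul, norm_mul, RCLike.norm_conj, mul_assoc]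
    have h1 := hG α β
    have h2 := PiLp.norm_apply_le v α
    have h3 := PiLp.norm_apply_le w β
    gcongr
  calc _ ≤ ∑ _α : Fin n, ∑ _β : Fin n, C * (‖v‖ * ‖w‖) :=
        (norm_sum_le _ _).trans (Finset.sum_le_sum fun α _ => (norm_sum_le _ _).trans
          (Finset.sum_le_sum fun β _ => h α β))
    _ = _ := by simp; ring

theorem norm_dH_le {f : Cn n → ℂ} {C : ℝ} (hf : ∀ α, ‖dH (basisVec α) f z‖ ≤ C) (w : Cn n) :
    ‖dH w f z‖ ≤ n * C * ‖w‖ := by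
  rw [dH_eq_sum]
  calc _ ≤ ∑ _α : Fin n, C * ‖w‖ := (norm_sum_le _ _).trans (Finset.sum_le_sum fun α _ => by
        rw [norm_mul, mul_comm]
        have hC : 0 ≤ C := (norm_nonneg _).trans (hf α)
        have h1 := hf α
        have h2 := PiLp.norm_apply_le w α
        gcongr)
    _ = _ := by simp; ring

theorem norm_dB_le {f : Cn n → ℂ} {C : ℝ} (hf : ∀ α, ‖dB (basisVec α) f z‖ ≤ C) (w : Cn n) :
    ‖dB w f z‖ ≤ n * C * ‖w‖ := by
  rw [dB_eq_sum]
  calc _ ≤ ∑ _α : Fin n, C * ‖w‖ := (norm_sum_le _ _).trans (Finset.sum_le_sum fun α _ => by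
        rw [norm_mul, mul_comm, RCLike.norm_conj]
        have hC : 0 ≤ C := (norm_nonneg _).trans (hf α)
        have h1 := hf α
        have h2 := PiLp.norm_apply_le w α
        gcongr)
    _ = _ := by simp; ring

/-- `C` bounds a field of sesquilinear forms and its first and mixed second derivatives at `z`. -/
structure FormBound (s : Cn n → Cn n → Cn n → ℂ) (C : ℝ) (z : Cn n) : Prop where
  val : ∀ v w, ‖s v w z‖ ≤ C * (‖v‖ * ‖w‖)
  hol : ∀ u v w, ‖dH u (s v w) z‖ ≤ C * (‖u‖ * (‖v‖ * ‖w‖))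
  anti : ∀ u v w, ‖dB u (s v w) z‖ ≤ C * (‖u‖ * (‖v‖ * ‖w‖))
  mixed : ∀ u v w, ‖dH u (dB u (s v w)) z‖ ≤ C * ((‖u‖ * ‖u‖) * (‖v‖ * ‖w‖))

theorem FormBound.congr {s s' : Cn n → Cn n → Cn n → ℂ} {C : ℝ} {W : Set (Cn n)}
    (h : FormBound s C z) (hW : IsOpen W) (hz : z ∈ W) (hs : ∀ v w, EqOn (s' v w) (s v w) W) :
    FormBound s' C z where
  val v w := by rw [hs v w hz]; exact h.val v w
  hol u v w := by rw [dH_congr_on hW (hs v w) hz]; exact h.hol u v w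
  anti u v w := by rw [dB_congr_on hW (hs v w) hz]; exact h.anti u v w
  mixed u v w := by
    rw [dH_congr_on hW (fun y hy => dB_congr_on hW (hs v w) hy u) hz]; exact h.mixed u v w

/-- On a compact set the finitely many coefficients and their derivatives are bounded, and the
powers of n count the indices in the expansions of the directional derivatives. -/
theorem exists_formBound (hU : IsOpen U) (hS : IsCompact S) (hSU : S ⊆ U)
    {G : Cn n → Matrix (Fin n) (Fin n) ℂ} (hG : ∀ α β, ContDiffOn ℝ ∞ (fun y => G y α β) U) :
    ∃ C : ℝ, 0 ≤ C ∧ ∀ z ∈ S, FormBound (fun v w y => sesq (G y) v w) C z := by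
  obtain ⟨C₁, h₁, H₁⟩ := exists_bound_of_smooth_family (ι := Fin n × Fin n)
    (f := fun i y => G y i.1 i.2) hS hSU fun i => (hG i.1 i.2).continuousOn
  obtain ⟨C₂, h₂, H₂⟩ := exists_bound_of_smooth_family (ι := Fin n × Fin n × Fin n)
    (f := fun i => dH (basisVec i.1) fun y => G y i.2.1 i.2.2) hS hSU
    fun i => (contDiffOn_dH hU (hG i.2.1 i.2.2) _).continuousOn
  obtain ⟨C₃, h₃, H₃⟩ := exists_bound_of_smooth_family (ι := Fin n × Fin n × Fin n)
    (f := fun i => dB (basisVec i.1) fun y => G y i.2.1 i.2.2) hS hSU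
    fun i => (contDiffOn_dB hU (hG i.2.1 i.2.2) _).continuousOn
  obtain ⟨C₄, h₄, H₄⟩ := exists_bound_of_smooth_family (ι := Fin n × Fin n × Fin n × Fin n)
    (f := fun i => dH (basisVec i.1) (dB (basisVec i.2.1) fun y => G y i.2.2.1 i.2.2.2)) hS hSU
    fun i => (contDiffOn_dH hU (contDiffOn_dB hU (hG i.2.2.1 i.2.2.2) _) _).continuousOn
  have h₂' (γ α β : Fin n) (z : Cn n) (hz : z ∈ S) :
      ‖dH (basisVec γ) (fun y => G y α β) z‖ ≤ C₂ := H₂ (γ, α, β) z hz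
  have h₃' (γ α β : Fin n) (z : Cn n) (hz : z ∈ S) :
      ‖dB (basisVec γ) (fun y => G y α β) z‖ ≤ C₃ := H₃ (γ, α, β) z hz
  have h₄' (γ δ α β : Fin n) (z : Cn n) (hz : z ∈ S) :
      ‖dH (basisVec γ) (dB (basisVec δ) fun y => G y α β) z‖ ≤ C₄ := H₄ (γ, δ, α, β) z hz
  have e₁ : 0 ≤ (n : ℝ) * (n * C₁) := by positivity
  have e₂ : 0 ≤ (n : ℝ) * (n * (n * C₂)) := by positivity
  have e₃ : 0 ≤ (n : ℝ) * (n * (n * C₃)) := by positivity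
  have e₄ : 0 ≤ (n : ℝ) * (n * (n * (n * C₄))) := by positivity
  refine ⟨n * (n * C₁) + n * (n * (n * C₂)) + n * (n * (n * C₃)) + n * (n * (n * (n * C₄))),
    by positivity, fun z hz => ⟨fun v w => ?_, fun u v w => ?_, fun u v w => ?_, fun u v w => ?_⟩⟩
  · have h := norm_sesq_le (G := G z) (fun α β => H₁ (α, β) z hz) v w
    exact h.trans (mul_le_mul_of_nonneg_right (by linarith) (by positivity))
  · have h (α β : Fin n) : ‖dH u (fun y => G y α β) z‖ ≤ n * C₂ * ‖u‖ :=
      norm_dH_le (f := fun y => G y α β) (fun γ => h₂' γ α β z hz) u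
    rw [dH_sesq hU hG (hSU hz)]
    have h' := norm_sesq_le (G := Matrix.of fun α β => dH u (fun y => G y α β) z) h v w
    refine h'.trans ?_
    rw [show (n * (n * (n * C₂ * ‖u‖))) * (‖v‖ * ‖w‖)
      = (n * (n * (n * C₂))) * (‖u‖ * (‖v‖ * ‖w‖)) by ring]
    exact mul_le_mul_of_nonneg_right (by linarith) (by positivity)
  · have h (α β : Fin n) : ‖dB u (fun y => G y α β) z‖ ≤ n * C₃ * ‖u‖ :=
      norm_dB_le (f := fun y => G y α β) (fun γ => h₃' γ α β z hz) u
    rw [dB_sesq hU hG (hSU hz)]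
    have h' := norm_sesq_le (G := Matrix.of fun α β => dB u (fun y => G y α β) z) h v w
    refine h'.trans ?_
    rw [show (n * (n * (n * C₃ * ‖u‖))) * (‖v‖ * ‖w‖)
      = (n * (n * (n * C₃))) * (‖u‖ * (‖v‖ * ‖w‖)) by ring]
    exact mul_le_mul_of_nonneg_right (by linarith) (by positivity)
  · have h (α β : Fin n) : ‖dH u (dB u (fun y => G y α β)) z‖ ≤ n * (n * C₄) * (‖u‖ * ‖u‖) := by
      rw [← sesq_complexHessian hU (hG α β) (hSU hz)]
      exact norm_sesq_le (fun γ δ => h₄' γ δ α β z hz) u u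
    rw [dH_dB_sesq hU hG (hSU hz)]
    have h' := norm_sesq_le (G := Matrix.of fun α β => dH u (dB u (fun y => G y α β)) z) h v w
    refine h'.trans ?_
    rw [show (n * (n * (n * (n * C₄) * (‖u‖ * ‖u‖)))) * (‖v‖ * ‖w‖)
      = (n * (n * (n * (n * C₄)))) * ((‖u‖ * ‖u‖) * (‖v‖ * ‖w‖)) by ring]
    exact mul_le_mul_of_nonneg_right (by linarith) (by positivity)

theorem exists_levi_formBound (hU : IsOpen U) (hS : IsCompact S) (hSU : S ⊆ U) {φ : Cn n → ℝ}
    (hφ : ContDiffOn ℝ ∞ φ U) :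
    ∃ C : ℝ, 0 ≤ C ∧ ∀ z ∈ S, FormBound (levi φ) C z := by
  obtain ⟨C, hC, h⟩ := exists_formBound hU hS hSU
    (G := fun y => complexHessian (fun y => (φ y : ℂ)) y)
    fun α β => contDiffOn_dH hU (contDiffOn_dB hU (contDiffOn_ofReal hφ) _) _
  exact ⟨C, hC, fun z hz => (h z hz).congr hU (hSU hz)
    fun v w y hy => (sesq_complexHessian_eq_levi hU hφ hy v w).symm⟩

theorem exists_del_bound (hU : IsOpen U) (hS : IsCompact S) (hSU : S ⊆ U) {φ : Cn n → ℝ}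
    (hφ : ContDiffOn ℝ ∞ φ U) :
    ∃ C : ℝ, 0 ≤ C ∧ ∀ z ∈ S, ∀ v, ‖del φ v z‖ ≤ C * ‖v‖ := by
  obtain ⟨C, hC, h⟩ := exists_bound_of_smooth_family (f := fun α => del φ (basisVec α)) hS hSU
    fun α => (contDiffOn_del hU hφ _).continuousOn
  exact ⟨n * C, by positivity, fun z hz v => norm_dH_le (fun α => h α z hz) v⟩

theorem exists_dH_del_bound (hU : IsOpen U) (hS : IsCompact S) (hSU : S ⊆ U) {φ : Cn n → ℝ}
    (hφ : ContDiffOn ℝ ∞ φ U) :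
    ∃ C : ℝ, 0 ≤ C ∧ ∀ z ∈ S, ∀ v w, ‖dH w (del φ v) z‖ ≤ C * (‖v‖ * ‖w‖) := by
  obtain ⟨C, hC, h⟩ := exists_bound_of_smooth_family (ι := Fin n × Fin n)
    (f := fun i => dH (basisVec i.1) (del φ (basisVec i.2))) hS hSU
    fun i => (contDiffOn_dH hU (contDiffOn_del hU hφ _) _).continuousOn
  refine ⟨n * (n * C), by positivity, fun z hz v w => ?_⟩
  have h1 (α : Fin n) : ‖dH (basisVec α) (del φ v) z‖ ≤ n * C * ‖v‖ := by
    have e : dH (basisVec α) (del φ v) z = dH v (del φ (basisVec α)) z :=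
      dH_dH_comm hU (contDiffOn_ofReal hφ) (hSU hz) _ _
    rw [e]
    refine norm_dH_le (fun β => ?_) v
    exact h (β, α) z hz
  refine (norm_dH_le h1 w).trans (le_of_eq (by ring))

end Bounds

/-! ### The inequality between real numbers behind the curvature estimate. -/

section Scalar

theorem mul_le_sq_add_sq (x y : ℝ) : x * y ≤ x ^ 2 + y ^ 2 := by
  nlinarith [sq_nonneg (x - y), sq_nonneg x, sq_nonneg y]

/-- The terms other than the leading ones in the Hessian of the edge metric are controlled. -/
theorem edge_scalar_estimate {V W Y Q β ρ P t C R K : ℝ} (hρ : 0 ≤ ρ) (hC : 0 ≤ C) (hR : 0 ≤ R) (hK : 0 ≤ K)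
    (hρR : ρ ≤ R) (htR : t ≤ R) (htρ : t ≤ R * ρ)
    (hβb : β ^ 2 ≤ C * t * (Q ^ 2 * Y ^ 2 + Q ^ 2 * V ^ 2 + W ^ 2 * Y ^ 2 + V ^ 2 * W ^ 2))
    (hP : C * (3 + 5 * R) * C * t ≤ P + K * ρ ^ 2) :
    C * (V ^ 2 * W ^ 2 + W * V * β + β ^ 2 + ρ * (Q ^ 2 * V ^ 2 + W ^ 2 * Y ^ 2 + Q * W * V * Y
      + V ^ 2 * W ^ 2 + Y * V * W ^ 2 + Y * β * W + Q * W * V ^ 2 + Q * V * β + V * W * β + β ^ 2))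
      - P * (Q ^ 2 * Y ^ 2)
    ≤ (C * (10 + 10 * R) + C * (3 + 5 * R) * C * (1 + R) * 3 + K)
      * ((V ^ 2 + ρ * Y ^ 2) * (W ^ 2 + ρ * Q ^ 2)) := by
  obtain ⟨T, hT⟩ : ∃ T, T = (V ^ 2 + ρ * Y ^ 2) * (W ^ 2 + ρ * Q ^ 2) := ⟨_, rfl⟩
  rw [← hT]
  -- All four products on the right are available as upper bounds, but Q²Y² only with the small
  -- weight ρ². Whatever exceeds that weight has to be paid by the negative term -P Q²Y².
  have hTe : T = V ^ 2 * W ^ 2 + ρ * (Q ^ 2 * V ^ 2) + ρ * (W ^ 2 * Y ^ 2)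
      + ρ ^ 2 * (Q ^ 2 * Y ^ 2) := by rw [hT]; ring
  have a1 : 0 ≤ V ^ 2 * W ^ 2 := by positivity
  have a2 : 0 ≤ ρ * (Q ^ 2 * V ^ 2) := by positivity
  have a3 : 0 ≤ ρ * (W ^ 2 * Y ^ 2) := by positivity
  have a4 : 0 ≤ ρ ^ 2 * (Q ^ 2 * Y ^ 2) := by positivity
  have hT0 : 0 ≤ T := by rw [hTe]; positivity
  have b1 : V ^ 2 * W ^ 2 ≤ T := by linarith
  have b2 : ρ * (Q ^ 2 * V ^ 2) ≤ T := by linarith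
  have b3 : ρ * (W ^ 2 * Y ^ 2) ≤ T := by linarith
  have b5 : ρ * (V ^ 2 * W ^ 2) ≤ R * T := mul_le_mul hρR b1 a1 hR
  have b6 : ρ * β ^ 2 ≤ R * β ^ 2 := mul_le_mul_of_nonneg_right hρR (sq_nonneg _)
  -- Each mixed product is split by xy ≤ x² + y² into products already dominated by T and multiples
  -- of β².
  have c1 : W * V * β ≤ V ^ 2 * W ^ 2 + β ^ 2 := by
    linarith [mul_le_sq_add_sq (W * V) β]
  have c2 : ρ * (Q * W * V * Y) ≤ ρ * (Q ^ 2 * V ^ 2 + W ^ 2 * Y ^ 2) :=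
    mul_le_mul_of_nonneg_left (by
      linarith [mul_le_sq_add_sq (Q * V) (W * Y)]) hρ
  have c3 : ρ * (Y * V * W ^ 2) ≤ ρ * (W ^ 2 * Y ^ 2 + V ^ 2 * W ^ 2) :=
    mul_le_mul_of_nonneg_left (by
      linarith [mul_le_sq_add_sq (W * Y) (V * W)]) hρ
  have c4 : ρ * (Y * β * W) ≤ ρ * (W ^ 2 * Y ^ 2 + β ^ 2) :=
    mul_le_mul_of_nonneg_left (by
      linarith [mul_le_sq_add_sq (W * Y) (β)]) hρ
  have c5 : ρ * (Q * W * V ^ 2) ≤ ρ * (Q ^ 2 * V ^ 2 + V ^ 2 * W ^ 2) :=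
    mul_le_mul_of_nonneg_left (by
      linarith [mul_le_sq_add_sq (Q * V) (V * W)]) hρ
  have c6 : ρ * (Q * V * β) ≤ ρ * (Q ^ 2 * V ^ 2 + β ^ 2) :=
    mul_le_mul_of_nonneg_left (by
      linarith [mul_le_sq_add_sq (Q * V) (β)]) hρ
  have c7 : ρ * (V * W * β) ≤ ρ * (V ^ 2 * W ^ 2 + β ^ 2) :=
    mul_le_mul_of_nonneg_left (by
      linarith [mul_le_sq_add_sq (V * W) (β)]) hρ
  have hβ2 := sq_nonneg β
  have hRT : 0 ≤ R * T := by positivity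
  have hRβ : 0 ≤ R * β ^ 2 := by positivity
  have d1 : V ^ 2 * W ^ 2 + W * V * β + β ^ 2 + ρ * (Q ^ 2 * V ^ 2 + W ^ 2 * Y ^ 2 + Q * W * V * Y
      + V ^ 2 * W ^ 2 + Y * V * W ^ 2 + Y * β * W + Q * W * V ^ 2 + Q * V * β + V * W * β + β ^ 2)
      ≤ (10 + 10 * R) * T + (3 + 5 * R) * β ^ 2 := by
    linarith only [c1, c2, c3, c4, c5, c6, c7, b1, b2, b3, b5, b6, hT0, hRT, hRβ, hβ2]
  -- Three of the four products in `hβb` are dominated by T, through t ≤ Rρ or t ≤ R. Only t Q²Y² is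
  -- left over.
  have d2 : β ^ 2 ≤ C * t * (Q ^ 2 * Y ^ 2) + C * (1 + R) * 3 * T := by
    refine hβb.trans ?_
    have f1 : t * (Q ^ 2 * V ^ 2) ≤ R * T := by
      calc t * (Q ^ 2 * V ^ 2) ≤ (R * ρ) * (Q ^ 2 * V ^ 2) :=
            mul_le_mul_of_nonneg_right htρ (by positivity)
        _ = R * (ρ * (Q ^ 2 * V ^ 2)) := by ring
        _ ≤ R * T := mul_le_mul_of_nonneg_left b2 hR
    have f2 : t * (W ^ 2 * Y ^ 2) ≤ R * T := by
      calc t * (W ^ 2 * Y ^ 2) ≤ (R * ρ) * (W ^ 2 * Y ^ 2) :=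
            mul_le_mul_of_nonneg_right htρ (by positivity)
        _ = R * (ρ * (W ^ 2 * Y ^ 2)) := by ring
        _ ≤ R * T := mul_le_mul_of_nonneg_left b3 hR
    have f3 : t * (V ^ 2 * W ^ 2) ≤ R * T := mul_le_mul htR b1 a1 hR
    have f4 : t * (Q ^ 2 * V ^ 2) + t * (W ^ 2 * Y ^ 2) + t * (V ^ 2 * W ^ 2) ≤ (1 + R) * 3 * T := by
      linarith only [f1, f2, f3, hT0]
    have := mul_le_mul_of_nonneg_left f4 hC
    linarith only [this]
  have d3 : C * ((3 + 5 * R) * β ^ 2)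
      ≤ C * ((3 + 5 * R) * (C * t * (Q ^ 2 * Y ^ 2) + C * (1 + R) * 3 * T)) := by gcongr
  -- The leftover t Q²Y² is absorbed by P, up to K ρ² Q²Y² ≤ K T. This is where the concavity gained
  -- from the second exponential is spent.
  have d4 : (C * (3 + 5 * R) * C * t) * (Q ^ 2 * Y ^ 2) ≤ (P + K * ρ ^ 2) * (Q ^ 2 * Y ^ 2) :=
    mul_le_mul_of_nonneg_right hP (by positivity)
  have d5 : K * (ρ ^ 2 * (Q ^ 2 * Y ^ 2)) ≤ K * T := mul_le_mul_of_nonneg_left (by linarith) hK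
  have d6 := mul_le_mul_of_nonneg_left d1 hC
  generalize V ^ 2 * W ^ 2 + W * V * β + β ^ 2 + ρ * (Q ^ 2 * V ^ 2 + W ^ 2 * Y ^ 2
    + Q * W * V * Y + V ^ 2 * W ^ 2 + Y * V * W ^ 2 + Y * β * W + Q * W * V ^ 2 + Q * V * β
    + V * W * β + β ^ 2) = X at d6 ⊢
  linarith only [d3, d4, d5, d6]

end Scalar

/-! ### The curvature estimate for edge metrics in an adapted chart. -/

section EdgeCurvature

/-- The derivatives of `t ↦ a e^{τ t} - c e^{τ' t}`. -/
def expDiff (a c τ τ' : ℝ) (k : ℕ) (t : ℝ) : ℝ :=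
  a * τ ^ k * Real.exp (τ * t) - c * τ' ^ k * Real.exp (τ' * t)

theorem hasDerivAt_expDiff (a c τ τ' : ℝ) (k : ℕ) (t : ℝ) :
    HasDerivAt (expDiff a c τ τ' k) (expDiff a c τ τ' (k + 1) t) t := by
  have h (σ : ℝ) : HasDerivAt (fun t => Real.exp (σ * t)) (σ * Real.exp (σ * t)) t := by
    have := ((hasDerivAt_id t).const_mul σ).exp
    simpa [mul_comm] using this
  refine (((h τ).const_mul (a * τ ^ k)).sub ((h τ').const_mul (c * τ' ^ k))).congr_deriv ?_
  simp only [expDiff]; ring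

/-- Every derivative of F is of the order of its first exponential: the exponents are at most 1, and
on a range bounded above the second exponential is dominated by the first. -/
theorem abs_expDiff_le {a c τ τ' R t : ℝ} (ha : 0 ≤ a) (hc : 0 ≤ c) (hτ : 0 ≤ τ) (hτ1 : τ ≤ 1)
    (hτ' : 0 ≤ τ') (hτ'1 : τ' ≤ 1) (hR : Real.exp (τ' * t) ≤ R * Real.exp (τ * t)) (k : ℕ) :
    |expDiff a c τ τ' k t| ≤ (a + c * R) * Real.exp (τ * t) := by
  have h1 : a * τ ^ k * Real.exp (τ * t) ≤ a * Real.exp (τ * t) :=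
    mul_le_mul_of_nonneg_right (mul_le_of_le_one_right ha (pow_le_one₀ hτ hτ1)) (Real.exp_nonneg _)
  have h2 : c * τ' ^ k * Real.exp (τ' * t) ≤ c * Real.exp (τ' * t) :=
    mul_le_mul_of_nonneg_right (mul_le_of_le_one_right hc (pow_le_one₀ hτ' hτ'1)) (Real.exp_nonneg _)
  have h3 : c * Real.exp (τ' * t) ≤ c * (R * Real.exp (τ * t)) := mul_le_mul_of_nonneg_left hR hc
  have h4 : 0 ≤ a * τ ^ k * Real.exp (τ * t) := by positivity
  have h5 : 0 ≤ c * τ' ^ k * Real.exp (τ' * t) := by positivity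
  rw [expDiff, abs_le]
  constructor <;> nlinarith only [h1, h2, h3, h4, h5]

/-- The concavity of `log F''` for `F = a e^{τ t} - c e^{τ' t}`. -/
theorem expDiff_concavity {a c τ τ' t : ℝ}
    (hpos : c * τ' ^ 2 * Real.exp (τ' * t) < a * τ ^ 2 * Real.exp (τ * t)) :
    expDiff a c τ τ' 4 t - expDiff a c τ τ' 3 t ^ 2 / expDiff a c τ τ' 2 t
      ≤ - ((τ' - τ) ^ 2 * (c * τ' ^ 2 * Real.exp (τ' * t))) := by
  set x := a * τ ^ 2 * Real.exp (τ * t) with hx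
  set y := c * τ' ^ 2 * Real.exp (τ' * t) with hy
  have e2 : expDiff a c τ τ' 2 t = x - y := rfl
  have e3 : expDiff a c τ τ' 3 t = τ * x - τ' * y := by simp only [expDiff, hx, hy]; ring
  have e4 : expDiff a c τ τ' 4 t = τ ^ 2 * x - τ' ^ 2 * y := by simp only [expDiff, hx, hy]; ring
  have h : 0 < x - y := by linarith
  rw [e2, e3, e4, sub_le_iff_le_add, ← sub_le_iff_le_add', le_div_iff₀ h]
  -- Direct computation gives (x - y)(τ²x - τ'²y) - (τx - τ'y)² = -(τ' - τ)² x y. Comparing with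
  -- -(τ' - τ)² y (x - y) leaves the square of (τ' - τ) y.
  nlinarith only [sq_nonneg ((τ' - τ) * y)]

/-- Since τ' < 1, e^t is negligible against e^{τ't} as t → -∞, so the first term suffices below a
threshold t₁. On the remaining range t₁ ≤ t ≤ t₀ the exponential e^{2τt} is bounded below, and a
large K suffices. -/
theorem exists_exp_absorb {p τ τ' : ℝ} (hp : 0 < p) (hτ : 0 < τ) (hτ'1 : τ' < 1) (C t₀ : ℝ)
    (hC : 0 ≤ C) : ∃ K : ℝ, 0 ≤ K ∧ ∀ t ≤ t₀,
      C * Real.exp t ≤ p * Real.exp (τ' * t) + K * Real.exp (τ * t) ^ 2 := by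
  -- The threshold at which e^{(1-τ')t} reaches p/(C + 1); the added 1 covers the case C = 0.
  set t₁ := Real.log (p / (C + 1)) / (1 - τ') with ht₁
  have h1 : (1 - τ') * t₁ = Real.log (p / (C + 1)) := by
    rw [ht₁]; field_simp [(sub_pos.2 hτ'1).ne']
  refine ⟨C * Real.exp (t₀ - 2 * (τ * t₁)), by positivity, fun t ht => ?_⟩
  rcases le_total t t₁ with h | h
  · have e : Real.exp t = Real.exp ((1 - τ') * t) * Real.exp (τ' * t) := by
      rw [← Real.exp_add]; congr 1; ring
    have h2 : Real.exp ((1 - τ') * t) ≤ p / (C + 1) := by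
      calc _ ≤ Real.exp ((1 - τ') * t₁) :=
            Real.exp_le_exp.2 (mul_le_mul_of_nonneg_left h (sub_pos.2 hτ'1).le)
        _ = _ := by rw [h1, Real.exp_log (by positivity)]
    have h3 : C * Real.exp ((1 - τ') * t) ≤ p := by
      calc _ ≤ C * (p / (C + 1)) := mul_le_mul_of_nonneg_left h2 hC
        _ = p * (C / (C + 1)) := by ring
        _ ≤ p * 1 := mul_le_mul_of_nonneg_left
            ((div_le_one (by positivity)).2 (by linarith)) hp.le
        _ = p := mul_one p
    calc _ = C * Real.exp ((1 - τ') * t) * Real.exp (τ' * t) := by rw [e]; ring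
      _ ≤ p * Real.exp (τ' * t) := mul_le_mul_of_nonneg_right h3 (Real.exp_nonneg _)
      _ ≤ _ := le_add_of_nonneg_right (by positivity)
  · have h2 : Real.exp t ≤ Real.exp (t₀ - 2 * (τ * t₁)) * Real.exp (τ * t) ^ 2 := by
      rw [← Real.exp_nat_mul, ← Real.exp_add, Real.exp_le_exp]
      push_cast
      nlinarith
    calc _ ≤ C * (Real.exp (t₀ - 2 * (τ * t₁)) * Real.exp (τ * t) ^ 2) :=
          mul_le_mul_of_nonneg_left h2 hC
      _ = C * Real.exp (t₀ - 2 * (τ * t₁)) * Real.exp (τ * t) ^ 2 := by ring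
      _ ≤ _ := le_add_of_nonneg_left (by positivity)

theorem exp_mul_le_exp_mul {τ σ t t₀ : ℝ} (hτσ : τ ≤ σ) (ht : t ≤ t₀) :
    Real.exp (σ * t) ≤ Real.exp ((σ - τ) * t₀) * Real.exp (τ * t) := by
  rw [← Real.exp_add, Real.exp_le_exp]
  nlinarith [mul_le_mul_of_nonneg_left ht (sub_nonneg.2 hτσ)]

/-- These are the terms of `discHessian_potential` that contain the Levi form. Each is at most Mρ,
times C or C², times a product of the norms of v, w, b, q and u. None contains the singular product
|q|²|u|². -/
theorem norm_rest_le {n : ℕ} {z : Cn n} {C M ρ : ℝ} {φ : Cn n → ℝ} {F₁ F₂ F₃ : ℝ}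
    (hC : 0 ≤ C) (h : FormBound (levi φ) C z) (h₁ : |F₁| ≤ M * ρ)
    (h₂ : |F₂| ≤ M * ρ) (h₃ : |F₃| ≤ M * ρ) (v w b : Cn n) (q u : ℂ) :
    ‖(F₃ * levi φ w w z * (u * conj u) + 2 * (F₃ * q * levi φ v w z * conj u)
        + F₂ * (levi φ v w z * conj (levi φ v w z))
        + 2 * (F₂ * conj u * dH w (levi φ v w) z) + 2 * (F₂ * u * conj (levi φ b w z))
        + F₃ * (q * conj q) * levi φ v v z + F₂ * levi φ w w z * levi φ v v z
        + 2 * (F₂ * q * dB w (levi φ v v) z) + F₁ * dH w (dB w (levi φ v v)) z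
        + 2 * (F₂ * q * levi φ v b z) + 2 * (F₁ * dH w (levi φ v b) z)
        + F₁ * levi φ b b z : ℂ)‖
      ≤ 2 * M * (C + C ^ 2) * (ρ * (‖q‖ ^ 2 * ‖v‖ ^ 2 + ‖w‖ ^ 2 * ‖u‖ ^ 2 + ‖q‖ * ‖w‖ * ‖v‖ * ‖u‖
        + ‖v‖ ^ 2 * ‖w‖ ^ 2 + ‖u‖ * ‖v‖ * ‖w‖ ^ 2 + ‖u‖ * ‖b‖ * ‖w‖ + ‖q‖ * ‖w‖ * ‖v‖ ^ 2
        + ‖q‖ * ‖v‖ * ‖b‖ + ‖v‖ * ‖w‖ * ‖b‖ + ‖b‖ ^ 2)) := by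
  have hMρ : 0 ≤ M * ρ := (abs_nonneg _).trans h₁
  have n2 : ‖(2 : ℂ)‖ = 2 := by simp
  have t1 : ‖(F₃ : ℂ) * levi φ w w z * (u * conj u)‖ ≤ M * ρ * (C * (‖w‖ * ‖w‖)) * (‖u‖ * ‖u‖) := by
    rw [norm_mul, norm_mul, norm_mul, Complex.norm_real, RCLike.norm_conj, Real.norm_eq_abs]
    gcongr; exact h.val w w
  have t2 : ‖2 * ((F₃ : ℂ) * q * levi φ v w z * conj u)‖
      ≤ 2 * (M * ρ * ‖q‖ * (C * (‖v‖ * ‖w‖)) * ‖u‖) := by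
    rw [norm_mul, norm_mul, norm_mul, norm_mul, Complex.norm_real, RCLike.norm_conj,
      Real.norm_eq_abs, n2]
    gcongr; exact h.val v w
  have t3 : ‖(F₂ : ℂ) * (levi φ v w z * conj (levi φ v w z))‖
      ≤ M * ρ * ((C * (‖v‖ * ‖w‖)) * (C * (‖v‖ * ‖w‖))) := by
    rw [norm_mul, norm_mul, Complex.norm_real, RCLike.norm_conj, Real.norm_eq_abs]
    have := h.val v w
    gcongr
  have t4 : ‖2 * ((F₂ : ℂ) * conj u * dH w (levi φ v w) z)‖
      ≤ 2 * (M * ρ * ‖u‖ * (C * (‖w‖ * (‖v‖ * ‖w‖)))) := by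
    rw [norm_mul, norm_mul, norm_mul, Complex.norm_real, RCLike.norm_conj, Real.norm_eq_abs, n2]
    gcongr; exact h.hol w v w
  have t5 : ‖2 * ((F₂ : ℂ) * u * conj (levi φ b w z))‖
      ≤ 2 * (M * ρ * ‖u‖ * (C * (‖b‖ * ‖w‖))) := by
    rw [norm_mul, norm_mul, norm_mul, Complex.norm_real, RCLike.norm_conj, Real.norm_eq_abs, n2]
    gcongr; exact h.val b w
  have t6 : ‖(F₃ : ℂ) * (q * conj q) * levi φ v v z‖
      ≤ M * ρ * (‖q‖ * ‖q‖) * (C * (‖v‖ * ‖v‖)) := by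
    rw [norm_mul, norm_mul, norm_mul, Complex.norm_real, RCLike.norm_conj, Real.norm_eq_abs]
    gcongr; exact h.val v v
  have t7 : ‖(F₂ : ℂ) * levi φ w w z * levi φ v v z‖
      ≤ M * ρ * (C * (‖w‖ * ‖w‖)) * (C * (‖v‖ * ‖v‖)) := by
    rw [norm_mul, norm_mul, Complex.norm_real, Real.norm_eq_abs]
    gcongr
    · exact h.val w w
    · exact h.val v v
  have t8 : ‖2 * ((F₂ : ℂ) * q * dB w (levi φ v v) z)‖
      ≤ 2 * (M * ρ * ‖q‖ * (C * (‖w‖ * (‖v‖ * ‖v‖)))) := by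
    rw [norm_mul, norm_mul, norm_mul, Complex.norm_real, Real.norm_eq_abs, n2]
    gcongr; exact h.anti w v v
  have t9 : ‖(F₁ : ℂ) * dH w (dB w (levi φ v v)) z‖
      ≤ M * ρ * (C * ((‖w‖ * ‖w‖) * (‖v‖ * ‖v‖))) := by
    rw [norm_mul, Complex.norm_real, Real.norm_eq_abs]
    gcongr; exact h.mixed w v v
  have t10 : ‖2 * ((F₂ : ℂ) * q * levi φ v b z)‖
      ≤ 2 * (M * ρ * ‖q‖ * (C * (‖v‖ * ‖b‖))) := by
    rw [norm_mul, norm_mul, norm_mul, Complex.norm_real, Real.norm_eq_abs, n2]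
    gcongr; exact h.val v b
  have t11 : ‖2 * ((F₁ : ℂ) * dH w (levi φ v b) z)‖
      ≤ 2 * (M * ρ * (C * (‖w‖ * (‖v‖ * ‖b‖)))) := by
    rw [norm_mul, norm_mul, Complex.norm_real, Real.norm_eq_abs, n2]
    gcongr; exact h.hol w v b
  have t12 : ‖(F₁ : ℂ) * levi φ b b z‖ ≤ M * ρ * (C * (‖b‖ * ‖b‖)) := by
    rw [norm_mul, Complex.norm_real, Real.norm_eq_abs]
    gcongr; exact h.val b b
  refine (norm_add_le_of_le (norm_add_le_of_le (norm_add_le_of_le (norm_add_le_of_le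
    (norm_add_le_of_le (norm_add_le_of_le (norm_add_le_of_le (norm_add_le_of_le
    (norm_add_le_of_le (norm_add_le_of_le (norm_add_le_of_le t1 t2) t3) t4) t5) t6) t7) t8) t9)
    t10) t11) t12).trans ?_
  have p1 : 0 ≤ M * ρ * C * (‖w‖ ^ 2 * ‖u‖ ^ 2) := by positivity
  have p2 : 0 ≤ M * ρ * C ^ 2 * (‖w‖ ^ 2 * ‖u‖ ^ 2) := by positivity
  have p3 : 0 ≤ M * ρ * C ^ 2 * (‖q‖ * ‖v‖ * ‖w‖ * ‖u‖) := by positivity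
  have p4 : 0 ≤ M * ρ * C * (‖v‖ ^ 2 * ‖w‖ ^ 2) := by positivity
  have p5 : 0 ≤ M * ρ * C ^ 2 * (‖u‖ * ‖v‖ * ‖w‖ ^ 2) := by positivity
  have p6 : 0 ≤ M * ρ * C ^ 2 * (‖u‖ * ‖b‖ * ‖w‖) := by positivity
  have p7 : 0 ≤ M * ρ * C * (‖q‖ ^ 2 * ‖v‖ ^ 2) := by positivity
  have p8 : 0 ≤ M * ρ * C ^ 2 * (‖q‖ ^ 2 * ‖v‖ ^ 2) := by positivity
  have p9 : 0 ≤ M * ρ * C ^ 2 * (‖q‖ * ‖w‖ * ‖v‖ ^ 2) := by positivity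
  have p10 : 0 ≤ M * ρ * C ^ 2 * (‖q‖ * ‖v‖ * ‖b‖) := by positivity
  have p11 : 0 ≤ M * ρ * C ^ 2 * (‖v‖ * ‖w‖ * ‖b‖) := by positivity
  have p12 : 0 ≤ M * ρ * C * ‖b‖ ^ 2 := by positivity
  have p13 : 0 ≤ M * ρ * C ^ 2 * ‖b‖ ^ 2 := by positivity
  linarith only [p1, p2, p3, p4, p5, p6, p7, p8, p9, p10, p11, p12, p13]

theorem sq_le_of_le_sum {C D x Q Y V W : ℝ} (hx : 0 ≤ x)
    (h : x ≤ 5 * (Q * Y) + C * (Q * V) + C * (W * Y) + D * (V * W)) :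
    x ^ 2 ≤ (100 + 4 * C ^ 2 + 4 * D ^ 2)
      * (Q ^ 2 * Y ^ 2 + Q ^ 2 * V ^ 2 + W ^ 2 * Y ^ 2 + V ^ 2 * W ^ 2) := by
  have four (x y z w : ℝ) : (x + y + z + w) ^ 2 ≤ 4 * (x ^ 2 + y ^ 2 + z ^ 2 + w ^ 2) := by
    linarith [sq_nonneg (x - y), sq_nonneg (x - z), sq_nonneg (x - w), sq_nonneg (y - z),
      sq_nonneg (y - w), sq_nonneg (z - w)]
  refine (pow_le_pow_left₀ hx h 2).trans ((four _ _ _ _).trans ?_)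
  simp only [mul_pow]
  have key {E A B P S T : ℝ} (hA : 0 ≤ A) (hB : 0 ≤ B) (hE : 0 ≤ E) (hP : 0 ≤ P) (hS : 0 ≤ S)
      (hT : 0 ≤ T) :
      4 * (5 ^ 2 * E + A * P + A * S + B * T) ≤ (100 + 4 * A + 4 * B) * (E + P + S + T) := by
    have a1 := mul_nonneg hA hE
    have a2 := mul_nonneg hA hT
    have a3 := mul_nonneg hB hE
    have a4 := mul_nonneg hB hP
    have a5 := mul_nonneg hB hS
    linarith
  exact key (by positivity) (by positivity) (by positivity) (by positivity) (by positivity)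
    (by positivity)

theorem sum_weights_le {A D₁ D₂ E ρ X₁ X₂ X₃ : ℝ} (hA : 0 ≤ A) (h₁ : 0 ≤ D₁) (h₂ : 0 ≤ D₂)
    (hE : 0 ≤ E) (hρ : 0 ≤ ρ) (x₁ : 0 ≤ X₁) (x₂ : 0 ≤ X₂) (x₃ : 0 ≤ X₃) :
    A * X₁ + D₁ * (ρ * (X₂ + X₃)) + D₂ * (ρ * X₃)
      ≤ (A + D₁ + D₂ + E) * (X₁ + ρ * (X₂ + X₃)) := by
  have s1 : 0 ≤ A * (ρ * (X₂ + X₃)) := by positivity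
  have s2 : 0 ≤ D₁ * X₁ := by positivity
  have s3 : 0 ≤ D₂ * X₁ := by positivity
  have s4 : 0 ≤ D₂ * (ρ * X₂) := by positivity
  have s5 : 0 ≤ E * (X₁ + ρ * (X₂ + X₃)) := by positivity
  linarith only [s1, s2, s3, s4, s5]

variable {n : ℕ} [NeZero n] {H : Cn n → ℝ} {U S : Set (Cn n)} {z : Cn n}

theorem exp_logN (hpos : ∀ z ∈ U, 0 < H z) (hz : z ∈ U ∩ offZero n) :
    Real.exp (logN H z) = ‖z 0‖ ^ 2 * H z :=
  Real.exp_log (mul_pos (pow_pos (norm_pos_iff.2 hz.2) 2) (hpos z hz.1))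

theorem exists_logN_le (hS : IsCompact S) (hSU : S ⊆ U) (hH : ContDiffOn ℝ ∞ H U)
    (hpos : ∀ z ∈ U, 0 < H z) : ∃ t₀ : ℝ, ∀ z ∈ S ∩ offZero n, logN H z ≤ t₀ := by
  obtain ⟨C, hC, h⟩ := exists_bound_of_smooth (f := fun z => ‖z 0‖ ^ 2 * H z) hS hSU
    (contDiff_normSq_coord.continuous.continuousOn.mul hH.continuousOn)
  refine ⟨Real.log (C + 1), fun z hz => ?_⟩
  have h1 : 0 < ‖z 0‖ ^ 2 * H z := mul_pos (pow_pos (norm_pos_iff.2 hz.2) 2) (hpos z (hSU hz.1))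
  exact Real.log_le_log h1 (((le_abs_self _).trans (h z hz.1)).trans (by linarith))

theorem exists_normSq_le_exp_logN (hS : IsCompact S) (hSU : S ⊆ U) (hH : ContDiffOn ℝ ∞ H U)
    (hpos : ∀ z ∈ U, 0 < H z) :
    ∃ C : ℝ, 0 ≤ C ∧ ∀ z ∈ S ∩ offZero n, ‖z 0‖ ^ 2 ≤ C * Real.exp (logN H z) := by
  obtain ⟨C, hC, h⟩ := exists_bound_of_smooth (f := fun z => (H z)⁻¹) hS hSU
    (hH.continuousOn.inv₀ fun z hz => (hpos z hz).ne')
  refine ⟨C, hC, fun z hz => ?_⟩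
  have h0 := hpos z (hSU hz.1)
  have h1 : (H z)⁻¹ ≤ C := (le_abs_self _).trans (h z hz.1)
  rw [exp_logN hpos ⟨hSU hz.1, hz.2⟩]
  calc ‖z 0‖ ^ 2 = (H z)⁻¹ * (‖z 0‖ ^ 2 * H z) := by field_simp
    _ ≤ _ := mul_le_mul_of_nonneg_right h1 (by positivity)

/-- Completing the square in κ. The remaining coefficient F₄ - F₃²/F₂ is F'' (log F'')'' for the
successive derivatives of F, hence negative when log F'' is strictly concave. -/
theorem leading_term_eq {F₂ F₃ F₄ : ℝ} (hF₂ : F₂ ≠ 0) (q u κ : ℂ) :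
    F₄ * (‖q‖ ^ 2 * ‖u‖ ^ 2) + 2 * F₃ * (q * u * conj κ).re + F₂ * ‖κ‖ ^ 2
      = F₂ * ‖κ + (F₃ / F₂ : ℝ) * (q * u)‖ ^ 2
        + (F₄ - F₃ ^ 2 / F₂) * (‖q‖ ^ 2 * ‖u‖ ^ 2) := by
  have h : ‖κ + (F₃ / F₂ : ℝ) * (q * u)‖ ^ 2 = ‖κ‖ ^ 2 + (F₃ / F₂) ^ 2 * (‖q‖ ^ 2 * ‖u‖ ^ 2)
      + 2 * ((F₃ / F₂) * (q * u * conj κ).re) := by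
    rw [add_comm, ← Complex.normSq_eq_norm_sq, Complex.normSq_add, Complex.normSq_mul,
      Complex.normSq_mul, Complex.normSq_ofReal, mul_assoc _ (q * u), Complex.re_ofReal_mul,
      Complex.normSq_eq_norm_sq, Complex.normSq_eq_norm_sq, Complex.normSq_eq_norm_sq]
    ring
  rw [h]
  field_simp
  ring

set_option maxHeartbeats 1000000 in
-- The vector b is chosen so that the square in `leading_term_eq` reduces to a bounded multiple of
-- |b|². The negative remainder coming from the second exponential then absorbs the only error too
-- large for the metric, of size |z₁|²|q|²|u|².
theorem discHessian_edge_le (hU : IsOpen U) (hS : IsCompact S) (hSU : S ⊆ U)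
    (hH : ContDiffOn ℝ ∞ H U) (hpos : ∀ z ∈ U, 0 < H z) {a c τ τ' : ℝ} (ha : 0 < a) (hc : 0 < c)
    (hτ : 0 < τ) (hττ' : τ < τ') (hτ' : τ' < 1) {g g₀ : Cn n → Matrix (Fin n) (Fin n) ℂ}
    (hg₀ : ∀ α β, ContDiffOn ℝ ∞ (fun y => g₀ y α β) U)
    (hg : ∀ y ∈ U ∩ offZero n, ∀ v w, sesq (g y) v w = sesq (g₀ y) v w
      + ((expDiff a c τ τ' 1 (logN H y) : ℂ) * levi (logN H) v w y
      + (expDiff a c τ τ' 2 (logN H y) : ℂ) * (del (logN H) v y * conj (del (logN H) w y))))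
    (hsmall : ∀ z ∈ S ∩ offZero n, c * τ' ^ 2 * Real.exp (τ' * logN H z)
      ≤ a * τ ^ 2 * Real.exp (τ * logN H z) / 2) :
    ∃ K : ℝ, 0 ≤ K ∧ ∀ z ∈ S ∩ offZero n, ∀ v w, ∃ b, discHessian g z v w b
      ≤ K * ((‖v‖ ^ 2 + Real.exp (τ * logN H z) * ‖del (logN H) v z‖ ^ 2)
        * (‖w‖ ^ 2 + Real.exp (τ * logN H z) * ‖del (logN H) w z‖ ^ 2)) := by
  have hL := contDiffOn_logH hH hpos
  have hW : IsOpen (U ∩ offZero n) := hU.inter isOpen_offZero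
  have hφ := contDiffOn_logN hH hpos
  obtain ⟨C₁, hC₁, B₁⟩ := exists_formBound hU hS hSU hg₀
  obtain ⟨C₂, hC₂, B₂⟩ := exists_levi_formBound hU hS hSU hL
  obtain ⟨C₃, hC₃, B₃⟩ := exists_del_bound hU hS hSU hL
  obtain ⟨C₄, hC₄, B₄⟩ := exists_dH_del_bound hU hS hSU hL
  obtain ⟨t₀, ht₀⟩ := exists_logN_le hS hSU hH hpos
  obtain ⟨C₅, hC₅, B₅⟩ := exists_normSq_le_exp_logN hS hSU hH hpos
  set R₁ := Real.exp ((τ' - τ) * t₀)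
  set M := a + c * R₁ with hM
  have hM0 : 0 ≤ M := by positivity
  set Cβ := 100 + 4 * C₃ ^ 2 + 4 * (C₃ ^ 2 + C₄) ^ 2 with hCβ
  set C := 2 * C₁ + 2 * M * (C₂ + C₂ ^ 2) + M * C₃ ^ 2 + Cβ with hCdef
  have hC : 0 ≤ C := by positivity
  -- The three summands bound, in this order, ρ, |z₁|² and |z₁|²/ρ.
  set R := Real.exp (τ * t₀) + C₅ * Real.exp t₀ + C₅ * Real.exp ((1 - τ) * t₀) with hR
  have hR0 : 0 ≤ R := by positivity
  -- Here p is the gain from `expDiff_concavity`, and C(3 + 5R)C · C₅ is the coefficient of the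
  -- error once |z₁|² has been replaced by C₅ e^φ.
  obtain ⟨K, hK, BK⟩ := exists_exp_absorb (p := (τ' - τ) ^ 2 * (c * τ' ^ 2)) (τ := τ) (τ' := τ')
    (by have := sub_pos.2 hττ'; have := hτ.trans hττ'; positivity) hτ hτ'
    (C * (3 + 5 * R) * C * C₅) t₀ (by positivity)
  refine ⟨C * (10 + 10 * R) + C * (3 + 5 * R) * C * (1 + R) * 3 + K, by positivity,
    fun z hz v w => ?_⟩
  have hzW : z ∈ U ∩ offZero n := ⟨hSU hz.1, hz.2⟩
  have hz0 : z 0 ≠ 0 := hz.2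
  set φ := logN H with hφdef
  set ρ := Real.exp (τ * φ z) with hρ
  set q := del φ w z with hq
  set u := del φ v z with hu
  set F := expDiff a c τ τ' with hF
  have hsm := hsmall z hz
  have hx0 : 0 < a * τ ^ 2 * Real.exp (τ * φ z) := by positivity
  have hy0 : 0 ≤ c * τ' ^ 2 * Real.exp (τ' * φ z) := by positivity
  have hRb : Real.exp (τ' * φ z) ≤ R₁ * Real.exp (τ * φ z) := exp_mul_le_exp_mul hττ'.le (ht₀ z hz)
  have hFk (k : ℕ) : |F k (φ z)| ≤ M * ρ :=
    abs_expDiff_le ha.le hc.le hτ.le (hττ'.trans hτ').le (hτ.trans hττ').le hτ'.le hRb k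
  have eF2 : F 2 (φ z) = a * τ ^ 2 * Real.exp (τ * φ z) - c * τ' ^ 2 * Real.exp (τ' * φ z) := rfl
  have eF3 : F 3 (φ z) = τ * (a * τ ^ 2 * Real.exp (τ * φ z))
      - τ' * (c * τ' ^ 2 * Real.exp (τ' * φ z)) := by simp only [hF, expDiff]; ring
  have hF2 : 0 < F 2 (φ z) := by rw [eF2]; linarith
  -- By `hsmall`, F'' is at least half of its first term, while |F'''| is at most that first term.
  -- The ratio is thus bounded uniformly up to the divisor.
  have hlam : |F 3 (φ z) / F 2 (φ z)| ≤ 4 := by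
    rw [abs_div, abs_of_pos hF2, div_le_iff₀ hF2, abs_le, eF2, eF3]
    have h1 : τ * (a * τ ^ 2 * Real.exp (τ * φ z)) ≤ 1 * (a * τ ^ 2 * Real.exp (τ * φ z)) :=
      mul_le_mul_of_nonneg_right (hττ'.trans hτ').le hx0.le
    have h2 : τ' * (c * τ' ^ 2 * Real.exp (τ' * φ z)) ≤ 1 * (c * τ' ^ 2 * Real.exp (τ' * φ z)) :=
      mul_le_mul_of_nonneg_right hτ'.le hy0
    have h3 : 0 ≤ τ * (a * τ ^ 2 * Real.exp (τ * φ z)) := mul_nonneg hτ.le hx0.le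
    have h4 : 0 ≤ τ' * (c * τ' ^ 2 * Real.exp (τ' * φ z)) := mul_nonneg (hτ.trans hττ').le hy0
    constructor <;> linarith
  set lam := F 3 (φ z) / F 2 (φ z) with hlamdef
  set B := dH w (del φ v) z with hB
  -- As ∂φ(z₁ ∂/∂z₁) is 1 plus a smooth term, adding ∂φ(b) to B + λqu cancels it up to ∂ log H(b).
  -- The factor z₁ in b makes the compensation cheap: |b| = |β||z₁|.
  set β := -(B + (lam : ℂ) * (q * u)) with hβ
  set b : Cn n := (β * z 0) • basisVec 0 with hb
  refine ⟨b, ?_⟩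
  have hdel (x : Cn n) : del φ x z = x 0 / z 0 + del (logH H) x z := del_logN hU hH hpos hzW x
  have hb0 : b 0 = β * z 0 := by simp [hb, basisVec]
  have hκ : B + del φ b z + (lam : ℂ) * (q * u) = del (logH H) b z := by
    rw [hdel b, hb0, mul_div_assoc, div_self hz0, hβ]; ring
  have hnb : ‖b‖ = ‖β‖ * ‖z 0‖ := by
    rw [hb, norm_smul, norm_mul]; simp [basisVec]
  -- the size of `b`
  have hq1 (x : Cn n) : ‖x 0 / z 0‖ ≤ ‖del φ x z‖ + C₃ * ‖x‖ := by
    have e : x 0 / z 0 = del φ x z - del (logH H) x z := by rw [hdel x]; ring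
    rw [e]
    exact (norm_sub_le _ _).trans (add_le_add le_rfl (B₃ z hz.1 x))
  have hBn : ‖B‖ ≤ (‖u‖ + C₃ * ‖v‖) * (‖q‖ + C₃ * ‖w‖) + C₄ * (‖v‖ * ‖w‖) := by
    rw [hB, dH_del_logN hU hH hpos hzW]
    refine norm_add_le_of_le ?_ (B₄ z hz.1 v w)
    rw [norm_mul, norm_neg]
    exact mul_le_mul (hq1 v) (hq1 w) (norm_nonneg _) (by positivity)
  -- The coefficient 5 is 1 from the singular part of B plus 4 from λ.
  have hβn : ‖β‖ ≤ 5 * (‖q‖ * ‖u‖) + C₃ * (‖q‖ * ‖v‖) + C₃ * (‖w‖ * ‖u‖)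
      + (C₃ ^ 2 + C₄) * (‖v‖ * ‖w‖) := by
    rw [hβ, norm_neg]
    have h1 : ‖(lam : ℂ) * (q * u)‖ ≤ 4 * (‖q‖ * ‖u‖) := by
      rw [norm_mul, norm_mul, Complex.norm_real, Real.norm_eq_abs]
      gcongr
    refine (norm_add_le_of_le hBn h1).trans (le_of_eq (by ring))
  have hβ2 : ‖β‖ ^ 2 ≤ Cβ * (‖q‖ ^ 2 * ‖u‖ ^ 2 + ‖q‖ ^ 2 * ‖v‖ ^ 2 + ‖w‖ ^ 2 * ‖u‖ ^ 2
      + ‖v‖ ^ 2 * ‖w‖ ^ 2) := by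
    exact sq_le_of_le_sum (norm_nonneg _) hβn
  -- the three groups of terms
  have g1 : discHessian g₀ z v w b
      ≤ 2 * C₁ * (‖v‖ ^ 2 * ‖w‖ ^ 2 + ‖w‖ * ‖v‖ * ‖b‖ + ‖b‖ ^ 2) := by
    have h := B₁ z hz.1
    have e1 := (Complex.re_le_norm _).trans (h.mixed w v v)
    have e2 := (Complex.re_le_norm _).trans (h.hol w v b)
    have e3 := (Complex.re_le_norm _).trans (h.val b b)
    rw [discHessian]
    have p1 : 0 ≤ C₁ * (‖v‖ ^ 2 * ‖w‖ ^ 2) := by positivity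
    have p2 : 0 ≤ C₁ * ‖b‖ ^ 2 := by positivity
    linarith only [e1, e2, e3, p1, p2]
  have g2 : F 4 (φ z) * (‖q‖ ^ 2 * ‖u‖ ^ 2) + 2 * F 3 (φ z) * (q * u * conj (B + del φ b z)).re
      + F 2 (φ z) * ‖B + del φ b z‖ ^ 2 ≤ M * C₃ ^ 2 * (ρ * ‖b‖ ^ 2)
        - (τ' - τ) ^ 2 * (c * τ' ^ 2 * Real.exp (τ' * φ z)) * (‖q‖ ^ 2 * ‖u‖ ^ 2) := by
    rw [leading_term_eq hF2.ne', hκ]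
    have h1 : F 2 (φ z) * ‖del (logH H) b z‖ ^ 2 ≤ (M * ρ) * (C₃ * ‖b‖) ^ 2 :=
      mul_le_mul ((le_abs_self _).trans (hFk 2)) (pow_le_pow_left₀ (norm_nonneg _) (B₃ z hz.1 b) 2)
        (by positivity) (by positivity)
    have h2 := mul_le_mul_of_nonneg_right (expDiff_concavity (a := a) (c := c) (τ := τ) (τ' := τ')
      (t := φ z) (by linarith)) (by positivity : 0 ≤ ‖q‖ ^ 2 * ‖u‖ ^ 2)
    linarith only [h1, h2]
  -- The Levi form of the singular potential is that of log H, so its bounds on the compact set S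
  -- apply.
  have hlb : FormBound (levi φ) C₂ z :=
    (B₂ z hz.1).congr hW hzW fun v w y hy => levi_logN hU hH hpos hy v w
  have g3 := (Complex.re_le_norm _).trans
    (norm_rest_le hC₂ hlb (hFk 1) (hFk 2) (hFk 3) v w b q u)
  rw [discHessian_potential hW hφ hzW (hasDerivAt_expDiff a c τ τ')
    (fun α β => (hg₀ α β).mono inter_subset_left) hg v w b hq hu rfl]
  have hφ0 := ht₀ z hz
  have hρR : ρ ≤ R := by
    have : ρ ≤ Real.exp (τ * t₀) := Real.exp_le_exp.2 (mul_le_mul_of_nonneg_left hφ0 hτ.le)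
    have h2 : 0 ≤ C₅ * Real.exp t₀ := by positivity
    have h3 : 0 ≤ C₅ * Real.exp ((1 - τ) * t₀) := by positivity
    linarith
  have ht5 := B₅ z hz
  have htR : ‖z 0‖ ^ 2 ≤ R := by
    have : C₅ * Real.exp (φ z) ≤ C₅ * Real.exp t₀ :=
      mul_le_mul_of_nonneg_left (Real.exp_le_exp.2 hφ0) hC₅
    have h2 : 0 ≤ Real.exp (τ * t₀) := by positivity
    have h3 : 0 ≤ C₅ * Real.exp ((1 - τ) * t₀) := by positivity
    linarith
  have htρ : ‖z 0‖ ^ 2 ≤ R * ρ := by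
    have h1 := exp_mul_le_exp_mul (τ := τ) (σ := 1) (hττ'.trans hτ').le hφ0
    rw [one_mul] at h1
    have h2 : C₅ * Real.exp (φ z) ≤ C₅ * (Real.exp ((1 - τ) * t₀) * ρ) :=
      mul_le_mul_of_nonneg_left h1 hC₅
    have h3 : C₅ * Real.exp ((1 - τ) * t₀) * ρ ≤ R * ρ := by
      refine mul_le_mul_of_nonneg_right ?_ (Real.exp_nonneg _)
      have h2 : 0 ≤ Real.exp (τ * t₀) := by positivity
      have h3 : 0 ≤ C₅ * Real.exp t₀ := by positivity
      linarith
    linarith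
  have hβb : ‖b‖ ^ 2 ≤ C * ‖z 0‖ ^ 2 * (‖q‖ ^ 2 * ‖u‖ ^ 2 + ‖q‖ ^ 2 * ‖v‖ ^ 2
      + ‖w‖ ^ 2 * ‖u‖ ^ 2 + ‖v‖ ^ 2 * ‖w‖ ^ 2) := by
    rw [hnb, mul_pow]
    calc ‖β‖ ^ 2 * ‖z 0‖ ^ 2 ≤ (Cβ * (‖q‖ ^ 2 * ‖u‖ ^ 2 + ‖q‖ ^ 2 * ‖v‖ ^ 2 + ‖w‖ ^ 2 * ‖u‖ ^ 2
          + ‖v‖ ^ 2 * ‖w‖ ^ 2)) * ‖z 0‖ ^ 2 := mul_le_mul_of_nonneg_right hβ2 (by positivity)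
      _ = Cβ * ‖z 0‖ ^ 2 * (‖q‖ ^ 2 * ‖u‖ ^ 2 + ‖q‖ ^ 2 * ‖v‖ ^ 2
          + ‖w‖ ^ 2 * ‖u‖ ^ 2 + ‖v‖ ^ 2 * ‖w‖ ^ 2) := by ring
      _ ≤ _ := by
        refine mul_le_mul_of_nonneg_right (mul_le_mul_of_nonneg_right ?_ (by positivity))
          (by positivity)
        have e1 : 0 ≤ 2 * M * (C₂ + C₂ ^ 2) := by positivity
        have e2 : 0 ≤ M * C₃ ^ 2 := by positivity
        linarith
  -- The hypothesis of the scalar estimate that encodes τ' < 1: |z₁|² ≤ C₅ e^φ is dominated by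
  -- e^{τ'φ} and ρ² = e^{2τφ} together.
  have hP : C * (3 + 5 * R) * C * ‖z 0‖ ^ 2
      ≤ (τ' - τ) ^ 2 * (c * τ' ^ 2 * Real.exp (τ' * φ z)) + K * ρ ^ 2 := by
    have h1 := BK (φ z) hφ0
    have h2 := mul_le_mul_of_nonneg_left ht5 (by positivity : 0 ≤ C * (3 + 5 * R) * C)
    linarith only [h1, h2]
  have main := edge_scalar_estimate (V := ‖v‖) (W := ‖w‖) (Y := ‖u‖) (Q := ‖q‖) (β := ‖b‖)
    (Real.exp_nonneg _) hC hR0 hK hρR htR htρ hβb hP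
  refine le_trans ?_ main
  have q0 : 0 ≤ ‖v‖ ^ 2 * ‖w‖ ^ 2 + ‖w‖ * ‖v‖ * ‖b‖ + ‖b‖ ^ 2 := by positivity
  have q1 : 0 ≤ ‖q‖ ^ 2 * ‖v‖ ^ 2 + ‖w‖ ^ 2 * ‖u‖ ^ 2 + ‖q‖ * ‖w‖ * ‖v‖ * ‖u‖
        + ‖v‖ ^ 2 * ‖w‖ ^ 2 + ‖u‖ * ‖v‖ * ‖w‖ ^ 2 + ‖u‖ * ‖b‖ * ‖w‖ + ‖q‖ * ‖w‖ * ‖v‖ ^ 2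
        + ‖q‖ * ‖v‖ * ‖b‖ + ‖v‖ * ‖w‖ * ‖b‖ := by positivity
  have q2 : 0 ≤ ‖b‖ ^ 2 := by positivity
  have hρ0 : 0 ≤ ρ := Real.exp_nonneg _
  generalize ‖v‖ ^ 2 * ‖w‖ ^ 2 + ‖w‖ * ‖v‖ * ‖b‖ + ‖b‖ ^ 2 = X₁ at g1 q0 ⊢
  generalize ‖q‖ ^ 2 * ‖v‖ ^ 2 + ‖w‖ ^ 2 * ‖u‖ ^ 2 + ‖q‖ * ‖w‖ * ‖v‖ * ‖u‖
        + ‖v‖ ^ 2 * ‖w‖ ^ 2 + ‖u‖ * ‖v‖ * ‖w‖ ^ 2 + ‖u‖ * ‖b‖ * ‖w‖ + ‖q‖ * ‖w‖ * ‖v‖ ^ 2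
        + ‖q‖ * ‖v‖ * ‖b‖ + ‖v‖ * ‖w‖ * ‖b‖ = X₂ at g3 q1 ⊢
  generalize ‖b‖ ^ 2 = X₃ at g2 g3 q2 ⊢
  have hCβ0 : 0 ≤ Cβ := by positivity
  have r1 : 2 * C₁ * X₁ + (2 * M * (C₂ + C₂ ^ 2)) * (ρ * (X₂ + X₃)) + M * C₃ ^ 2 * (ρ * X₃)
      ≤ C * (X₁ + ρ * (X₂ + X₃)) :=
    sum_weights_le (by positivity) (by positivity) (by positivity) hCβ0 hρ0 q0 q1 q2
  linarith only [r1, g1, g2, g3]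

end EdgeCurvature

/-! ### Division of a holomorphic function by a coordinate. -/

section Hadamard

open MeasureTheory Convolution

variable {n : ℕ} [NeZero n]

/-- The point obtained by multiplying the first coordinate by `t`. -/
def scaleFirst (p : Cn n) (t : ℝ) : Cn n := p - ((1 - t : ℝ) : ℂ) • (p 0 • basisVec 0)

theorem scaleFirst_one (p : Cn n) : scaleFirst p 1 = p := by simp [scaleFirst]

theorem scaleFirst_zero_apply (p : Cn n) : scaleFirst p 0 0 = 0 := by simp [scaleFirst, basisVec]

theorem contDiff_scaleFirst : ContDiff ℝ ∞ (fun q : Cn n × ℝ => scaleFirst q.1 q.2) := by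
  have h1 : ContDiff ℝ ∞ (fun q : Cn n × ℝ => (q.1 : Cn n) 0) :=
    (contDiff_coord 0).comp contDiff_fst
  have h2 : ContDiff ℝ ∞ (fun q : Cn n × ℝ => ((1 - q.2 : ℝ) : ℂ)) :=
    Complex.ofRealCLM.contDiff.comp (contDiff_const.sub contDiff_snd)
  exact contDiff_fst.sub (h2.smul (h1.smul contDiff_const))

theorem norm_scaleFirst_sub_le {p y : Cn n} (hy : y 0 = 0) {t : ℝ} (h0 : 0 ≤ t) (h1 : t ≤ 1) :
    ‖scaleFirst p t - y‖ ≤ ‖p - y‖ := by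
  rw [EuclideanSpace.norm_eq, EuclideanSpace.norm_eq]
  refine Real.sqrt_le_sqrt (Finset.sum_le_sum fun i _ => ?_)
  refine pow_le_pow_left₀ (norm_nonneg _) ?_ 2
  by_cases hi : i = 0
  · subst hi
    have e : (scaleFirst p t - y) 0 = (t : ℂ) * p 0 := by
      simp [scaleFirst, basisVec, hy]; ring
    rw [e, PiLp.sub_apply, hy, sub_zero, norm_mul, Complex.norm_real, Real.norm_of_nonneg h0]
    exact mul_le_of_le_one_left (norm_nonneg _) h1
  · simp [scaleFirst, basisVec, hi]

/-- Integrals over `[0, 1]` depend smoothly on parameters. -/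
theorem contDiff_parametric_integral {E : Type*} [NormedAddCommGroup E] [NormedSpace ℝ E]
    {g : E → ℝ → ℂ} (hg : ContDiff ℝ ∞ ↿g) :
    ContDiff ℝ ∞ fun p => ∫ t in (0 : ℝ)..1, g p t := by
  obtain ⟨χ, hχ, hχ0, hχ1⟩ : ∃ χ : ℝ → ℝ, ContDiff ℝ ∞ χ ∧ (∀ x, 3 ≤ |x| → χ x = 0) ∧
      ∀ x, |x| ≤ 2 → χ x = 1 := by
    let χ : ContDiffBump (0 : ℝ) := ⟨2, 3, by norm_num, by norm_num⟩
    exact ⟨χ, χ.contDiff, fun x hx => χ.zero_of_le_dist (by simpa using hx),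
      fun x hx => χ.one_of_mem_closedBall (by simpa using hx)⟩
  -- The integral is the value at 0 of the convolution in t of the indicator of [0, 1] with t ↦ g(p,
  -- -t). The cutoff χ provides compact support and equals 1 where the indicator sees it, so that
  -- smoothness of convolutions with parameters applies.
  obtain ⟨g', hg'e⟩ : ∃ g' : E → ℝ → ℂ, g' = fun p x => χ x • g p (-x) := ⟨_, rfl⟩
  obtain ⟨k, hke⟩ : ∃ k : ℝ → ℝ, k = (Icc (0 : ℝ) 1).indicator fun _ => 1 := ⟨_, rfl⟩
  have hg' : ContDiff ℝ ∞ ↿g' := by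
    have h1 : ContDiff ℝ ∞ (fun q : E × ℝ => χ q.2) := hχ.comp contDiff_snd
    have h2 : ContDiff ℝ ∞ (fun q : E × ℝ => ↿g (q.1, -q.2)) :=
      hg.comp (contDiff_fst.prodMk contDiff_snd.neg)
    rw [hg'e]
    exact h1.smul h2
  have hk : LocallyIntegrable k volume := by
    rw [hke]
    exact (integrable_indicator_iff measurableSet_Icc).2 (by simp) |>.locallyIntegrable
  have hsupp : ∀ p x, p ∈ (univ : Set E) → x ∉ Metric.closedBall (0 : ℝ) 3 → g' p x = 0 := by
    intro p x _ hx
    have : χ x = 0 := hχ0 x (by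
      simp only [mem_closedBall_zero_iff, Real.norm_eq_abs, not_le] at hx; exact hx.le)
    simp [hg'e, this]
  have hconv := contDiffOn_convolution_right_with_param (𝕜 := ℝ) (μ := volume) (n := ⊤)
    (ContinuousLinearMap.lsmul ℝ ℝ) (g := g') isOpen_univ (isCompact_closedBall (0 : ℝ) 3) hsupp hk
    hg'.contDiffOn
  rw [univ_prod_univ, contDiffOn_univ] at hconv
  have hι : ContDiff ℝ ∞ (fun p : E => (p, (0 : ℝ))) := contDiff_id.prodMk contDiff_const
  have hc : ContDiff ℝ ∞ (fun p => (k ⋆[ContinuousLinearMap.lsmul ℝ ℝ, volume] g' p) 0) :=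
    hconv.comp hι
  refine (congrArg (ContDiff ℝ ∞) (funext fun p => ?_)).mpr hc
  rw [intervalIntegral.integral_of_le zero_le_one, ← integral_Icc_eq_integral_Ioc,
    ← integral_indicator measurableSet_Icc]
  simp only [convolution, ContinuousLinearMap.lsmul_apply]
  congr 1
  ext t
  by_cases ht : t ∈ Icc (0 : ℝ) 1
  · have h1 : χ (-t) = 1 := hχ1 _ (by
      rw [abs_neg, abs_of_nonneg ht.1]; exact ht.2.trans (by norm_num))
    simp [hke, hg'e, ht, h1]
  · simp [hke, ht]

/-- Hadamard's lemma for a holomorphic function which vanishes on the hyperplane `z₁ = 0`. -/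
theorem exists_eq_coord_mul {f : Cn n → ℂ} {V : Set (Cn n)} (hV : IsOpen V)
    (hf : ContDiffOn ℂ ω f V) {y : Cn n} (hy : y ∈ V) (hy0 : y 0 = 0)
    (hzero : ∀ p ∈ V, p 0 = 0 → f p = 0) :
    ∃ u : Cn n → ℂ, ∃ B : Set (Cn n), IsOpen B ∧ y ∈ B ∧ B ⊆ V ∧ ContDiffOn ℝ ∞ u B ∧
      ∀ p ∈ B, f p = p 0 * u p := by
  obtain ⟨r, hr, hrV⟩ := Metric.isOpen_iff.1 hV y hy
  have : FiniteDimensional ℝ (Cn n) := FiniteDimensional.complexToReal (Cn n)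
  -- The cutoff makes the integrand smooth on the whole space. It equals 1 on the ball of radius
  -- r/4, which contains the segments used below.
  let ψ : ContDiffBump y := ⟨r / 4, r / 2, by positivity, by linarith⟩
  have hcd : ContDiffOn ℂ ω (fderiv ℂ f) V := hf.fderiv_of_isOpen hV (by simp)
  have hF : ContDiffOn ℝ ∞ (fun z => fderiv ℂ f z (basisVec 0)) V := by
    have h1 : ContDiffOn ℂ ω (fun z => fderiv ℂ f z (basisVec 0)) V :=
      hcd.clm_apply contDiffOn_const
    exact (h1.of_le (by simp)).restrict_scalars ℝ
  let F : Cn n → ℂ := fun z => ψ z • fderiv ℂ f z (basisVec 0)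
  have hFs : ContDiff ℝ ∞ F := by
    rw [contDiff_iff_contDiffAt]
    intro z
    by_cases hz : z ∈ Metric.ball y r
    · exact (ψ.contDiff.contDiffAt).smul (hF.contDiffAt (hV.mem_nhds (hrV hz)))
    · have : F =ᶠ[𝓝 z] fun _ => 0 := by
        have ho : IsOpen (Metric.closedBall y (r / 2))ᶜ := Metric.isClosed_closedBall.isOpen_compl
        have hzm : z ∈ (Metric.closedBall y (r / 2))ᶜ := by
          simp only [mem_compl_iff, Metric.mem_closedBall, not_le, Metric.mem_ball, not_lt] at hz ⊢
          linarith
        filter_upwards [ho.mem_nhds hzm] with w hw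
        have : ψ w = 0 := ψ.zero_of_le_dist (by
          simp only [mem_compl_iff, Metric.mem_closedBall, not_le] at hw
          exact hw.le)
        simp [F, this]
      exact contDiffAt_const.congr_of_eventuallyEq this
  have hg : ContDiff ℝ ∞ ↿(fun (p : Cn n) (t : ℝ) => F (scaleFirst p t)) :=
    hFs.comp contDiff_scaleFirst
  refine ⟨fun p => ∫ t in (0 : ℝ)..1, F (scaleFirst p t), Metric.ball y (r / 4),
    Metric.isOpen_ball, Metric.mem_ball_self (by positivity),
    (Metric.ball_subset_ball (by linarith)).trans hrV,
    (contDiff_parametric_integral hg).contDiffOn, ?_⟩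
  · intro p hp
    have hseg (t : ℝ) (ht : t ∈ Icc (0 : ℝ) 1) : scaleFirst p t ∈ Metric.ball y (r / 4) := by
      rw [mem_ball_iff_norm] at hp ⊢
      exact (norm_scaleFirst_sub_le hy0 ht.1 ht.2).trans_lt hp
    have hsegV (t : ℝ) (ht : t ∈ Icc (0 : ℝ) 1) : scaleFirst p t ∈ V :=
      hrV (Metric.ball_subset_ball (by linarith) (hseg t ht))
    have e1 : ∫ t in (0 : ℝ)..1, F (scaleFirst p t)
        = ∫ t in (0 : ℝ)..1, fderiv ℂ f (scaleFirst p t) (basisVec 0) := by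
      refine intervalIntegral.integral_congr fun t ht => ?_
      rw [uIcc_of_le zero_le_one] at ht
      have h2 : ψ (scaleFirst p t) = 1 :=
        ψ.one_of_mem_closedBall (Metric.ball_subset_closedBall (hseg t ht))
      simp [F, h2]
    -- The quotient is u(p) = ∫₀¹ ∂₁f(t p₁, p₂, …, p_n) dt, and p₁ u(p) is the integral of the
    -- derivative of f along the segment from the hyperplane to p. Real smoothness of u is enough,
    -- as only |u|² is used later.
    have hder (t : ℝ) (ht : t ∈ uIcc (0 : ℝ) 1) : HasDerivAt (fun t => f (scaleFirst p t))
        (p 0 * fderiv ℂ f (scaleFirst p t) (basisVec 0)) t := by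
      rw [uIcc_of_le zero_le_one] at ht
      have h1 : HasDerivAt (fun t : ℝ => scaleFirst p t) (p 0 • basisVec 0) t := by
        have h2 : HasDerivAt (fun t : ℝ => ((1 - t : ℝ) : ℂ)) (((-1 : ℝ)) : ℂ) t :=
          ((hasDerivAt_id t).const_sub 1).ofReal_comp
        have h3 := (h2.smul_const (p 0 • (basisVec 0 : Cn n))).const_sub p
        simpa [scaleFirst] using h3
      have h4 : HasFDerivAt f (fderiv ℂ f (scaleFirst p t)) (scaleFirst p t) :=
        ((hf.contDiffAt (hV.mem_nhds (hsegV t ht))).differentiableAt (by simp)).hasFDerivAt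
      have h5 : HasDerivAt (fun t => f (scaleFirst p t)) _ t :=
        (h4.restrictScalars ℝ).comp_hasDerivAt t h1
      exact h5.congr_deriv (by simp)
    have hint : IntervalIntegrable (fun t => p 0 * fderiv ℂ f (scaleFirst p t) (basisVec 0))
        volume 0 1 := by
      refine ContinuousOn.intervalIntegrable ?_
      rw [uIcc_of_le zero_le_one]
      refine continuousOn_const.mul (hF.continuousOn.comp ?_ fun t ht => hsegV t ht)
      exact (contDiff_scaleFirst.continuous.comp (Continuous.prodMk_right p)).continuousOn
    have e2 := intervalIntegral.integral_eq_sub_of_hasDerivAt hder hint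
    have e3 : f (scaleFirst p 0) = 0 :=
      hzero _ (hsegV 0 ⟨le_rfl, zero_le_one⟩) (scaleFirst_zero_apply p)
    rw [scaleFirst_one, e3, sub_zero, intervalIntegral.integral_const_mul] at e2
    simp only
    rw [e1, e2]

end Hadamard

/-! ### Transition maps, coefficients of forms, and dd^c in arbitrary holomorphic charts. -/

section ChartCalculus

variable {n : ℕ} {M : Type*} [TopologicalSpace M] {e e' : OpenPartialHomeomorph M (Cn n)}
  {y : Cn n}

/-- The domain of the transition map between two charts. -/
def overlap (e e' : OpenPartialHomeomorph M (Cn n)) : Set (Cn n) := e.target ∩ e.symm ⁻¹' e'.source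

/-- The transition map between two charts. -/
def trans (e e' : OpenPartialHomeomorph M (Cn n)) (y : Cn n) : Cn n := e' (e.symm y)

theorem isOpen_overlap : IsOpen (overlap e e') := e.isOpen_inter_preimage_symm e'.open_source

theorem trans_mem (hy : y ∈ overlap e e') : trans e e' y ∈ overlap e' e := by
  refine ⟨e'.map_source hy.2, ?_⟩
  change e'.symm (e' (e.symm y)) ∈ e.source
  rw [e'.left_inv hy.2]
  exact e.map_target hy.1

theorem symm_trans (hy : y ∈ overlap e e') : e'.symm (trans e e' y) = e.symm y :=
  e'.left_inv hy.2

theorem trans_trans (hy : y ∈ overlap e e') : trans e' e (trans e e' y) = y := by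
  rw [trans, symm_trans hy, e.right_inv hy.1]

theorem isOpen_chart_inter (e : OpenPartialHomeomorph M (Cn n)) {X : Set M} (hX : IsOpen X) :
    IsOpen (e.target ∩ e.symm ⁻¹' X) := e.isOpen_inter_preimage_symm hX

theorem fderiv_trans_self (hy : y ∈ e.target) (v : Cn n) : fderiv ℂ (trans e e) y v = v := by
  have h1 : trans e e =ᶠ[𝓝 y] fun z => z := by
    filter_upwards [e.open_target.mem_nhds hy] with z hz using e.right_inv hz
  rw [h1.fderiv_eq]; simp

theorem levi_comp_holo {f : Cn n → ℝ} {Φ : Cn n → Cn n} {W W' : Set (Cn n)} (hW : IsOpen W)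
    (hW' : IsOpen W') (hΦ : ContDiffOn ℂ ω Φ W) (hm : MapsTo Φ W W') (hf : ContDiffOn ℝ ∞ f W')
    (hy : y ∈ W) (v w : Cn n) :
    levi (fun z => f (Φ z)) v w y = levi f (fderiv ℂ Φ y v) (fderiv ℂ Φ y w) (Φ y) := by
  have hc : ContDiffOn ℝ ∞ (fun z => f (Φ z)) W :=
    hf.comp ((hΦ.of_le (by simp)).restrict_scalars ℝ) hm
  rw [levi_eq hW hc hy, levi_eq hW' hf (hm hy)]
  exact dH_dB_comp_holo hW hW' hΦ hm (contDiffOn_ofReal hf) hy v w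

variable [ChartedSpace (Cn n) M]

theorem contDiffOn_trans (he : e ∈ holoCharts n M) (he' : e' ∈ holoCharts n M) :
    ContDiffOn ℂ ω (trans e e') (overlap e e') := by
  rw [← contMDiffOn_iff_contDiffOn]
  exact (contMDiffOn_of_mem_maximalAtlas he').comp
    ((contMDiffOn_symm_of_mem_maximalAtlas he).mono inter_subset_left) fun y hy => hy.2

theorem differentiableAt_trans (he : e ∈ holoCharts n M) (he' : e' ∈ holoCharts n M)
    (hy : y ∈ overlap e e') : DifferentiableAt ℂ (trans e e') y :=
  ((contDiffOn_trans he he').contDiffAt (isOpen_overlap.mem_nhds hy)).differentiableAt (by simp)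

theorem fderiv_trans_comp {e'' : OpenPartialHomeomorph M (Cn n)} (he : e ∈ holoCharts n M)
    (he' : e' ∈ holoCharts n M) (he'' : e'' ∈ holoCharts n M) (hy : y ∈ overlap e e')
    (hy' : y ∈ overlap e e'') (v : Cn n) :
    fderiv ℂ (trans e e'') y v
      = fderiv ℂ (trans e' e'') (trans e e' y) (fderiv ℂ (trans e e') y v) := by
  have hm : trans e e' y ∈ overlap e' e'' := by
    refine ⟨(trans_mem hy).1, ?_⟩
    change e'.symm (trans e e' y) ∈ e''.source
    rw [symm_trans hy]; exact hy'.2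
  have h1 : trans e e'' =ᶠ[𝓝 y] fun z => trans e' e'' (trans e e' z) := by
    filter_upwards [isOpen_overlap.mem_nhds hy] with z hz
    simp only [trans]
    rw [e'.left_inv hz.2]
  rw [h1.fderiv_eq]
  have h2 := (differentiableAt_trans he' he'' hm).hasFDerivAt.comp y
    (differentiableAt_trans he he' hy).hasFDerivAt
  have h3 : fderiv ℂ (fun z => trans e' e'' (trans e e' z)) y = _ := h2.fderiv
  rw [h3]; rfl

theorem fderiv_trans_inverse (he : e ∈ holoCharts n M) (he' : e' ∈ holoCharts n M)
    (hy : y ∈ overlap e e') (v : Cn n) :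
    fderiv ℂ (trans e' e) (trans e e' y) (fderiv ℂ (trans e e') y v) = v := by
  have hy' : y ∈ overlap e e := ⟨hy.1, e.map_target hy.1⟩
  rw [← fderiv_trans_comp he he' he hy hy', fderiv_trans_self hy.1]

theorem fderiv_trans_surjective (he : e ∈ holoCharts n M) (he' : e' ∈ holoCharts n M)
    (hy : y ∈ overlap e e') : Function.Surjective (fderiv ℂ (trans e e') y) := by
  intro v
  refine ⟨fderiv ℂ (trans e' e) (trans e e' y) v, ?_⟩
  have := fderiv_trans_inverse he' he (trans_mem hy) v
  rwa [trans_trans hy] at this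

theorem fderiv_trans_ne_zero (he : e ∈ holoCharts n M) (he' : e' ∈ holoCharts n M)
    (hy : y ∈ overlap e e') {v : Cn n} (hv : v ≠ 0) : fderiv ℂ (trans e e') y v ≠ 0 := by
  intro h
  apply hv
  rw [← fderiv_trans_inverse he he' hy v, h, map_zero]

/-- The derivative of the inverse of a chart, in the preferred chart at the image point. -/
def jac (e : OpenPartialHomeomorph M (Cn n)) (y : Cn n) : Cn n →L[ℂ] Cn n :=
  fderiv ℂ (trans e (chartAt (Cn n) (e.symm y))) y

/-- The value of a form field on two vectors of `ℂⁿ`. -/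
def formVal (g : FormField n M) (x : M) (v w : Cn n) : ℂ := g x v w

theorem mem_overlap_chartAt (hy : y ∈ e.target) :
    y ∈ overlap e (chartAt (Cn n) (e.symm y)) := ⟨hy, mem_chart_source _ _⟩

theorem sesq_coeff_eq (g : FormField n M) (e : OpenPartialHomeomorph M (Cn n)) (y v w : Cn n) :
    sesq (coeff g e y) v w
      = g (e.symm y) (mfderiv 𝓘(ℂ, Cn n) 𝓘(ℂ, Cn n) e.symm y v)
        (mfderiv 𝓘(ℂ, Cn n) 𝓘(ℂ, Cn n) e.symm y w) := by
  let B : Cn n →ₗ[ℂ] Cn n →ₗ⋆[ℂ] ℂ := LinearMap.mk₂'ₛₗ (RingHom.id ℂ) (starRingEnd ℂ)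
    (fun v w => g (e.symm y) (mfderiv 𝓘(ℂ, Cn n) 𝓘(ℂ, Cn n) e.symm y v)
        (mfderiv 𝓘(ℂ, Cn n) 𝓘(ℂ, Cn n) e.symm y w))
    (fun v v' w => by
      have h := (mfderiv 𝓘(ℂ, Cn n) 𝓘(ℂ, Cn n) e.symm y).map_add v v'
      erw [h, map_add]; rfl)
    (fun c v w => by
      have h := (mfderiv 𝓘(ℂ, Cn n) 𝓘(ℂ, Cn n) e.symm y).map_smul c v
      erw [h, map_smul]; rfl)
    (fun v w w' => by
      have h := (mfderiv 𝓘(ℂ, Cn n) 𝓘(ℂ, Cn n) e.symm y).map_add w w'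
      erw [h, map_add])
    (fun c v w => by
      have h := (mfderiv 𝓘(ℂ, Cn n) 𝓘(ℂ, Cn n) e.symm y).map_smul c w
      erw [h, LinearMap.map_smulₛₗ])
  exact sesq_of_form B v w

/-- The tangent space at a point is identified with ℂⁿ by the preferred chart there, so the manifold
derivative of the inverse of a chart is the ordinary derivative of a transition map. -/
theorem mfderiv_symm_eq (he : e ∈ holoCharts n M) (hy : y ∈ e.target) (v : Cn n) :
    (mfderiv 𝓘(ℂ, Cn n) 𝓘(ℂ, Cn n) e.symm y v : Cn n) = jac e y v := by
  have hd : MDifferentiableAt 𝓘(ℂ, Cn n) 𝓘(ℂ, Cn n) e.symm y :=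
    (contMDiffAt_symm_of_mem_maximalAtlas he hy).mdifferentiableAt (by simp)
  have h := hd.hasMFDerivAt.2
  have key (L : Cn n →L[ℂ] Cn n) (hL : HasFDerivWithinAt
      (writtenInExtChartAt 𝓘(ℂ, Cn n) 𝓘(ℂ, Cn n) y e.symm) L (range 𝓘(ℂ, Cn n))
      (extChartAt 𝓘(ℂ, Cn n) y y)) : L v = jac e y v := by
    have h1 : HasFDerivAt (trans e (chartAt (Cn n) (e.symm y))) L y := by
      simp only [range_id, hasFDerivWithinAt_univ, writtenInExtChartAt, chartAt_self_eq,
        mfld_simps] at hL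
      exact hL
    rw [jac, h1.fderiv]
  exact key _ h

theorem sesq_coeff (g : FormField n M) (he : e ∈ holoCharts n M) (hy : y ∈ e.target) (v w : Cn n) :
    sesq (coeff g e y) v w = formVal g (e.symm y) (jac e y v) (jac e y w) := by
  rw [sesq_coeff_eq, formVal, ← mfderiv_symm_eq he hy, ← mfderiv_symm_eq he hy]

variable [IsManifold 𝓘(ℂ, Cn n) ω M]

theorem chartAt_mem_holoCharts (x : M) : chartAt (Cn n) x ∈ holoCharts n M :=
  IsManifold.chart_mem_maximalAtlas x

theorem jac_eq_jac_trans (he : e ∈ holoCharts n M) (he' : e' ∈ holoCharts n M)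
    (hy : y ∈ overlap e e') (v : Cn n) :
    jac e y v = jac e' (trans e e' y) (fderiv ℂ (trans e e') y v) := by
  rw [jac, jac, symm_trans hy]
  exact fderiv_trans_comp he he' (chartAt_mem_holoCharts _) hy (mem_overlap_chartAt hy.1) v

/-- The change of charts formula for the coefficients of a form. -/
theorem sesq_coeff_trans (g : FormField n M) (he : e ∈ holoCharts n M) (he' : e' ∈ holoCharts n M)
    (hy : y ∈ overlap e e') (v w : Cn n) :
    sesq (coeff g e y) v w = sesq (coeff g e' (trans e e' y)) (fderiv ℂ (trans e e') y v)
      (fderiv ℂ (trans e e') y w) := by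
  rw [sesq_coeff g he hy.1, sesq_coeff g he' (trans_mem hy).1, symm_trans hy,
    jac_eq_jac_trans he he' hy v, jac_eq_jac_trans he he' hy w]

theorem jac_surjective (he : e ∈ holoCharts n M) (hy : y ∈ e.target) :
    Function.Surjective (jac e y) :=
  fderiv_trans_surjective he (chartAt_mem_holoCharts _) (mem_overlap_chartAt hy)

theorem jac_ne_zero (he : e ∈ holoCharts n M) (hy : y ∈ e.target) {v : Cn n} (hv : v ≠ 0) :
    jac e y v ≠ 0 :=
  fderiv_trans_ne_zero he (chartAt_mem_holoCharts _) (mem_overlap_chartAt hy) hv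

/-! ### Smooth functions in charts -/

/-- Smoothness of a real function on an open set, tested in all holomorphic charts. -/
def SmoothOnCharts (n : ℕ) {M : Type*} [TopologicalSpace M] [ChartedSpace (Cn n) M] (f : M → ℝ)
    (X : Set M) : Prop :=
  ∀ e ∈ holoCharts n M, ContDiffOn ℝ ∞ (fun y => f (e.symm y)) (e.target ∩ e.symm ⁻¹' X)

/-- The coefficients of `dd^c f` in a holomorphic chart. -/
theorem sesq_coeff_ddc {f : M → ℝ} {X : Set M} (hX : IsOpen X) (hf : SmoothOnCharts n f X)
    (he : e ∈ holoCharts n M) (hy : y ∈ e.target) (hyX : e.symm y ∈ X) (v w : Cn n) :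
    sesq (coeff (ddc f) e y) v w = levi (fun y => f (e.symm y)) v w y := by
  rw [sesq_coeff _ he hy]
  set c := chartAt (Cn n) (e.symm y) with hc
  have hcm : c ∈ holoCharts n M := chartAt_mem_holoCharts _
  have hyo : y ∈ overlap e c := mem_overlap_chartAt hy
  have hW : IsOpen (overlap e c ∩ (e.target ∩ e.symm ⁻¹' X)) :=
    isOpen_overlap.inter (isOpen_chart_inter e hX)
  have hm : MapsTo (trans e c) (overlap e c ∩ (e.target ∩ e.symm ⁻¹' X))
      (c.target ∩ c.symm ⁻¹' X) := by
    intro z hz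
    refine ⟨(trans_mem hz.1).1, ?_⟩
    change c.symm (trans e c z) ∈ X
    rw [symm_trans hz.1]; exact hz.2.2
  have hyW : y ∈ overlap e c ∩ (e.target ∩ e.symm ⁻¹' X) := ⟨hyo, hy, hyX⟩
  -- The form dd^c f is defined by the preferred chart at each point. The Levi form transforms
  -- tensorially under the holomorphic transition map, so any holomorphic chart gives the same form.
  have h1 := levi_comp_holo (f := fun z => f (c.symm z)) hW (isOpen_chart_inter c hX)
    ((contDiffOn_trans he hcm).mono inter_subset_left) hm (hf c hcm) hyW v w
  have h2 : levi (fun y => f (e.symm y)) v w y = levi (fun z => f (c.symm (trans e c z))) v w y := by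
    refine dB_congr_on hW (fun z hz => dH_congr_on hW (fun z' hz' => ?_) hz v) hyW w
    simp only
    rw [symm_trans hz'.1]
  rw [h2, h1, formVal, ddc]
  exact sesq_complexHessian_eq_levi (isOpen_chart_inter c hX) (hf c hcm) (hm hyW) _ _

theorem coeff_ddc {f : M → ℝ} {X : Set M} (hX : IsOpen X) (hf : SmoothOnCharts n f X)
    (he : e ∈ holoCharts n M) (hy : y ∈ e.target) (hyX : e.symm y ∈ X) (α β : Fin n) :
    coeff (ddc f) e y α β = levi (fun y => f (e.symm y)) (basisVec α) (basisVec β) y := by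
  rw [← sesq_coeff_ddc hX hf he hy hyX, sesq_basisVec]

end ChartCalculus

/-! ### The norm of a section, locally -/

section LocalNorm

variable {n : ℕ} {M : Type*} [TopologicalSpace M] [ChartedSpace (Cn n) M]

/-- A nonnegative function which, locally, is `‖f‖² k` with `k` smooth and positive and `f` a
holomorphic equation of `D` with nonvanishing differential. -/
def IsDivisorNorm (n : ℕ) {M : Type*} [TopologicalSpace M] [ChartedSpace (Cn n) M] (D : Set M)
    (N : M → ℝ) : Prop :=
  ∀ x₀ : M, ∃ (O : Set M) (f : M → ℂ) (k : M → ℝ), IsOpen O ∧ x₀ ∈ O ∧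
    (∀ e ∈ holoCharts n M, ContDiffOn ℂ ω (fun y => f (e.symm y)) (e.target ∩ e.symm ⁻¹' O)) ∧
    SmoothOnCharts n k O ∧ (∀ x ∈ O, 0 < k x ∧ N x = ‖f x‖ ^ 2 * k x ∧ (x ∈ D ↔ f x = 0)) ∧
    (x₀ ∈ D → ∀ e ∈ holoCharts n M, x₀ ∈ e.source →
      fderiv ℂ (fun y => f (e.symm y)) (e x₀) ≠ 0)

theorem contDiffOn_of_contMDiffOn {f : M → ℂ} {O : Set M}
    (hf : ContMDiffOn 𝓘(ℂ, Cn n) 𝓘(ℂ, ℂ) ω f O) {e : OpenPartialHomeomorph M (Cn n)}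
    (he : e ∈ holoCharts n M) :
    ContDiffOn ℂ ω (fun y => f (e.symm y)) (e.target ∩ e.symm ⁻¹' O) := by
  rw [← contMDiffOn_iff_contDiffOn]
  exact hf.comp ((contMDiffOn_symm_of_mem_maximalAtlas he).mono inter_subset_left)
    fun y hy => hy.2

theorem mfderiv_eq_zero_of_chart {f : M → ℂ} {x : M} (hf : ContMDiffAt 𝓘(ℂ, Cn n) 𝓘(ℂ, ℂ) ω f x)
    {e : OpenPartialHomeomorph M (Cn n)} (he : e ∈ holoCharts n M) (hx : x ∈ e.source)
    (h : fderiv ℂ (fun y => f (e.symm y)) (e x) = 0) : mfderiv 𝓘(ℂ, Cn n) 𝓘(ℂ, ℂ) f x = 0 := by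
  have hd : MDifferentiableAt 𝓘(ℂ, Cn n) 𝓘(ℂ, Cn n) e x :=
    (contMDiffAt_of_mem_maximalAtlas he hx).mdifferentiableAt (by simp)
  have hs : ContMDiffAt 𝓘(ℂ, Cn n) 𝓘(ℂ, Cn n) ω e.symm (e x) :=
    contMDiffAt_symm_of_mem_maximalAtlas he (e.map_source hx)
  have hf' : ContMDiffAt 𝓘(ℂ, Cn n) 𝓘(ℂ, ℂ) ω f (e.symm (e x)) := by rwa [e.left_inv hx]
  have hg : MDifferentiableAt 𝓘(ℂ, Cn n) 𝓘(ℂ, ℂ) (fun y => f (e.symm y)) (e x) :=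
    (hf'.comp (e x) hs).mdifferentiableAt (by simp)
  have h1 : f =ᶠ[𝓝 x] (fun y => f (e.symm y)) ∘ e := by
    filter_upwards [e.open_source.mem_nhds hx] with z hz
    simp [e.left_inv hz]
  rw [h1.mfderiv_eq, mfderiv_comp x hg hd, mfderiv_eq_fderiv, h]
  exact ContinuousLinearMap.zero_comp _

variable [IsManifold 𝓘(ℂ, Cn n) ω M]

/-- Real smoothness is expressed in preferred charts; composing with transition maps, holomorphic
and therefore real smooth, gives all holomorphic charts. -/
theorem smoothOnCharts_of_contMDiffOn {k : M → ℂ} {O : Set M} (hO : IsOpen O)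
    (hk : ContMDiffOn 𝓘(ℝ, Cn n) 𝓘(ℝ, ℂ) ∞ k O) : SmoothOnCharts n (fun x => (k x).re) O := by
  intro e he y hy
  refine ContDiffAt.contDiffWithinAt ?_
  have h1 : ContMDiffAt 𝓘(ℝ, Cn n) 𝓘(ℝ, ℂ) ∞ k (e.symm y) := hk.contMDiffAt (hO.mem_nhds hy.2)
  have h2 := (contMDiffAt_iff.1 h1).2
  simp only [range_id, contDiffWithinAt_univ, chartAt_self_eq, mfld_simps] at h2
  have h3 : ContDiffAt ℝ ∞ (trans e (chartAt (Cn n) (e.symm y))) y :=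
    (((contDiffOn_trans he (chartAt_mem_holoCharts _)).contDiffAt
      (isOpen_overlap.mem_nhds (mem_overlap_chartAt hy.1))).of_le (by simp)).restrict_scalars ℝ
  have h4 := ContDiffAt.comp (g := k ∘ (chartAt (Cn n) (e.symm y)).symm) y h2 h3
  have h5 : (fun z => (k (e.symm z)).re) =ᶠ[𝓝 y] fun z =>
      Complex.reCLM ((k ∘ (chartAt (Cn n) (e.symm y)).symm)
        (trans e (chartAt (Cn n) (e.symm y)) z)) := by
    filter_upwards [isOpen_overlap.mem_nhds (mem_overlap_chartAt hy.1)] with z hz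
    simp only [Function.comp_apply, Complex.reCLM_apply]
    rw [symm_trans hz]
  exact (Complex.reCLM.contDiff.contDiffAt.comp y h4).congr_of_eventuallyEq h5

variable {L : M → Type*} [TopologicalSpace (Bundle.TotalSpace ℂ L)] [∀ x, AddCommGroup (L x)]
    [∀ x, Module ℂ (L x)] [∀ x, TopologicalSpace (L x)] [FiberBundle ℂ L] [VectorBundle ℂ ℂ L]
    [ContMDiffVectorBundle ω ℂ L 𝓘(ℂ, Cn n)]

/-- In a local trivialisation s is f times the frame, so |s|² is |f|² times the squared length of
the frame. From here on the line bundle enters only through the function N = |s|². -/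
theorem isDivisorNorm (h : HermitianMetric n L) {s : ∀ x, L x} (hs : IsHolomorphicSection n s)
    {D : Set M} (hD : VanishesSimplyAlong n s D) :
    IsDivisorNorm n D (fun x => (h.form x (s x) (s x)).re) := by
  intro x₀
  set t := trivializationAt ℂ L x₀ with ht
  set f : M → ℂ := fun y => (t (⟨y, s y⟩ : Bundle.TotalSpace ℂ L)).2 with hf
  have hfm : ContMDiffOn 𝓘(ℂ, Cn n) 𝓘(ℂ, ℂ) ω f t.baseSet :=
    (t.contMDiffOn_section_baseSet_iff).1 hs.contMDiffOn
  have hsf : ∀ x ∈ t.baseSet, s x = f x • t.symm x 1 := by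
    intro x hx
    have h1 : t.symmₗ ℂ x (t.linearMapAt ℂ x (s x)) = s x := t.symmₗ_linearMapAt hx (s x)
    have h2 : t.linearMapAt ℂ x (s x) = f x := by
      rw [Bundle.Trivialization.coe_linearMapAt_of_mem t hx]
    rw [h2, ← mul_one (f x), ← smul_eq_mul, map_smul] at h1
    rw [← h1]
    congr 1
    exact t.symmₗ_apply hx 1
  have hone : ∀ x ∈ t.baseSet, t.symm x (1 : ℂ) ≠ 0 := by
    intro x hx h0
    have h1 : t.linearMapAt ℂ x (t.symm x 1) = 1 := by
      have := t.linearMapAt_symmₗ (R := ℂ) hx 1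
      rwa [t.symmₗ_apply hx] at this
    rw [h0, map_zero] at h1
    exact zero_ne_one h1
  refine ⟨t.baseSet, f, fun x => (h.form x (t.symm x 1) (t.symm x 1)).re, t.open_baseSet,
    FiberBundle.mem_baseSet_trivializationAt' x₀, fun e he => contDiffOn_of_contMDiffOn hfm he,
    smoothOnCharts_of_contMDiffOn t.open_baseSet (h.smooth x₀), fun x hx => ⟨?_, ?_, ?_⟩, ?_⟩
  · exact h.pos x _ (hone x hx)
  · simp only
    rw [hsf x hx, (h.form x).map_smulₛₗ, LinearMap.smul_apply,
      (h.form x (t.symm x 1)).map_smulₛₗ, RingHom.id_apply, smul_eq_mul, smul_eq_mul,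
      ← mul_assoc, Complex.mul_conj, Complex.normSq_eq_norm_sq, Complex.re_ofReal_mul]
  · rw [hD.1, mem_ofPred_eq, hsf x hx, smul_eq_zero]
    simp [hone x hx]
  · intro hx e he hxe h0
    refine hD.2 x₀ hx (mfderiv_eq_zero_of_chart (hfm.contMDiffAt
      (t.open_baseSet.mem_nhds (FiberBundle.mem_baseSet_trivializationAt' x₀))) he hxe h0)

end LocalNorm

/-! ### Consequences -/

section DivisorNorm

variable {n : ℕ} {M : Type*} [TopologicalSpace M] [ChartedSpace (Cn n) M] {D : Set M} {N : M → ℝ}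

theorem IsDivisorNorm.pos (hN : IsDivisorNorm n D N) {x : M} (hx : x ∉ D) : 0 < N x := by
  obtain ⟨O, f, k, -, hxO, -, -, h, -⟩ := hN x
  obtain ⟨h1, h2, h3⟩ := h x hxO
  have : f x ≠ 0 := fun h0 => hx (h3.2 h0)
  rw [h2]; positivity

theorem IsDivisorNorm.eq_zero (hN : IsDivisorNorm n D N) {x : M} (hx : x ∈ D) : N x = 0 := by
  obtain ⟨O, f, k, -, hxO, -, -, h, -⟩ := hN x
  obtain ⟨h1, h2, h3⟩ := h x hxO
  rw [h2, h3.1 hx]; simp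

theorem IsDivisorNorm.smooth (hN : IsDivisorNorm n D N) : SmoothOnCharts n N univ := by
  intro e he y hy
  obtain ⟨O, f, k, hO, hxO, hf, hk, h, -⟩ := hN (e.symm y)
  have hW := isOpen_chart_inter e hO
  have h1 : ContDiffOn ℝ ∞ (fun z => ‖f (e.symm z)‖ ^ 2 * k (e.symm z)) (e.target ∩ e.symm ⁻¹' O) :=
    ((((hf e he).of_le (by simp)).restrict_scalars ℝ).norm_sq ℝ).mul (hk e he)
  refine ((h1.congr fun z hz => (h _ hz.2).2.1).contDiffAt (hW.mem_nhds ⟨hy.1, hxO⟩)).contDiffWithinAt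

theorem SmoothOnCharts.mono {f : M → ℝ} {X Y : Set M} (hf : SmoothOnCharts n f X) (h : Y ⊆ X) :
    SmoothOnCharts n f Y := fun e he =>
  (hf e he).mono (inter_subset_inter_right _ (preimage_mono h))

theorem IsDivisorNorm.smooth_log (hN : IsDivisorNorm n D N) :
    SmoothOnCharts n (fun x => Real.log (N x)) Dᶜ := fun e he =>
  ((hN.smooth.mono (subset_univ _)) e he).log fun _ hy => (hN.pos hy.2).ne'

variable [IsManifold 𝓘(ℂ, Cn n) ω M]

theorem SmoothOnCharts.continuous {f : M → ℝ} (hf : SmoothOnCharts n f univ) : Continuous f := by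
  rw [continuous_iff_continuousAt]
  intro x
  have h1 : ContinuousAt (fun y => f ((chartAt (Cn n) x).symm y)) (chartAt (Cn n) x x) := by
    refine ((hf _ (chartAt_mem_holoCharts x)).continuousOn).continuousAt ?_
    simpa using (chartAt (Cn n) x).open_target.mem_nhds (mem_chart_target _ _)
  have h2 := ContinuousAt.comp (f := chartAt (Cn n) x) h1
    ((chartAt (Cn n) x).continuousAt (mem_chart_source _ x))
  refine h2.congr ?_
  filter_upwards [(chartAt (Cn n) x).open_source.mem_nhds (mem_chart_source _ x)] with z hz
  simp [(chartAt (Cn n) x).left_inv hz]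

theorem IsDivisorNorm.isClosed (hN : IsDivisorNorm n D N) : IsClosed D := by
  have : D = {x | N x ≤ 0} := by
    ext x
    constructor
    · intro hx; exact (hN.eq_zero hx).le
    · intro hx; by_contra h; exact absurd (hN.pos h) (not_lt.2 hx)
  rw [this]
  exact isClosed_le hN.smooth.continuous continuous_const

end DivisorNorm

/-! ### Adapted charts -/

section AdaptedCharts

variable {n : ℕ} {M : Type*} [TopologicalSpace M] [ChartedSpace (Cn n) M]

theorem dense_offZero [NeZero n] : Dense (offZero n) := by
  have h1 : IsOpenMap (EuclideanSpace.proj (𝕜 := ℂ) (0 : Fin n)) :=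
    ContinuousLinearMap.isOpenMap _ fun c => ⟨EuclideanSpace.single 0 c, by simp⟩
  exact (dense_compl_singleton (0 : ℂ)).preimage h1

theorem nhdsWithin_offZero_neBot [NeZero n] (y : Cn n) : (𝓝[offZero n] y).NeBot :=
  mem_closure_iff_nhdsWithin_neBot.1 (dense_offZero y)

theorem IsAdapted.mem_iff [NeZero n] {D : Set M} {e : OpenPartialHomeomorph M (Cn n)}
    (he : IsAdapted D e) {y : Cn n} (hy : y ∈ e.target) : e.symm y ∈ D ↔ y 0 = 0 := by
  rw [he.2 _ (e.map_target hy), e.right_inv hy]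

/-- On the hyperplane, Hadamard's lemma writes the local equation as f = z₁ u, and df ≠ 0 forces u ≠
0, so H = |u|² k works. Off the hyperplane one simply divides N by |z₁|². -/
theorem exists_local_factor [NeZero n] {D : Set M} {N : M → ℝ} (hN : IsDivisorNorm n D N)
    {e : OpenPartialHomeomorph M (Cn n)} (he : IsAdapted D e) {y : Cn n} (hy : y ∈ e.target) :
    ∃ (B : Set (Cn n)) (H : Cn n → ℝ), IsOpen B ∧ y ∈ B ∧ B ⊆ e.target ∧ ContDiffOn ℝ ∞ H B ∧
      ∀ z ∈ B, 0 < H z ∧ N (e.symm z) = ‖z 0‖ ^ 2 * H z := by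
  by_cases hy0 : y 0 = 0
  · obtain ⟨O, f, k, hO, hxO, hf, hk, h, hdf⟩ := hN (e.symm y)
    have hV := isOpen_chart_inter e hO
    obtain ⟨u, B, hB, hyB, hBV, hu, hfu⟩ := exists_eq_coord_mul hV (hf e he.1) ⟨hy, hxO⟩ hy0
      (fun p hp hp0 => ((h _ hp.2).2.2).1 ((he.mem_iff hp.1).2 hp0))
    have huy : u y ≠ 0 := by
      intro hu0
      refine hdf ((he.mem_iff hy).2 hy0) e he.1 (e.map_target hy) ?_
      rw [e.right_inv hy]
      have h1 : HasFDerivAt (fun z => f (e.symm z)) (fderiv ℂ (fun z => f (e.symm z)) y) y :=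
        (((hf e he.1).contDiffAt (hV.mem_nhds ⟨hy, hxO⟩)).differentiableAt (by simp)).hasFDerivAt
      have h2 := h1.restrictScalars ℝ
      -- If u also vanished at y, both factors of z₁ u would vanish there and so would the
      -- differential of f.
      have h3 : HasFDerivAt (fun z : Cn n => z 0 * u z) (0 : Cn n →L[ℝ] ℂ) y := by
        have hc := (differentiableAt_coord (0 : Fin n) y).hasFDerivAt.restrictScalars ℝ
        have hu' := ((hu.contDiffAt (hB.mem_nhds hyB)).differentiableAt (by simp)).hasFDerivAt
        refine (hc.mul hu').congr_fderiv ?_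
        rw [hy0, hu0]
        ext v
        change (0 : ℂ) * _ + (0 : ℂ) * _ = 0
        ring
      have h4 := h2.unique (h3.congr_of_eventuallyEq
        (by filter_upwards [hB.mem_nhds hyB] with z hz using hfu z hz))
      ext v
      exact congrArg (fun A : Cn n →L[ℝ] ℂ => A v) h4
    have hB' : IsOpen (B ∩ u ⁻¹' {0}ᶜ) :=
      hu.continuousOn.isOpen_inter_preimage hB isOpen_compl_singleton
    refine ⟨B ∩ u ⁻¹' {0}ᶜ, fun z => ‖u z‖ ^ 2 * k (e.symm z), hB', ⟨hyB, huy⟩,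
      fun z hz => (hBV hz.1).1, ?_, fun z hz => ?_⟩
    · exact ((hu.mono inter_subset_left).norm_sq ℝ).mul
        ((hk e he.1).mono (inter_subset_left.trans hBV))
    · obtain ⟨h1, h2, -⟩ := h _ (hBV hz.1).2
      have : u z ≠ 0 := hz.2
      refine ⟨by positivity, ?_⟩
      rw [h2, hfu z hz.1, norm_mul]; ring
  · refine ⟨e.target ∩ offZero n, fun z => N (e.symm z) / ‖z 0‖ ^ 2,
      e.open_target.inter isOpen_offZero, ⟨hy, hy0⟩, inter_subset_left, ?_, fun z hz => ?_⟩
    · refine ContDiffOn.div ((hN.smooth e he.1).mono ?_) contDiff_normSq_coord.contDiffOn ?_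
      · exact fun z hz => ⟨hz.1, mem_univ _⟩
      · intro z hz
        have : z 0 ≠ 0 := hz.2
        positivity
    · have h0 : z 0 ≠ 0 := hz.2
      have : 0 < N (e.symm z) := hN.pos fun h => h0 ((he.mem_iff hz.1).1 h)
      refine ⟨by positivity, ?_⟩
      field_simp

/-- In an adapted chart `|s|² = |z₁|² H` with `H` smooth and positive. -/
theorem exists_factor [NeZero n] {D : Set M} {N : M → ℝ} (hN : IsDivisorNorm n D N)
    {e : OpenPartialHomeomorph M (Cn n)} (he : IsAdapted D e) :
    ∃ H : Cn n → ℝ, ContDiffOn ℝ ∞ H e.target ∧ (∀ z ∈ e.target, 0 < H z) ∧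
      ∀ z ∈ e.target, N (e.symm z) = ‖z 0‖ ^ 2 * H z := by
  choose! B H hB hyB hBe hH hHN using fun y (hy : y ∈ e.target) => exists_local_factor hN he hy
  -- Off the hyperplane each local factor equals N/|z₁|². That set is dense, so continuity makes the
  -- local factors agree and they glue.
  have key : ∀ y ∈ e.target, ∀ z ∈ B y, H z z = H y z := by
    intro y hy z hz
    have hz' := hBe y hy hz
    have h1 : Tendsto (H z) (𝓝[offZero n] z) (𝓝 (H z z)) :=
      (((hH z hz').continuousOn.continuousAt ((hB z hz').mem_nhds (hyB z hz'))).tendsto).mono_left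
        nhdsWithin_le_nhds
    have h2 : Tendsto (H y) (𝓝[offZero n] z) (𝓝 (H y z)) :=
      (((hH y hy).continuousOn.continuousAt ((hB y hy).mem_nhds hz)).tendsto).mono_left
        nhdsWithin_le_nhds
    have := nhdsWithin_offZero_neBot z
    refine tendsto_nhds_unique (h1.congr' ?_) h2
    filter_upwards [nhdsWithin_le_nhds ((hB z hz').mem_nhds (hyB z hz')),
      nhdsWithin_le_nhds ((hB y hy).mem_nhds hz), self_mem_nhdsWithin] with p hp1 hp2 hp0
    have hp0' : p 0 ≠ 0 := hp0
    have e1 := (hHN z hz' p hp1).2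
    have e2 := (hHN y hy p hp2).2
    rw [e1] at e2
    exact mul_left_cancel₀ (by positivity) e2
  refine ⟨fun z => H z z, fun y hy => ContDiffAt.contDiffWithinAt ?_,
    fun z hz => (hHN z hz z (hyB z hz)).1, fun z hz => (hHN z hz z (hyB z hz)).2⟩
  refine ((hH y hy).contDiffAt ((hB y hy).mem_nhds (hyB y hy))).congr_of_eventuallyEq ?_
  filter_upwards [(hB y hy).mem_nhds (hyB y hy)] with z hz using key y hy z hz

theorem EdgeAtlas.exists_mem_core [NeZero n] {D : Set M} (A : EdgeAtlas n D) (x : M) :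
    ∃ i, x ∈ A.core i := mem_iUnion.1 (A.core_cover ▸ mem_univ x)

variable [IsManifold 𝓘(ℂ, Cn n) ω M]

theorem trans_mem_holoCharts {c : OpenPartialHomeomorph M (Cn n)} (hc : c ∈ holoCharts n M)
    {P : OpenPartialHomeomorph (Cn n) (Cn n)} (hP : ContDiffOn ℂ ω P P.source)
    (hP' : ContDiffOn ℂ ω P.symm P.target) : c.trans P ∈ holoCharts n M := by
  refine OpenPartialHomeomorph.mem_maximalAtlas_of_contMDiffOn _ ?_ ?_
  · refine (contMDiffOn_iff_contDiffOn.2 hP).comp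
      ((contMDiffOn_of_mem_maximalAtlas hc).mono ?_) ?_
    · intro x hx
      rw [OpenPartialHomeomorph.trans_source] at hx; exact hx.1
    · intro x hx
      rw [OpenPartialHomeomorph.trans_source] at hx; exact hx.2
  · refine (contMDiffOn_symm_of_mem_maximalAtlas hc).comp
      ((contMDiffOn_iff_contDiffOn.2 hP').mono ?_) ?_
    · intro x hx
      rw [OpenPartialHomeomorph.trans_target] at hx; exact hx.1
    · intro x hx
      rw [OpenPartialHomeomorph.trans_target] at hx; exact hx.2

/-- A linear map with a prescribed nonzero first coordinate can be completed to an isomorphism. -/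
theorem exists_equiv_of_ne_zero [NeZero n] {l : Cn n →L[ℂ] ℂ} (hl : l ≠ 0) :
    ∃ (A : Cn n →L[ℂ] Cn n) (T : Cn n ≃L[ℂ] Cn n), (∀ v, A v 0 = 0) ∧
      ∀ v, T v = A v + l v • basisVec 0 := by
  obtain ⟨j, hj⟩ : ∃ j, l (basisVec j) ≠ 0 := by
    by_contra! h
    apply hl
    ext v
    rw [← sum_smul_basisVec v]
    simp [h]
  -- The first coordinate is l; the other coordinates are all those except the j-th, permuted by the
  -- swap. Their common zero is a multiple of the j-th basis vector, on which l does not vanish.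
  let σ := Equiv.swap 0 j
  let A₀ : Cn n →ₗ[ℂ] Cn n :=
    { toFun := fun v => WithLp.toLp 2 fun α => if α = 0 then 0 else v (σ α)
      map_add' := fun v w => by
        ext α; by_cases h : α = 0 <;> simp [h]
      map_smul' := fun c v => by
        ext α; by_cases h : α = 0 <;> simp [h] }
  let T₀ : Cn n →ₗ[ℂ] Cn n := A₀ + l.toLinearMap.smulRight (basisVec 0)
  have hT₀ : ∀ v, T₀ v = A₀ v + l v • basisVec 0 := fun v => rfl
  have hA0 : ∀ v, A₀ v 0 = 0 := fun v => by simp [A₀]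
  have hA1 : ∀ v α, α ≠ 0 → A₀ v α = v (σ α) := fun v α h => by simp [A₀, h]
  have hinj : Function.Injective T₀ := by
    rw [← LinearMap.ker_eq_bot, LinearMap.ker_eq_bot']
    intro v hv
    rw [hT₀] at hv
    have h0 : l v = 0 := by
      have := congrArg (fun w : Cn n => w 0) hv
      simpa [hA0, basisVec] using this
    have hne : ∀ β, β ≠ j → v β = 0 := by
      intro β hβ
      have h1 : σ β ≠ 0 := by
        intro h
        apply hβ
        have : σ (σ β) = σ 0 := by rw [h]
        simpa [σ] using this
      rw [h0, zero_smul, add_zero] at hv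
      have := congrArg (fun w : Cn n => w (σ β)) hv
      simp only [hA1 v _ h1] at this
      simpa [σ] using this
    have hvj : v = v j • basisVec j := by
      ext β
      by_cases hβ : β = j
      · subst hβ; simp [basisVec]
      · simp [basisVec, hβ, hne β hβ]
    rw [hvj, map_smul, smul_eq_mul, mul_eq_zero] at h0
    rw [hvj, h0.resolve_right hj, zero_smul]
  refine ⟨A₀.toContinuousLinearMap,
    (LinearEquiv.ofInjectiveEndo T₀ hinj).toContinuousLinearEquiv, hA0, fun v => ?_⟩
  simp [hT₀]

/-- The local equation f has nonzero differential, so it can serve as first coordinate: it is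
completed linearly and the inverse function theorem applies. -/
theorem exists_adapted_of_mem [NeZero n] {D : Set M} {N : M → ℝ} (hN : IsDivisorNorm n D N) {x : M}
    (hx : x ∈ D) : ∃ e, IsAdapted (n := n) D e ∧ x ∈ e.source := by
  obtain ⟨O, f, k, hO, hxO, hf, -, h, hdf⟩ := hN x
  set c := chartAt (Cn n) x
  have hc : c ∈ holoCharts n M := chartAt_mem_holoCharts x
  have hxc : x ∈ c.source := mem_chart_source _ x
  have hV := isOpen_chart_inter c hO
  have hyV : c x ∈ c.target ∩ c.symm ⁻¹' O := ⟨c.map_source hxc, by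
    change c.symm (c x) ∈ O; rwa [c.left_inv hxc]⟩
  obtain ⟨A, T, hA, hT⟩ := exists_equiv_of_ne_zero (hdf hx c hc hxc)
  set Ψ : Cn n → Cn n := fun z => A z + f (c.symm z) • basisVec 0
  have hΨ : ContDiffOn ℂ ω Ψ (c.target ∩ c.symm ⁻¹' O) :=
    A.contDiff.contDiffOn.add ((hf c hc).smul contDiffOn_const)
  have hΨy := hΨ.contDiffAt (hV.mem_nhds hyV)
  have hd : HasFDerivAt Ψ (T : Cn n →L[ℂ] Cn n) (c x) := by
    have h1 : HasFDerivAt (fun z => f (c.symm z)) _ (c x) :=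
      (((hf c hc).contDiffAt (hV.mem_nhds hyV)).differentiableAt (by simp)).hasFDerivAt
    refine (A.hasFDerivAt.add (h1.smul_const (basisVec 0))).congr_fderiv ?_
    ext1 v
    exact (hT v).symm
  set P := hΨy.toOpenPartialHomeomorph Ψ hd (by simp) with hPdef
  have hPc : ⇑P = Ψ := hΨy.toOpenPartialHomeomorph_coe hd (by simp)
  have hyP : c x ∈ P.source := hΨy.mem_toOpenPartialHomeomorph_source hd (by simp)
  have hsymm : ContDiffAt ℂ ω P.symm (P (c x)) := by
    refine P.contDiffAt_symm (f₀' := T) (P.map_source hyP) ?_ ?_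
    · rw [P.left_inv hyP, hPc]; exact hd
    · rw [P.left_inv hyP, hPc]; exact hΨy
  -- Analyticity of the inverse is known at the image point only, hence near it. The chart is
  -- restricted to the part mapped into such a neighbourhood.
  obtain ⟨B, hBsub, hB, hyB⟩ := eventually_nhds_iff.1 (hsymm.eventually (by simp))
  have hW : IsOpen ((c.target ∩ c.symm ⁻¹' O) ∩ (P.source ∩ P ⁻¹' B)) :=
    hV.inter (P.isOpen_inter_preimage hB)
  set P' := P.restrOpen _ hW
  have hs' : P'.source ⊆ (c.target ∩ c.symm ⁻¹' O) ∩ (P.source ∩ P ⁻¹' B) := by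
    rw [P.restrOpen_source]; exact inter_subset_right
  refine ⟨c.trans P', ⟨trans_mem_holoCharts hc ?_ ?_, fun z hz => ?_⟩, ?_⟩
  · change ContDiffOn ℂ ω P P'.source
    rw [hPc]; exact hΨ.mono (hs'.trans inter_subset_left)
  · intro z hz
    have h1 := hs' (P'.map_target hz)
    have h2 : P (P'.symm z) ∈ B := h1.2.2
    have h3 : P (P'.symm z) = z := P'.right_inv hz
    rw [h3] at h2
    exact (hBsub z h2).contDiffWithinAt
  · rw [OpenPartialHomeomorph.trans_source] at hz
    have hzO : c.symm (c z) ∈ O := (hs' hz.2).1.2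
    rw [c.left_inv hz.1] at hzO
    rw [(h z hzO).2.2]
    have h1 : (c.trans P') z = Ψ (c z) := by
      rw [← hPc]; rfl
    rw [h1]
    simp [Ψ, hA, c.left_inv hz.1, basisVec]
  · rw [OpenPartialHomeomorph.trans_source]
    refine ⟨hxc, ?_⟩
    rw [mem_preimage, P.restrOpen_source]
    exact ⟨hyP, hyV, hyP, hyB⟩

/-- A translation gives the point first coordinate 1. After restriction the chart avoids D and its
first coordinate has no zero, so it is adapted vacuously. -/
theorem exists_adapted_of_notMem [NeZero n] {D : Set M} (hD : IsClosed D) {x : M}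
    (hx : x ∉ D) : ∃ e, IsAdapted (n := n) D e ∧ x ∈ e.source := by
  set c := chartAt (Cn n) x
  have hc : c ∈ holoCharts n M := chartAt_mem_holoCharts x
  have hxc : x ∈ c.source := mem_chart_source _ x
  set a : Cn n := (1 - c x 0) • basisVec 0
  set P := (Homeomorph.addRight a).toOpenPartialHomeomorph
  have hW : IsOpen ((c.target ∩ c.symm ⁻¹' Dᶜ) ∩ (fun z => z + a) ⁻¹' offZero n) :=
    (isOpen_chart_inter c hD.isOpen_compl).inter (isOpen_offZero.preimage (by fun_prop))
  set P' := P.restrOpen _ hW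
  have hs' : P'.source ⊆ (c.target ∩ c.symm ⁻¹' Dᶜ) ∩ (fun z => z + a) ⁻¹' offZero n := by
    rw [P.restrOpen_source]; exact inter_subset_right
  refine ⟨c.trans P', ⟨trans_mem_holoCharts hc ?_ ?_, fun z hz => ?_⟩, ?_⟩
  · change ContDiffOn ℂ ω (fun z => z + a) _
    fun_prop
  · change ContDiffOn ℂ ω (fun z => z + -a) _
    fun_prop
  · rw [OpenPartialHomeomorph.trans_source] at hz
    have h1 := hs' hz.2
    have h2 : c.symm (c z) ∉ D := h1.1.2
    rw [c.left_inv hz.1] at h2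
    have h3 : (c.trans P') z 0 ≠ 0 := h1.2
    exact iff_of_false h2 h3
  · rw [OpenPartialHomeomorph.trans_source]
    refine ⟨hxc, ?_⟩
    rw [mem_preimage, P.restrOpen_source]
    refine ⟨mem_univ _, ⟨c.map_source hxc, ?_⟩, ?_⟩
    · rw [mem_preimage, c.left_inv hxc]; exact hx
    · change (c x + a) 0 ≠ 0
      simp [a, basisVec]

theorem exists_edgeAtlas [NeZero n] [T2Space M] [CompactSpace M] {D : Set M} {N : M → ℝ}
    (hN : IsDivisorNorm n D N) : Nonempty (EdgeAtlas n D) := by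
  have h1 : ∀ x : M, ∃ e, IsAdapted (n := n) D e ∧ x ∈ e.source := by
    intro x
    by_cases hx : x ∈ D
    · exact exists_adapted_of_mem hN hx
    · exact exists_adapted_of_notMem hN.isClosed hx
  choose e he hxe using h1
  have h2 : ∀ x : M, ∃ K, IsCompact K ∧ x ∈ interior K ∧ K ⊆ (e x).source := fun x =>
    exists_compact_subset (e x).open_source (hxe x)
  choose K hK hxK hKe using h2
  obtain ⟨t, -, ht⟩ := isCompact_univ.elim_nhds_subcover K
    fun x _ => mem_interior_iff_mem_nhds.1 (hxK x)
  exact ⟨{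
    size := t.card
    chart := fun i => e (t.equivFin.symm i)
    adapted := fun i => he _
    core := fun i => K (t.equivFin.symm i)
    core_compact := fun i => hK _
    core_subset := fun i => hKe _
    core_cover := by
      refine eq_univ_of_univ_subset fun x hx => ?_
      obtain ⟨y, hy, hxy⟩ := mem_iUnion₂.1 (ht hx)
      exact mem_iUnion.2 ⟨t.equivFin ⟨y, hy⟩, by simpa using hxy⟩ }⟩

end AdaptedCharts

/-! ### Closed Hermitian forms -/

section ClosedForms

variable {n : ℕ} {M : Type*} [TopologicalSpace M] [ChartedSpace (Cn n) M]
  {e : OpenPartialHomeomorph M (Cn n)} {y : Cn n} {g g' : FormField n M} {U : Set M}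

theorem coeff_add (g g' : FormField n M) (e : OpenPartialHomeomorph M (Cn n)) (y : Cn n) :
    coeff (g + g') e y = coeff g e y + coeff g' e y := rfl

theorem coeff_sub (g g' : FormField n M) (e : OpenPartialHomeomorph M (Cn n)) (y : Cn n) :
    coeff (g - g') e y = coeff g e y - coeff g' e y := rfl

theorem coeff_smul (a : ℝ) (g : FormField n M) (e : OpenPartialHomeomorph M (Cn n)) (y : Cn n) :
    coeff (a • g) e y = (a : ℂ) • coeff g e y := by
  ext α β
  exact Complex.real_smul

/-- Smooth Hermitian forms whose associated `(1,1)`-form is closed. -/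
structure IsClosedHermitian (g : FormField n M) (U : Set M) : Prop where
  hermitian : ∀ x ∈ U, ∀ v w, g x v w = conj (g x w v)
  smooth : ∀ e ∈ holoCharts n M, ∀ α β,
    ContDiffOn ℝ ∞ (fun y => coeff g e y α β) (e.target ∩ e.symm ⁻¹' U)
  closed : ∀ e ∈ holoCharts n M, ∀ y ∈ e.target, e.symm y ∈ U → ∀ α β γ,
    wirt γ (fun z => coeff g e z α β) y = wirt α (fun z => coeff g e z γ β) y

theorem IsKaehlerOn.isClosedHermitian (h : IsKaehlerOn g U) : IsClosedHermitian g U :=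
  ⟨h.hermitian, h.smooth, h.closed⟩

theorem IsClosedHermitian.isKaehlerOn (h : IsClosedHermitian g U)
    (hp : ∀ x ∈ U, ∀ v : Cn n, v ≠ 0 → 0 < (formVal g x v v).re) : IsKaehlerOn g U :=
  ⟨h.hermitian, hp, h.smooth, h.closed⟩

theorem IsClosedHermitian.mono (h : IsClosedHermitian g U) {V : Set M} (hV : V ⊆ U) :
    IsClosedHermitian g V :=
  ⟨fun x hx => h.hermitian x (hV hx), fun e he α β => (h.smooth e he α β).mono
    (inter_subset_inter_right _ (preimage_mono hV)), fun e he y hy hyV => h.closed e he y hy (hV hyV)⟩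

theorem IsClosedHermitian.differentiableAt (h : IsClosedHermitian g U) (hU : IsOpen U)
    (he : e ∈ holoCharts n M) (hy : y ∈ e.target) (hyU : e.symm y ∈ U) (α β : Fin n) :
    DifferentiableAt ℝ (fun y => coeff g e y α β) y :=
  differentiableAt_of_smooth (isOpen_chart_inter e hU) (h.smooth e he α β) ⟨hy, hyU⟩

theorem IsClosedHermitian.add (h : IsClosedHermitian g U) (h' : IsClosedHermitian g' U)
    (hU : IsOpen U) : IsClosedHermitian (g + g') U where
  hermitian x hx v w := by
    change g x v w + g' x v w = conj (g x w v + g' x w v)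
    rw [map_add, ← h.hermitian x hx, ← h'.hermitian x hx]
  smooth e he α β := (h.smooth e he α β).add (h'.smooth e he α β)
  closed e he y hy hyU α β γ := by
    have e1 := h.closed e he y hy hyU α β γ
    have e2 := h'.closed e he y hy hyU α β γ
    rw [wirt_eq_dH, wirt_eq_dH] at e1 e2 ⊢
    simp only [coeff_add, Matrix.add_apply]
    rw [dH_add _ (h.differentiableAt hU he hy hyU _ _) (h'.differentiableAt hU he hy hyU _ _),
      dH_add _ (h.differentiableAt hU he hy hyU _ _) (h'.differentiableAt hU he hy hyU _ _), e1, e2]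

theorem IsClosedHermitian.smul (h : IsClosedHermitian g U) (hU : IsOpen U) (a : ℝ) :
    IsClosedHermitian (a • g) U where
  hermitian x hx v w := by
    change a • g x v w = conj (a • g x w v)
    rw [Complex.real_smul, Complex.real_smul, map_mul, Complex.conj_ofReal, ← h.hermitian x hx]
  smooth e he α β := by
    simp only [coeff_smul, Matrix.smul_apply, smul_eq_mul]
    exact contDiffOn_const.mul (h.smooth e he α β)
  closed e he y hy hyU α β γ := by
    have e1 := h.closed e he y hy hyU α β γ
    rw [wirt_eq_dH, wirt_eq_dH] at e1 ⊢
    simp only [coeff_smul, Matrix.smul_apply, smul_eq_mul]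
    rw [dH_const_mul _ _ (h.differentiableAt hU he hy hyU _ _),
      dH_const_mul _ _ (h.differentiableAt hU he hy hyU _ _), e1]

theorem IsClosedHermitian.sub (h : IsClosedHermitian g U) (h' : IsClosedHermitian g' U)
    (hU : IsOpen U) : IsClosedHermitian (g - g') U := by
  have : g - g' = g + (-1 : ℝ) • g' := by
    funext x; ext v w
    change g x v w - g' x v w = g x v w + (-1 : ℝ) • g' x v w
    rw [Complex.real_smul]; push_cast; ring
  rw [this]
  exact h.add (h'.smul hU _) hU

theorem IsClosedHermitian.coeff_conj (h : IsClosedHermitian g U) (hyU : e.symm y ∈ U) (α β : Fin n) :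
    coeff g e y α β = conj (coeff g e y β α) := h.hermitian _ hyU _ _

variable [IsManifold 𝓘(ℂ, Cn n) ω M]

theorem isClosedHermitian_ddc {f : M → ℝ} (hU : IsOpen U) (hf : SmoothOnCharts n f U) :
    IsClosedHermitian (ddc (n := n) f) U where
  hermitian x hx v w := by
    set c := chartAt (Cn n) x
    have hW := isOpen_chart_inter c hU
    have hxW : c x ∈ c.target ∩ c.symm ⁻¹' U := ⟨mem_chart_target _ x, by
      rw [mem_preimage, c.left_inv (mem_chart_source _ x)]; exact hx⟩
    have h1 := fun v w => sesq_complexHessian_eq_levi hW (hf c (chartAt_mem_holoCharts x)) hxW v w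
    have h2 := levi_conj hW (hf c (chartAt_mem_holoCharts x)) hxW w v
    exact ((h1 v w).trans h2.symm).trans (congrArg conj (h1 w v).symm)
  smooth e he α β := (contDiffOn_levi (isOpen_chart_inter e hU) (hf e he) _ _).congr
    fun y hy => coeff_ddc hU hf he hy.1 hy.2 α β
  closed e he y hy hyU α β γ := by
    have hW := isOpen_chart_inter e hU
    have hc := contDiffOn_ofReal (hf e he)
    have h1 : ∀ α γ : Fin n, wirt γ (fun z => coeff (ddc f) e z α β) y
        = dB (basisVec β) (dH (basisVec γ) (del (fun y => f (e.symm y)) (basisVec α))) y := by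
      intro α γ
      rw [wirt_eq_dH, ← dH_dB_comm hW (contDiffOn_del hW (hf e he) _) ⟨hy, hyU⟩]
      exact dH_congr_on hW (fun z hz => coeff_ddc hU hf he hz.1 hz.2 α β) ⟨hy, hyU⟩ _
    rw [h1, h1]
    exact dB_congr_on hW (fun z hz => dH_dH_comm hW hc hz _ _) ⟨hy, hyU⟩ _

theorem IsKaehlerOn.sesq_pos (h : IsKaehlerOn g U) (he : e ∈ holoCharts n M) (hy : y ∈ e.target)
    (hyU : e.symm y ∈ U) {v : Cn n} (hv : v ≠ 0) : 0 < (sesq (coeff g e y) v v).re := by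
  rw [sesq_coeff g he hy]
  exact h.pos _ hyU _ (jac_ne_zero he hy hv)

theorem posDef_of_sesq_pos {G : Matrix (Fin n) (Fin n) ℂ} (hG : ∀ α β, G α β = conj (G β α))
    (hp : ∀ v : Cn n, v ≠ 0 → 0 < (sesq G v v).re) : G.PosDef := by
  rw [Matrix.posDef_iff_dotProduct_mulVec]
  refine ⟨?_, fun x hx => ?_⟩
  · ext α β
    rw [Matrix.conjTranspose_apply]
    exact (hG α β).symm
  · set c : Cn n := WithLp.toLp 2 (fun i => conj (x i)) with hc
    have e1 : star x ⬝ᵥ G.mulVec x = sesq G c c := by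
      simp only [dotProduct, Matrix.mulVec, sesq_apply, Finset.mul_sum, Pi.star_apply,
        RCLike.star_def, hc, Complex.conj_conj]
      refine Finset.sum_congr rfl fun α _ => Finset.sum_congr rfl fun β _ => by ring
    have hc0 : c ≠ 0 := by
      intro h0
      apply hx
      ext i
      have := congrArg (fun w : Cn n => w i) h0
      simpa [hc] using this
    rw [e1, ← sesq_self_im hG c, Complex.zero_lt_real]
    exact hp c hc0

/-- By homogeneity it suffices to take unit vectors, and a positive continuous function on the
compact set S × sphere has a positive lower bound. -/
theorem exists_sesq_lower_bound {S : Set (Cn n)} (hS : IsCompact S)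
    {G : Cn n → Matrix (Fin n) (Fin n) ℂ} (hG : ∀ α β, ContinuousOn (fun y => G y α β) S)
    (hp : ∀ y ∈ S, ∀ v : Cn n, v ≠ 0 → 0 < (sesq (G y) v v).re) :
    ∃ C : ℝ, 0 < C ∧ ∀ y ∈ S, ∀ v, ‖v‖ ^ 2 ≤ C * (sesq (G y) v v).re := by
  have hK : IsCompact (S ×ˢ Metric.sphere (0 : Cn n) 1) := hS.prod (isCompact_sphere 0 1)
  have hc : ContinuousOn (fun p : Cn n × Cn n => (sesq (G p.1) p.2 p.2).re)
      (S ×ˢ Metric.sphere (0 : Cn n) 1) := by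
    simp only [sesq_apply]
    refine Complex.continuous_re.comp_continuousOn ?_
    refine continuousOn_finsetSum _ fun α _ => continuousOn_finsetSum _ fun β _ => ?_
    have h1 : ContinuousOn (fun p : Cn n × Cn n => G p.1 α β) (S ×ˢ Metric.sphere (0 : Cn n) 1) :=
      (hG α β).comp continuousOn_fst fun p hp => hp.1
    have h2 : Continuous fun p : Cn n × Cn n => p.2 α := by fun_prop
    have h3 : Continuous fun p : Cn n × Cn n => conj (p.2 β) :=
      Complex.continuous_conj.comp (by fun_prop)
    exact (h1.mul h2.continuousOn).mul h3.continuousOn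
  have hpos : ∀ p ∈ S ×ˢ Metric.sphere (0 : Cn n) 1, 0 < (sesq (G p.1) p.2 p.2).re := by
    rintro ⟨y, v⟩ ⟨hy, hv⟩
    refine hp y hy v ?_
    rintro rfl
    simp at hv
  obtain ⟨c, hc0, hcb⟩ := hK.exists_forall_le' hc hpos
  refine ⟨c⁻¹, inv_pos.2 hc0, fun y hy v => ?_⟩
  by_cases hv : v = 0
  · subst hv; simp
  have hn : 0 < ‖v‖ := norm_pos_iff.2 hv
  set u : Cn n := ((‖v‖⁻¹ : ℝ) : ℂ) • v with hu
  have hu1 : u ∈ Metric.sphere (0 : Cn n) 1 := by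
    rw [mem_sphere_zero_iff_norm, hu, norm_smul, Complex.norm_real, norm_inv, norm_norm]
    field_simp
  have h1 := hcb (y, u) ⟨hy, hu1⟩
  have h2 : (sesq (G y) u u).re = (‖v‖ ^ 2)⁻¹ * (sesq (G y) v v).re := by
    rw [hu, (sesq (G y)).map_smulₛₗ, LinearMap.smul_apply, (sesq (G y) v).map_smulₛₗ,
      Complex.conj_ofReal, RingHom.id_apply, smul_eq_mul, smul_eq_mul, ← mul_assoc,
      ← Complex.ofReal_mul, Complex.re_ofReal_mul]
    congr 1
    rw [pow_two, mul_inv]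
  simp only [h2] at h1
  rw [← div_eq_inv_mul, le_div_iff₀ (by positivity)] at h1
  rw [← div_eq_inv_mul, le_div_iff₀ hc0]
  linarith

end ClosedForms

/-! ### Forms on the complement of the divisor -/

section GlobalForms

variable {n : ℕ} [NeZero n] {M : Type*} [TopologicalSpace M] [ChartedSpace (Cn n) M] {D : Set M}
  [IsManifold 𝓘(ℂ, Cn n) ω M]

/-- Inequalities between forms are checked in finitely many charts: every point lies in some core,
and every tangent vector comes from the chart since `jac` is surjective. -/
theorem EdgeAtlas.exists_form_le (A : EdgeAtlas n D) {q q' : FormField n M}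
    (hq' : ∀ x, x ∉ D → ∀ v : Cn n, 0 ≤ (formVal q' x v v).re)
    (h : ∀ i, ∃ C : ℝ, ∀ y ∈ (A.chart i).target, (A.chart i).symm y ∈ A.core i →
      (A.chart i).symm y ∉ D → ∀ v, |(sesq (coeff q (A.chart i) y) v v).re|
        ≤ C * (sesq (coeff q' (A.chart i) y) v v).re) :
    ∃ C : ℝ, 0 < C ∧ ∀ x, x ∉ D → ∀ v : Cn n,
      |(formVal q x v v).re| ≤ C * (formVal q' x v v).re := by
  choose C hC using h
  refine ⟨1 + ∑ i, |C i|, by positivity, fun x hx v => ?_⟩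
  obtain ⟨i, hi⟩ := A.exists_mem_core x
  have hxs := A.core_subset i hi
  have hy := (A.chart i).map_source hxs
  have hyx := (A.chart i).left_inv hxs
  obtain ⟨u, hu⟩ := jac_surjective (A.adapted i).1 hy v
  have h1 := hC i _ hy (by rwa [hyx]) (by rwa [hyx]) u
  rw [sesq_coeff _ (A.adapted i).1 hy, sesq_coeff _ (A.adapted i).1 hy, hu, hyx] at h1
  refine h1.trans (mul_le_mul_of_nonneg_right ?_ (hq' x hx v))
  have := Finset.single_le_sum (f := fun i => |C i|) (fun i _ => abs_nonneg _) (Finset.mem_univ i)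
  have h2 := le_abs_self (C i)
  linarith

end GlobalForms

/-! ### Powers of the norm in an adapted chart -/

section Powers

variable {n : ℕ} {M : Type*} [TopologicalSpace M] {D : Set M} {N : M → ℝ}
  {e : OpenPartialHomeomorph M (Cn n)} {H : Cn n → ℝ} {y : Cn n}

theorem rpow_eq_exp_logN [NeZero n] (hpos : ∀ z ∈ e.target, 0 < H z)
    (hNH : ∀ z ∈ e.target, N (e.symm z) = ‖z 0‖ ^ 2 * H z) (hy : y ∈ e.target ∩ offZero n) (σ : ℝ) :
    N (e.symm y) ^ σ = Real.exp (σ * logN H y) := by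
  rw [hNH y hy.1, exp_mul_logN hpos hy, Real.mul_rpow (by positivity) (hpos y hy.1).le,
    ← Real.rpow_natCast, ← Real.rpow_mul (norm_nonneg _)]
  norm_num

variable [ChartedSpace (Cn n) M]

theorem IsDivisorNorm.smooth_rpow (hN : IsDivisorNorm n D N) (σ : ℝ) :
    SmoothOnCharts n (fun x => N x ^ σ) Dᶜ := fun e he =>
  ((hN.smooth.mono (subset_univ _)) e he).rpow_const_of_ne fun _ hy => (hN.pos hy.2).ne'

variable [NeZero n]

variable [IsManifold 𝓘(ℂ, Cn n) ω M]

theorem sesq_coeff_ddc_log (hN : IsDivisorNorm n D N) (he : IsAdapted D e)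
    (hNH : ∀ z ∈ e.target, N (e.symm z) = ‖z 0‖ ^ 2 * H z) (hy : y ∈ e.target ∩ offZero n)
    (v w : Cn n) :
    sesq (coeff (ddc fun x => Real.log (N x)) e y) v w = levi (logN H) v w y := by
  have hyD : e.symm y ∈ Dᶜ := fun h => hy.2 ((he.mem_iff hy.1).1 h)
  rw [sesq_coeff_ddc hN.isClosed.isOpen_compl hN.smooth_log he.1 hy.1 hyD]
  refine dB_congr_on e.open_target (fun z hz => dH_congr_on e.open_target (fun z' hz' => ?_) hz v)
    hy.1 w
  simp only [logN]
  rw [hNH z' hz']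

theorem sesq_coeff_ddc_rpow (hN : IsDivisorNorm n D N) (he : IsAdapted D e)
    (hH : ContDiffOn ℝ ∞ H e.target) (hpos : ∀ z ∈ e.target, 0 < H z)
    (hNH : ∀ z ∈ e.target, N (e.symm z) = ‖z 0‖ ^ 2 * H z) (σ : ℝ) (hy : y ∈ e.target ∩ offZero n)
    (v w : Cn n) :
    sesq (coeff (ddc fun x => N x ^ σ) e y) v w = (Real.exp (σ * logN H y) : ℂ) *
      (σ * levi (logN H) v w y + σ ^ 2 * (del (logN H) v y * conj (del (logN H) w y))) := by
  have hyD : e.symm y ∈ Dᶜ := fun h => hy.2 ((he.mem_iff hy.1).1 h)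
  have hW : IsOpen (e.target ∩ offZero n) := e.open_target.inter isOpen_offZero
  rw [sesq_coeff_ddc hN.isClosed.isOpen_compl (hN.smooth_rpow σ) he.1 hy.1 hyD,
    ← levi_exp hW (contDiffOn_logN hH hpos) hy]
  refine dB_congr_on hW (fun z hz => dH_congr_on hW (fun z' hz' => ?_) hz v) hy w
  simp only
  rw [rpow_eq_exp_logN hpos hNH hz']

end Powers

/-! ### Comparison with the flat model -/

section Model

variable {n : ℕ} {H : Cn n → ℝ} {U S : Set (Cn n)} {z : Cn n}

theorem exists_rpow_factor_le (hS : IsCompact S) (hSU : S ⊆ U) (hH : ContDiffOn ℝ ∞ H U)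
    (hpos : ∀ z ∈ U, 0 < H z) (q : ℝ) : ∃ C : ℝ, 0 ≤ C ∧ ∀ z ∈ S, H z ^ q ≤ C := by
  have hc : ContinuousOn (fun z : Cn n => H z ^ q) U :=
    hH.continuousOn.rpow_const fun z hz => Or.inl (hpos z hz).ne'
  obtain ⟨C, hC, h⟩ := exists_bound_of_smooth hS hSU hc
  exact ⟨C, hC, fun z hz => (le_abs_self _).trans (h z hz)⟩

variable [NeZero n]

/-- The squared length `|v|² + |s|^{2τ} |∂ log |s|² (v)|²`. -/
def edgeSq (τ : ℝ) (H : Cn n → ℝ) (v z : Cn n) : ℝ :=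
  ‖v‖ ^ 2 + Real.exp (τ * logN H z) * ‖del (logN H) v z‖ ^ 2

theorem edgeSq_nonneg (τ : ℝ) (v : Cn n) : 0 ≤ edgeSq τ H v z := by
  unfold edgeSq; positivity

theorem sesq_modelEdge (τ : ℝ) (z v : Cn n) :
    (sesq (modelEdge τ z) v v).re
      = τ ^ 2 * (‖z 0‖ ^ (2 * τ - 2) * ‖v 0‖ ^ 2) + ∑ j ∈ Finset.univ.erase 0, ‖v j‖ ^ 2 := by
  have h1 : sesq (modelEdge τ z) v v = ∑ α : Fin n,
      (if α = 0 then ((τ ^ 2 * ‖z 0‖ ^ (2 * τ - 2) : ℝ) : ℂ) else 1) * v α * conj (v α) := by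
    rw [sesq_apply]
    refine Finset.sum_congr rfl fun α _ => ?_
    rw [Finset.sum_eq_single α]
    · simp [modelEdge]
    · intro β _ hβ
      simp [modelEdge, Matrix.diagonal_apply_ne _ hβ.symm]
    · simp
  rw [h1, ← Finset.add_sum_erase _ _ (Finset.mem_univ (0 : Fin n)), Complex.add_re, Complex.re_sum]
  congr 1
  · rw [if_pos rfl, mul_assoc, Complex.mul_conj, Complex.normSq_eq_norm_sq, ← Complex.ofReal_mul,
      Complex.ofReal_re, mul_assoc]
  · refine Finset.sum_congr rfl fun j hj => ?_
    rw [if_neg (Finset.ne_of_mem_erase hj), one_mul, Complex.mul_conj, Complex.normSq_eq_norm_sq,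
      Complex.ofReal_re]

theorem norm_sq_eq_add (v : Cn n) :
    ‖v‖ ^ 2 = ‖v 0‖ ^ 2 + ∑ j ∈ Finset.univ.erase 0, ‖v j‖ ^ 2 := by
  rw [EuclideanSpace.norm_sq_eq, ← Finset.add_sum_erase _ _ (Finset.mem_univ (0 : Fin n))]

theorem norm_add_sq_le_two (a b : ℂ) : ‖a + b‖ ^ 2 ≤ 2 * ‖a‖ ^ 2 + 2 * ‖b‖ ^ 2 := by
  have := norm_add_le a b
  nlinarith [sq_nonneg (‖a‖ - ‖b‖), norm_nonneg (a + b), norm_nonneg a, norm_nonneg b]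

theorem exists_rpow_norm_le (hS : IsCompact S) {q : ℝ} (hq : 0 ≤ q) :
    ∃ C : ℝ, 0 ≤ C ∧ ∀ z ∈ S, ‖z 0‖ ^ q ≤ C := by
  have hc : Continuous fun z : Cn n => ‖z 0‖ ^ q :=
    (contDiff_coord 0).continuous.norm.rpow_const fun _ => Or.inr hq
  obtain ⟨C, hC, h⟩ := exists_bound_of_smooth hS subset_rfl hc.continuousOn
  exact ⟨C, hC, fun z hz => (le_abs_self _).trans (h z hz)⟩

/-- With e^{τφ} = |z₁|^{2τ} H^τ and ∂φ(v) = v₁/z₁ + ∂ log H(v), the singular term is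
|z₁|^{2τ-2}|v₁|² up to bounded factors. Since τ < 1, |v₁|² is itself controlled by that term. -/
theorem exists_edgeSq_le_model (hU : IsOpen U) (hS : IsCompact S) (hSU : S ⊆ U)
    (hH : ContDiffOn ℝ ∞ H U) (hpos : ∀ z ∈ U, 0 < H z) {τ : ℝ} (hτ : 0 < τ) (hτ1 : τ < 1) :
    ∃ C : ℝ, 0 ≤ C ∧ ∀ z ∈ S ∩ offZero n, ∀ v,
      edgeSq τ H v z ≤ C * (sesq (modelEdge τ z) v v).re := by
  obtain ⟨C₁, h₁, B₁⟩ := exists_del_bound hU hS hSU (contDiffOn_logH hH hpos)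
  obtain ⟨C₂, h₂, B₂⟩ := exists_rpow_norm_le (S := S) hS (q := 2 * τ) (by positivity)
  obtain ⟨C₃, h₃, B₃⟩ := exists_rpow_norm_le (S := S) hS (q := 2 - 2 * τ) (by linarith)
  obtain ⟨C₄, h₄, B₄⟩ := exists_rpow_factor_le hS hSU hH hpos τ
  refine ⟨(1 + 2 * (C₂ * C₄) * C₁ ^ 2) * (C₃ / τ ^ 2 + 1) + 2 * C₄ / τ ^ 2, by positivity,
    fun z hz v => ?_⟩
  have hzU : z ∈ U ∩ offZero n := ⟨hSU hz.1, hz.2⟩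
  have h0 : 0 < ‖z 0‖ := norm_pos_iff.2 hz.2
  rw [edgeSq, sesq_modelEdge, exp_mul_logN hpos hzU, del_logN hU hH hpos hzU, norm_sq_eq_add]
  set A := ‖z 0‖ ^ (2 * τ - 2) * ‖v 0‖ ^ 2 with hA
  set B := ∑ j ∈ Finset.univ.erase (0 : Fin n), ‖v j‖ ^ 2 with hB
  have hA0 : 0 ≤ A := by positivity
  have hB0 : 0 ≤ B := Finset.sum_nonneg fun _ _ => by positivity
  have e1 : ‖v 0‖ ^ 2 = ‖z 0‖ ^ (2 - 2 * τ) * A := by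
    rw [hA, ← mul_assoc, ← Real.rpow_add h0]; simp
  have e2 : ‖z 0‖ ^ (2 * τ) * ‖v 0 / z 0‖ ^ 2 = A := by
    rw [hA, norm_div, div_pow, Real.rpow_sub h0]
    simp only [Real.rpow_ofNat]
    ring
  set r := ‖z 0‖ ^ (2 * τ) with hr
  set k := H z ^ τ with hk
  have hr0 : 0 ≤ r := by positivity
  have hk0 : 0 ≤ k := Real.rpow_nonneg (hpos z hzU.1).le _
  have i1 : ‖v 0‖ ^ 2 ≤ C₃ * A := by
    rw [e1]; exact mul_le_mul_of_nonneg_right (B₃ z hz.1) hA0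
  have i2 : ‖v 0 / z 0 + del (logH H) v z‖ ^ 2
      ≤ 2 * ‖v 0 / z 0‖ ^ 2 + 2 * (C₁ ^ 2 * (‖v 0‖ ^ 2 + B)) := by
    refine (norm_add_sq_le_two _ _).trans ?_
    have : ‖del (logH H) v z‖ ^ 2 ≤ (C₁ * ‖v‖) ^ 2 := by
      have := B₁ z hz.1 v
      gcongr
    rw [mul_pow, norm_sq_eq_add] at this
    linarith
  have i3 : r * k * ‖v 0 / z 0 + del (logH H) v z‖ ^ 2
      ≤ 2 * (C₄ * A) + 2 * (C₂ * C₄) * C₁ ^ 2 * (‖v 0‖ ^ 2 + B) := by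
    have a1 : k * A ≤ C₄ * A := mul_le_mul_of_nonneg_right (B₄ z hz.1) hA0
    have a2 : r * k ≤ C₂ * C₄ := mul_le_mul (B₂ z hz.1) (B₄ z hz.1) hk0 h₂
    have a3 := mul_le_mul_of_nonneg_right a2
      (show 0 ≤ 2 * (C₁ ^ 2 * (‖v 0‖ ^ 2 + B)) by positivity)
    calc _ ≤ r * k * (2 * ‖v 0 / z 0‖ ^ 2 + 2 * (C₁ ^ 2 * (‖v 0‖ ^ 2 + B))) :=
          mul_le_mul_of_nonneg_left i2 (by positivity)
      _ = 2 * (k * (r * ‖v 0 / z 0‖ ^ 2)) + r * k * (2 * (C₁ ^ 2 * (‖v 0‖ ^ 2 + B))) := by ring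
      _ ≤ _ := by rw [e2]; linarith
  have i4 : A ≤ (τ ^ 2 * A + B) / τ ^ 2 := by
    rw [le_div_iff₀ (by positivity)]; linarith
  have i5 : B ≤ τ ^ 2 * A + B := by linarith [show 0 ≤ τ ^ 2 * A by positivity]
  have i6 : ‖v 0‖ ^ 2 + B ≤ (C₃ / τ ^ 2 + 1) * (τ ^ 2 * A + B) := by
    have := mul_le_mul_of_nonneg_left i4 h₃
    calc _ ≤ C₃ * ((τ ^ 2 * A + B) / τ ^ 2) + (τ ^ 2 * A + B) := by linarith
      _ = _ := by ring
  calc _ ≤ (1 + 2 * (C₂ * C₄) * C₁ ^ 2) * (‖v 0‖ ^ 2 + B) + 2 * (C₄ * A) := by linarith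
    _ ≤ (1 + 2 * (C₂ * C₄) * C₁ ^ 2) * ((C₃ / τ ^ 2 + 1) * (τ ^ 2 * A + B))
        + 2 * (C₄ * ((τ ^ 2 * A + B) / τ ^ 2)) := by gcongr
    _ = _ := by ring

/-- The same identity read backwards: v₁/z₁ is ∂φ(v) minus a term bounded by |v|. -/
theorem exists_model_le_edgeSq (hU : IsOpen U) (hS : IsCompact S) (hSU : S ⊆ U)
    (hH : ContDiffOn ℝ ∞ H U) (hpos : ∀ z ∈ U, 0 < H z) {τ : ℝ} (hτ : 0 < τ) :
    ∃ C : ℝ, 0 ≤ C ∧ ∀ z ∈ S ∩ offZero n, ∀ v,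
      (sesq (modelEdge τ z) v v).re ≤ C * edgeSq τ H v z := by
  obtain ⟨C₁, h₁, B₁⟩ := exists_del_bound hU hS hSU (contDiffOn_logH hH hpos)
  obtain ⟨C₂, h₂, B₂⟩ := exists_rpow_norm_le (S := S) hS (q := 2 * τ) (by positivity)
  obtain ⟨C₄, h₄, B₄⟩ := exists_rpow_factor_le hS hSU hH hpos (-τ)
  refine ⟨τ ^ 2 * (2 * C₄ + 2 * C₂ * C₁ ^ 2) + 1, by positivity, fun z hz v => ?_⟩
  have hzU : z ∈ U ∩ offZero n := ⟨hSU hz.1, hz.2⟩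
  have h0 : 0 < ‖z 0‖ := norm_pos_iff.2 hz.2
  have hH0 := hpos z hzU.1
  have hp := del_logN hU hH hpos hzU v
  have hv := norm_sq_eq_add v
  rw [edgeSq, sesq_modelEdge, exp_mul_logN hpos hzU]
  set A := ‖z 0‖ ^ (2 * τ - 2) * ‖v 0‖ ^ 2 with hA
  set B := ∑ j ∈ Finset.univ.erase (0 : Fin n), ‖v j‖ ^ 2 with hB
  have e2 : ‖z 0‖ ^ (2 * τ) * ‖v 0 / z 0‖ ^ 2 = A := by
    rw [hA, norm_div, div_pow, Real.rpow_sub h0]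
    simp only [Real.rpow_ofNat]
    ring
  set r := ‖z 0‖ ^ (2 * τ) with hr
  set p := del (logN H) v z with hpdef
  have hr0 : 0 ≤ r := by positivity
  have i2 : ‖v 0 / z 0‖ ^ 2 ≤ 2 * ‖p‖ ^ 2 + 2 * (C₁ ^ 2 * ‖v‖ ^ 2) := by
    have e3 : v 0 / z 0 = p + -del (logH H) v z := by rw [hp]; ring
    rw [e3]
    refine (norm_add_sq_le_two _ _).trans ?_
    have : ‖del (logH H) v z‖ ^ 2 ≤ (C₁ * ‖v‖) ^ 2 := by
      have := B₁ z hz.1 v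
      gcongr
    rw [mul_pow] at this
    rw [norm_neg]
    linarith
  have i3 : r * ‖p‖ ^ 2 ≤ C₄ * (r * H z ^ τ * ‖p‖ ^ 2) := by
    have a1 : H z ^ (-τ) * H z ^ τ = 1 := by rw [← Real.rpow_add hH0]; simp
    calc r * ‖p‖ ^ 2 = H z ^ (-τ) * (r * H z ^ τ * ‖p‖ ^ 2) := by linear_combination (-(r * ‖p‖ ^ 2)) * a1
      _ ≤ _ := mul_le_mul_of_nonneg_right (B₄ z hz.1) (by positivity)
  have i4 : r * (C₁ ^ 2 * ‖v‖ ^ 2) ≤ C₂ * (C₁ ^ 2 * ‖v‖ ^ 2) :=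
    mul_le_mul_of_nonneg_right (B₂ z hz.1) (by positivity)
  have i5 : A ≤ (2 * C₄) * (r * H z ^ τ * ‖p‖ ^ 2) + 2 * C₂ * C₁ ^ 2 * ‖v‖ ^ 2 := by
    rw [← e2]
    calc _ ≤ r * (2 * ‖p‖ ^ 2 + 2 * (C₁ ^ 2 * ‖v‖ ^ 2)) := mul_le_mul_of_nonneg_left i2 hr0
      _ ≤ _ := by linarith
  set E := r * H z ^ τ * ‖p‖ ^ 2 with hE
  have hE0 : 0 ≤ E := by positivity
  have i6 : A ≤ (2 * C₄ + 2 * C₂ * C₁ ^ 2) * (‖v‖ ^ 2 + E) := by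
    have : 0 ≤ 2 * C₂ * C₁ ^ 2 * E + 2 * C₄ * ‖v‖ ^ 2 := by positivity
    linarith
  have i7 : B ≤ ‖v‖ ^ 2 + E := by linarith [sq_nonneg ‖v 0‖]
  calc _ ≤ τ ^ 2 * ((2 * C₄ + 2 * C₂ * C₁ ^ 2) * (‖v‖ ^ 2 + E)) + (‖v‖ ^ 2 + E) := by gcongr
    _ = _ := by ring

end Model

/-! ### The coefficients in the coframe `ε, dz₂, …, dz_n` -/

section EdgeFrame

variable {n : ℕ} [NeZero n] {H : Cn n → ℝ} {U : Set (Cn n)} {y z : Cn n} {τ σ : ℝ}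

theorem edgeCoeff_apply (τ : ℝ) (G : Cn n → Matrix (Fin n) (Fin n) ℂ) (z : Cn n) (α β : Fin n) :
    edgeCoeff τ G z α β = frameFactor τ z α * G z α β * conj (frameFactor τ z β) := rfl

/-- The product of `|z₁|^τ` and of the frame factor. -/
def kappa (τ : ℝ) (α : Fin n) (z : Cn n) : ℂ := if α = 0 then z 0 / τ else ((‖z 0‖ ^ τ : ℝ) : ℂ)

/-- The components of `|z₁|^τ ∂ log (|z₁|² H)` in the frame dual to `ε, dz₂, …, dz_n`. -/
def rho (τ : ℝ) (H : Cn n → ℝ) (α : Fin n) (z : Cn n) : ℂ :=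
  kappa τ α z * del (logH H) (basisVec α) z + if α = 0 then (1 / τ : ℂ) else 0

/-- The coefficients of `dd^c (|z₁|² H)^σ` in the coframe `ε, dz₂, …, dz_n`. -/
def powerExpr (τ σ : ℝ) (H : Cn n → ℝ) (α β : Fin n) (z : Cn n) : ℂ :=
  ((H z ^ σ : ℝ) : ℂ) * ((‖z 0‖ ^ (2 * σ - 2 * τ) : ℝ) : ℂ) *
    (σ * (kappa τ α z * conj (kappa τ β z) * levi (logH H) (basisVec α) (basisVec β) z)
      + σ ^ 2 * (rho τ H α z * conj (rho τ H β z)))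

theorem frameFactor_mul (hτ : 0 < τ) (hz : z 0 ≠ 0) (α : Fin n) :
    frameFactor τ z α * ((‖z 0‖ ^ τ : ℝ) : ℂ) = kappa τ α z := by
  have h1 : ((‖z 0‖ ^ τ : ℝ) : ℂ) ≠ 0 :=
    Complex.ofReal_ne_zero.2 (Real.rpow_pos_of_pos (norm_pos_iff.2 hz) _).ne'
  have h2 : (τ : ℂ) ≠ 0 := Complex.ofReal_ne_zero.2 hτ.ne'
  by_cases hα : α = 0
  · simp only [frameFactor, kappa, if_pos hα, Complex.ofReal_mul]
    field_simp
  · simp only [frameFactor, kappa, if_neg hα, one_mul]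

theorem frameFactor_mul_del (hτ : 0 < τ) (hU : IsOpen U) (hH : ContDiffOn ℝ ∞ H U)
    (hpos : ∀ z ∈ U, 0 < H z) (hz : z ∈ U ∩ offZero n) (α : Fin n) :
    frameFactor τ z α * ((‖z 0‖ ^ τ : ℝ) : ℂ) * del (logN H) (basisVec α) z = rho τ H α z := by
  have h2 : (τ : ℂ) ≠ 0 := Complex.ofReal_ne_zero.2 hτ.ne'
  have h0 : z 0 ≠ 0 := hz.2
  rw [frameFactor_mul hτ h0, del_logN hU hH hpos hz, rho, mul_add, add_comm]
  congr 1
  by_cases hα : α = 0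
  · subst hα
    simp only [kappa, if_true, basisVec, PiLp.single_apply]
    field_simp
  · simp [hα, basisVec, Ne.symm hα]

/-- Of the factor |z₁|^{2σ} in e^{σφ}, one |z₁|^τ goes to each frame factor. It cancels the pole of
∂φ in the ε direction, where the product tends to 1/τ, and leaves |z₁|^{2σ-2τ}. The resulting
expression makes sense on the hyperplane itself. -/
theorem edgeCoeff_eq_powerExpr (hτ : 0 < τ) (hU : IsOpen U) (hH : ContDiffOn ℝ ∞ H U)
    (hpos : ∀ z ∈ U, 0 < H z) (hz : z ∈ U ∩ offZero n) {G : Cn n → Matrix (Fin n) (Fin n) ℂ}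
    (hG : ∀ v w, sesq (G z) v w = (Real.exp (σ * logN H z) : ℂ) *
      (σ * levi (logN H) v w z + σ ^ 2 * (del (logN H) v z * conj (del (logN H) w z))))
    (α β : Fin n) : edgeCoeff τ G z α β = powerExpr τ σ H α β z := by
  have h0 : 0 < ‖z 0‖ := norm_pos_iff.2 hz.2
  have e1 : Real.exp (σ * logN H z)
      = H z ^ σ * ‖z 0‖ ^ (2 * σ - 2 * τ) * (‖z 0‖ ^ τ * ‖z 0‖ ^ τ) := by
    rw [exp_mul_logN hpos hz, ← Real.rpow_add h0, mul_assoc, ← Real.rpow_add h0, mul_comm]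
    congr 2; ring
  rw [edgeCoeff_apply, ← sesq_basisVec (G z), hG, e1, powerExpr, levi_logN hU hH hpos hz,
    ← frameFactor_mul_del hτ hU hH hpos hz, ← frameFactor_mul_del hτ hU hH hpos hz,
    ← frameFactor_mul hτ hz.2, ← frameFactor_mul hτ hz.2]
  simp only [map_mul, Complex.conj_ofReal]
  push_cast
  ring

theorem continuous_rpow_norm {q : ℝ} (hq : 0 ≤ q) :
    Continuous fun z : Cn n => ((‖z 0‖ ^ q : ℝ) : ℂ) :=
  Complex.continuous_ofReal.comp
    ((contDiff_coord 0).continuous.norm.rpow_const fun _ => Or.inr hq)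

theorem continuous_kappa (hτ : 0 < τ) (α : Fin n) : Continuous (kappa τ α) := by
  by_cases hα : α = 0
  · have : kappa τ α = fun z => z 0 / (τ : ℂ) := funext fun z => if_pos hα
    rw [this]
    exact (contDiff_coord 0).continuous.div_const _
  · have : kappa τ α = fun z => ((‖z 0‖ ^ τ : ℝ) : ℂ) := funext fun z => if_neg hα
    rw [this]
    exact continuous_rpow_norm hτ.le

theorem continuousOn_rho (hτ : 0 < τ) (hU : IsOpen U) (hH : ContDiffOn ℝ ∞ H U)
    (hpos : ∀ z ∈ U, 0 < H z) (α : Fin n) : ContinuousOn (rho τ H α) U :=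
  ((continuous_kappa hτ α).continuousOn.mul
    (contDiffOn_del hU (contDiffOn_logH hH hpos) _).continuousOn).add continuousOn_const

theorem continuousOn_powerExpr (hτ : 0 < τ) (hσ : τ ≤ σ) (hU : IsOpen U) (hH : ContDiffOn ℝ ∞ H U)
    (hpos : ∀ z ∈ U, 0 < H z) (α β : Fin n) : ContinuousOn (powerExpr τ σ H α β) U := by
  have h1 : ContinuousOn (fun z => ((H z ^ σ : ℝ) : ℂ)) U :=
    Complex.continuous_ofReal.comp_continuousOn
      (hH.continuousOn.rpow_const fun z hz => Or.inl (hpos z hz).ne')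
  have h2 := (contDiffOn_levi hU (contDiffOn_logH hH hpos) (basisVec α) (basisVec β)).continuousOn
  have hk := fun α => (continuous_kappa (n := n) hτ α).continuousOn (s := U)
  have hr := continuousOn_rho hτ hU hH hpos
  have hc := Complex.continuous_conj
  exact (h1.mul (continuous_rpow_norm (by linarith)).continuousOn).mul
    ((continuousOn_const.mul (((hk α).mul (hc.comp_continuousOn (hk β))).mul h2)).add
      (continuousOn_const.mul ((hr α).mul (hc.comp_continuousOn (hr β)))))

theorem kappa_eq_zero (hτ : 0 < τ) (hy : y 0 = 0) (α : Fin n) : kappa τ α y = 0 := by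
  simp [kappa, hy, Real.zero_rpow hτ.ne']

theorem powerExpr_self_of_zero (hτ : 0 < τ) (hy : y 0 = 0) (α β : Fin n) :
    powerExpr τ τ H α β y = if α = 0 ∧ β = 0 then ((H y ^ τ : ℝ) : ℂ) else 0 := by
  have h2 : (τ : ℂ) ≠ 0 := Complex.ofReal_ne_zero.2 hτ.ne'
  simp only [powerExpr, rho, kappa_eq_zero hτ hy, sub_self, Real.rpow_zero, zero_mul, mul_zero,
    zero_add, Complex.ofReal_one, mul_one]
  by_cases hα : α = 0 <;> by_cases hβ : β = 0 <;> simp [hα, hβ]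
  field_simp

/-- For σ > τ the factor |z₁|^{2σ-2τ} vanishes at the divisor, so the perturbation does not change
the limits there. -/
theorem powerExpr_of_zero (hστ : τ < σ) (hy : y 0 = 0) (α β : Fin n) :
    powerExpr τ σ H α β y = 0 := by
  have : (0 : ℝ) ^ (2 * σ - 2 * τ) = 0 := Real.zero_rpow (by linarith)
  simp [powerExpr, hy, this]

/-- The ε factor has modulus |z₁|^{1-τ}/τ, which tends to 0. So a smooth form retains in the limit
only its part along the divisor. -/
theorem tendsto_frameFactor (hτ : 0 < τ) (hτ1 : τ < 1) (hy : y 0 = 0) (α : Fin n) :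
    Tendsto (fun z => frameFactor τ z α) (𝓝[offZero n] y) (𝓝 (if α = 0 then 0 else 1)) := by
  by_cases hα : α = 0
  · simp only [frameFactor, if_pos hα]
    rw [tendsto_zero_iff_norm_tendsto_zero]
    have h1 : Continuous fun z : Cn n => ‖z 0‖ ^ (1 - τ) / τ :=
      ((contDiff_coord 0).continuous.norm.rpow_const fun _ => Or.inr (by linarith)).div_const _
    have h2 : Tendsto (fun z : Cn n => ‖z 0‖ ^ (1 - τ) / τ) (𝓝[offZero n] y) (𝓝 0) := by
      have := h1.tendsto y
      rw [hy, norm_zero, Real.zero_rpow (by linarith), zero_div] at this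
      exact this.mono_left nhdsWithin_le_nhds
    refine h2.congr' ?_
    filter_upwards [self_mem_nhdsWithin] with z hz
    have h0 : 0 < ‖z 0‖ := norm_pos_iff.2 hz
    rw [norm_div, Complex.norm_real, Real.norm_of_nonneg (by positivity), Real.rpow_sub h0,
      Real.rpow_one]
    field_simp
  · simp only [frameFactor, if_neg hα]
    exact tendsto_const_nhds

theorem tendsto_edgeCoeff (hτ : 0 < τ) (hτ1 : τ < 1) (hy : y 0 = 0)
    {G : Cn n → Matrix (Fin n) (Fin n) ℂ} {α β : Fin n} (hG : ContinuousAt (fun z => G z α β) y) :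
    Tendsto (fun z => edgeCoeff τ G z α β) (𝓝[offZero n] y)
      (𝓝 ((if α = 0 then 0 else 1) * G y α β * (if β = 0 then 0 else 1))) := by
  have h1 := (Complex.continuous_conj.tendsto _).comp (tendsto_frameFactor hτ hτ1 hy β)
  have h2 := ((tendsto_frameFactor hτ hτ1 hy α).mul
    (hG.tendsto.mono_left nhdsWithin_le_nhds)).mul h1
  have h3 : conj (if β = 0 then (0 : ℂ) else 1) = if β = 0 then 0 else 1 := by split_ifs <;> simp
  rw [h3] at h2
  exact h2

/-- The limit is block diagonal: b on the ε direction, and the restriction of G to the directions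
z₂, …, z_n. Either the truncated vector u is nonzero, or the first coordinate of v is. -/
theorem posDef_limit {G : Matrix (Fin n) (Fin n) ℂ} (hG : ∀ α β, G α β = conj (G β α))
    (hp : ∀ v : Cn n, v ≠ 0 → 0 < (sesq G v v).re) {b : ℝ} (hb : 0 < b) :
    (Matrix.of fun α β : Fin n => (if α = 0 then 0 else 1) * G α β * (if β = 0 then 0 else 1)
      + if α = 0 ∧ β = 0 then (b : ℂ) else 0).PosDef := by
  refine posDef_of_sesq_pos (fun α β => ?_) fun v hv => ?_
  · simp only [Matrix.of_apply, hG α β]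
    by_cases hα : α = 0 <;> by_cases hβ : β = 0 <;> simp [hα, hβ]
  · set u : Cn n := WithLp.toLp 2 fun α => if α = 0 then 0 else v α with hu
    have h1 : sesq (Matrix.of fun α β : Fin n => (if α = 0 then 0 else 1) * G α β *
        (if β = 0 then 0 else 1) + if α = 0 ∧ β = 0 then (b : ℂ) else 0) v v
        = sesq G u u + b * (v 0 * conj (v 0)) := by
      have h2 : ∑ α : Fin n, ∑ β : Fin n,
          (if α = 0 ∧ β = 0 then (b : ℂ) else 0) * v α * conj (v β) = b * (v 0 * conj (v 0)) := by
        rw [Finset.sum_eq_single 0, Finset.sum_eq_single 0]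
        · simp; ring
        · intro β _ hβ; simp [hβ]
        · simp
        · intro α _ hα; simp [hα]
        · simp
      rw [sesq_apply, sesq_apply, ← h2, ← Finset.sum_add_distrib]
      refine Finset.sum_congr rfl fun α _ => ?_
      rw [← Finset.sum_add_distrib]
      refine Finset.sum_congr rfl fun β _ => ?_
      simp only [Matrix.of_apply, hu]
      by_cases hα : α = 0 <;> by_cases hβ : β = 0 <;> simp [hα, hβ]
    rw [h1, Complex.mul_conj, Complex.normSq_eq_norm_sq, ← Complex.ofReal_mul, Complex.add_re,
      Complex.ofReal_re]
    by_cases hu0 : u = 0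
    · have hv0 : v 0 ≠ 0 := by
        intro h0
        apply hv
        ext α
        by_cases hα : α = 0
        · rw [hα, h0]; rfl
        · have := congrArg (fun w : Cn n => w α) hu0
          simpa [hu, hα] using this
      have : 0 < ‖v 0‖ := norm_pos_iff.2 hv0
      rw [hu0]
      simp only [map_zero, Complex.zero_re, zero_add]
      positivity
    · have := hp u hu0
      positivity

end EdgeFrame

/-! ### The forms `ω₀ + a dd^c |s|^{2τ} - c dd^c |s|^{2τ'}` -/

section EdgeMix

variable {n : ℕ} {M : Type*} [TopologicalSpace M] [ChartedSpace (Cn n) M] {D : Set M}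
  {N : M → ℝ} {e : OpenPartialHomeomorph M (Cn n)} {H : Cn n → ℝ} {y : Cn n} {ω₀ : FormField n M}

/-- The form `ω₀ + a dd^c N^τ - c dd^c N^τ'`. -/
def edgeMix (ω₀ : FormField n M) (N : M → ℝ) (τ τ' a c : ℝ) : FormField n M :=
  ω₀ + a • ddc (fun x => N x ^ τ) - c • ddc (fun x => N x ^ τ')

/-- The value c = 0 represents ω_τ, so one family covers both metrics. -/
theorem edgeMix_zero (ω₀ : FormField n M) (N : M → ℝ) (τ τ' a : ℝ) :
    edgeMix ω₀ N τ τ' a 0 = ω₀ + a • ddc (fun x => N x ^ τ) := by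
  funext x; ext v w
  change (ω₀ + a • ddc (fun x => N x ^ τ) : FormField n M) x v w
    - (0 : ℝ) • ddc (fun x => N x ^ τ') x v w = _
  rw [zero_smul, sub_zero]

theorem formVal_edgeMix (ω₀ : FormField n M) (N : M → ℝ) (τ τ' a c : ℝ) (x : M) (v w : Cn n) :
    formVal (edgeMix ω₀ N τ τ' a c) x v w = formVal (edgeMix ω₀ N τ τ' a 0) x v w
      - (c : ℂ) * formVal (ddc fun x => N x ^ τ') x v w := by
  rw [edgeMix_zero, ← Complex.real_smul]; rfl

theorem coeff_edgeMix (ω₀ : FormField n M) (N : M → ℝ) (τ τ' a c : ℝ) (e y) :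
    coeff (edgeMix ω₀ N τ τ' a c) e y = coeff ω₀ e y + (a : ℂ) • coeff (ddc fun x => N x ^ τ) e y
      - (c : ℂ) • coeff (ddc fun x => N x ^ τ') e y := by
  rw [edgeMix, coeff_sub, coeff_add, coeff_smul, coeff_smul]

theorem isClosedHermitian_edgeMix [IsManifold 𝓘(ℂ, Cn n) ω M] (hN : IsDivisorNorm n D N) (hω₀ : IsKaehlerOn ω₀ univ)
    (τ τ' a c : ℝ) : IsClosedHermitian (edgeMix ω₀ N τ τ' a c) Dᶜ := by
  have hU := hN.isClosed.isOpen_compl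
  have h := fun σ => isClosedHermitian_ddc hU (hN.smooth_rpow σ)
  exact ((hω₀.isClosedHermitian.mono (subset_univ _)).add ((h τ).smul hU a) hU).sub
    ((h τ').smul hU c) hU

variable [NeZero n]

theorem edgeCoeff_edgeMix (ω₀ : FormField n M) (N : M → ℝ) (τ τ' a c : ℝ)
    (e : OpenPartialHomeomorph M (Cn n)) (z : Cn n) (α β : Fin n) :
    edgeCoeff τ (coeff (edgeMix ω₀ N τ τ' a c) e) z α β = edgeCoeff τ (coeff ω₀ e) z α β
      + a * edgeCoeff τ (coeff (ddc fun x => N x ^ τ) e) z α β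
      - c * edgeCoeff τ (coeff (ddc fun x => N x ^ τ') e) z α β := by
  simp only [edgeCoeff_apply, coeff_edgeMix, Matrix.add_apply, Matrix.sub_apply, Matrix.smul_apply,
    smul_eq_mul]
  ring

variable [IsManifold 𝓘(ℂ, Cn n) ω M]

theorem sesq_coeff_edgeMix (hN : IsDivisorNorm n D N) (he : IsAdapted D e)
    (hH : ContDiffOn ℝ ∞ H e.target) (hpos : ∀ z ∈ e.target, 0 < H z)
    (hNH : ∀ z ∈ e.target, N (e.symm z) = ‖z 0‖ ^ 2 * H z) (τ τ' a c : ℝ)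
    (hy : y ∈ e.target ∩ offZero n) (v w : Cn n) :
    sesq (coeff (edgeMix ω₀ N τ τ' a c) e y) v w = sesq (coeff ω₀ e y) v w
      + ((expDiff a c τ τ' 1 (logN H y) : ℂ) * levi (logN H) v w y
      + (expDiff a c τ τ' 2 (logN H y) : ℂ) * (del (logN H) v y * conj (del (logN H) w y))) := by
  rw [coeff_edgeMix, sub_eq_add_neg, ← neg_smul, sesq_add, sesq_add, sesq_smul, sesq_smul,
    sesq_coeff_ddc_rpow hN he hH hpos hNH τ hy, sesq_coeff_ddc_rpow hN he hH hpos hNH τ' hy]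
  simp only [expDiff]
  push_cast
  ring

theorem edgeCoeff_ddc_rpow (hN : IsDivisorNorm n D N) (he : IsAdapted D e)
    (hH : ContDiffOn ℝ ∞ H e.target) (hpos : ∀ z ∈ e.target, 0 < H z)
    (hNH : ∀ z ∈ e.target, N (e.symm z) = ‖z 0‖ ^ 2 * H z) {τ : ℝ} (hτ : 0 < τ) (σ : ℝ)
    (hy : y ∈ e.target ∩ offZero n) (α β : Fin n) :
    edgeCoeff τ (coeff (ddc fun x => N x ^ σ) e) y α β = powerExpr τ σ H α β y :=
  edgeCoeff_eq_powerExpr hτ e.open_target hH hpos hy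
    (fun v w => sesq_coeff_ddc_rpow hN he hH hpos hNH σ hy v w) α β

theorem tendsto_edgeCoeff_ddc_rpow (hN : IsDivisorNorm n D N) (he : IsAdapted D e)
    (hH : ContDiffOn ℝ ∞ H e.target) (hpos : ∀ z ∈ e.target, 0 < H z)
    (hNH : ∀ z ∈ e.target, N (e.symm z) = ‖z 0‖ ^ 2 * H z) {τ σ : ℝ} (hτ : 0 < τ) (hσ : τ ≤ σ)
    (hy : y ∈ e.target) (α β : Fin n) :
    Tendsto (fun z => edgeCoeff τ (coeff (ddc fun x => N x ^ σ) e) z α β) (𝓝[offZero n] y)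
      (𝓝 (powerExpr τ σ H α β y)) := by
  have h1 := ((continuousOn_powerExpr hτ hσ e.open_target hH hpos α β).continuousAt
    (e.open_target.mem_nhds hy)).tendsto.mono_left (nhdsWithin_le_nhds (s := offZero n))
  refine h1.congr' ?_
  filter_upwards [self_mem_nhdsWithin, nhdsWithin_le_nhds (e.open_target.mem_nhds hy)] with z h0 hz
  exact (edgeCoeff_ddc_rpow hN he hH hpos hNH hτ σ ⟨hz, h0⟩ α β).symm

/-- Closedness and the limits at D hold for every c and every a > 0. Only positivity and the
comparison with the model depend on smallness, and these are left as hypotheses. -/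
theorem isEdgeConeKaehler_edgeMix (hN : IsDivisorNorm n D N) (hω₀ : IsKaehlerOn ω₀ univ)
    {τ τ' a c : ℝ} (hτ : 0 < τ) (hττ' : τ < τ') (hτ1 : τ < 1) (ha : 0 < a)
    (hp : ∀ x ∈ Dᶜ, ∀ v : Cn n, v ≠ 0 → 0 < (formVal (edgeMix ω₀ N τ τ' a c) x v v).re)
    (hm : ∀ e, IsAdapted D e → ∀ K ⊆ e.source, IsCompact K →
      ∃ C : ℝ, 0 < C ∧ ∀ y ∈ e.target, e.symm y ∈ K → e.symm y ∉ D → ∀ v : Cn n,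
        C⁻¹ * (sesq (modelEdge τ y) v v).re ≤ (sesq (coeff (edgeMix ω₀ N τ τ' a c) e y) v v).re ∧
        (sesq (coeff (edgeMix ω₀ N τ τ' a c) e y) v v).re ≤ C * (sesq (modelEdge τ y) v v).re) :
    IsEdgeConeKaehler D τ (edgeMix ω₀ N τ τ' a c) where
  kaehler := (isClosedHermitian_edgeMix hN hω₀ τ τ' a c).isKaehlerOn hp
  model_equiv := hm
  asymptotic e he := by
    obtain ⟨H, hH, hpos, hNH⟩ := exists_factor hN he
    have hs := fun α β => (hω₀.smooth e he.1 α β).mono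
      fun z (hz : z ∈ e.target) => (⟨hz, mem_univ _⟩ : z ∈ e.target ∩ e.symm ⁻¹' univ)
    refine ⟨fun y => Matrix.of fun α β : Fin n => (if α = 0 then 0 else 1) * coeff ω₀ e y α β *
      (if β = 0 then 0 else 1) + if α = 0 ∧ β = 0 then ((a * H y ^ τ : ℝ) : ℂ) else 0,
      fun α β => ?_, fun y hy hy0 => ⟨?_, ?_, fun α β => ?_⟩⟩
    · refine ((contDiffOn_const.mul (hs α β)).mul contDiffOn_const).add ?_
      split_ifs
      · refine contDiffOn_ofReal (contDiffOn_const.mul ?_)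
        exact hH.rpow_const_of_ne fun z hz => (hpos z hz).ne'
      · exact contDiffOn_const
    · exact posDef_limit (fun α β => hω₀.isClosedHermitian.coeff_conj (mem_univ _) α β)
        (fun v hv => hω₀.sesq_pos he.1 hy (mem_univ _) hv)
        (mul_pos ha (Real.rpow_pos_of_pos (hpos y hy) _))
    · intro α hα
      simp [hα]
    · have h1 := tendsto_edgeCoeff hτ hτ1 hy0
        (((hs α β).continuousOn.continuousAt (e.open_target.mem_nhds hy)))
      have h2 := tendsto_edgeCoeff_ddc_rpow hN he hH hpos hNH hτ le_rfl hy α β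
      have h3 := tendsto_edgeCoeff_ddc_rpow hN he hH hpos hNH hτ hττ'.le hy α β
      rw [powerExpr_self_of_zero hτ hy0] at h2
      rw [powerExpr_of_zero hττ' hy0] at h3
      have h4 := (h1.add (h2.const_mul (a : ℂ))).sub (h3.const_mul (c : ℂ))
      simp only [edgeCoeff_edgeMix, Matrix.of_apply]
      have h5 : ((a : ℂ) * if α = 0 ∧ β = 0 then ((H y ^ τ : ℝ) : ℂ) else 0)
          = if α = 0 ∧ β = 0 then ((a * H y ^ τ : ℝ) : ℂ) else 0 := by
        split_ifs <;> simp
      rw [mul_zero, sub_zero, h5] at h4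
      exact h4

end EdgeMix

/-! ### Positivity and comparison of the edge metrics -/

section Compact

variable {n : ℕ} {M : Type*} [TopologicalSpace M] {e : OpenPartialHomeomorph M (Cn n)}

theorem isCompact_chart_image (e : OpenPartialHomeomorph M (Cn n)) {K : Set M} (hK : IsCompact K)
    (hKe : K ⊆ e.source) : IsCompact (e.target ∩ e.symm ⁻¹' K) := by
  rw [← e.image_eq_target_inter_inv_preimage hKe]
  exact hK.image_of_continuousOn (e.continuousOn.mono hKe)

variable [ChartedSpace (Cn n) M] {ω₀ : FormField n M} {D : Set M} {N : M → ℝ}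

theorem IsKaehlerOn.contDiffOn_coeff (h : IsKaehlerOn ω₀ univ) (he : e ∈ holoCharts n M)
    (α β : Fin n) : ContDiffOn ℝ ∞ (fun y => coeff ω₀ e y α β) e.target :=
  (h.smooth e he α β).mono fun _ hz => ⟨hz, mem_univ _⟩

theorem IsKaehlerOn.exists_le_normSq (h : IsKaehlerOn ω₀ univ) (he : e ∈ holoCharts n M)
    {S : Set (Cn n)} (hS : IsCompact S) (hSe : S ⊆ e.target) :
    ∃ C : ℝ, 0 ≤ C ∧ ∀ y ∈ S, ∀ v, (sesq (coeff ω₀ e y) v v).re ≤ C * ‖v‖ ^ 2 := by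
  obtain ⟨C, hC, h⟩ := exists_formBound e.open_target hS hSe (h.contDiffOn_coeff he)
  refine ⟨C, hC, fun y hy v => ?_⟩
  have := (h y hy).val v v
  rw [pow_two]
  exact (Complex.re_le_norm _).trans this

theorem IsKaehlerOn.formVal_nonneg {U : Set M} (h : IsKaehlerOn ω₀ U) {x : M} (hx : x ∈ U)
    (v : Cn n) : 0 ≤ (formVal ω₀ x v v).re := by
  by_cases hv : v = 0
  · rw [hv, formVal]
    erw [map_zero]
    simp
  · exact (h.pos x hx v hv).le

variable [IsManifold 𝓘(ℂ, Cn n) ω M]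

theorem IsKaehlerOn.exists_normSq_le (h : IsKaehlerOn ω₀ univ) (he : e ∈ holoCharts n M)
    {S : Set (Cn n)} (hS : IsCompact S) (hSe : S ⊆ e.target) :
    ∃ C : ℝ, 0 < C ∧ ∀ y ∈ S, ∀ v, ‖v‖ ^ 2 ≤ C * (sesq (coeff ω₀ e y) v v).re :=
  exists_sesq_lower_bound hS (fun α β => (h.contDiffOn_coeff he α β).continuousOn.mono hSe)
    fun _ hy _ hv => h.sesq_pos he (hSe hy) (mem_univ _) hv

theorem IsDivisorNorm.exists_log_le [CompactSpace M] (hN : IsDivisorNorm n D N) :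
    ∃ t₀ : ℝ, ∀ x, x ∉ D → Real.log (N x) ≤ t₀ := by
  obtain ⟨B, hB⟩ := isCompact_univ.exists_bound_of_continuousOn hN.smooth.continuous.continuousOn
  refine ⟨Real.log B, fun x hx => Real.log_le_log (hN.pos hx) ?_⟩
  exact (le_abs_self _).trans (hB x (mem_univ _))

variable [NeZero n]

theorem EdgeAtlas.exists_chart_vector (A : EdgeAtlas n D) (x : M) (v : Cn n) :
    ∃ (e : OpenPartialHomeomorph M (Cn n)) (y u : Cn n), IsAdapted D e ∧ y ∈ e.target ∧
      e.symm y = x ∧ jac e y u = v := by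
  obtain ⟨i, hi⟩ := A.exists_mem_core x
  have hxs := A.core_subset i hi
  obtain ⟨u, hu⟩ := jac_surjective (A.adapted i).1 ((A.chart i).map_source hxs) v
  exact ⟨_, _, u, A.adapted i, (A.chart i).map_source hxs, (A.chart i).left_inv hxs, hu⟩

end Compact

/-! ### Domination of dd^c log |s|² and dd^c |s|^{2τ'}, and the edge-cone property for small 𝔞. -/

section Comparison

variable {n : ℕ} [NeZero n] {M : Type*} [TopologicalSpace M] [ChartedSpace (Cn n) M] {D : Set M}
  {N : M → ℝ} {e : OpenPartialHomeomorph M (Cn n)} {H : Cn n → ℝ} {y : Cn n} {ω₀ : FormField n M}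

theorem IsAdapted.mem_target_inter (he : IsAdapted D e) (hy : y ∈ e.target) (hD : e.symm y ∉ D) :
    y ∈ e.target ∩ offZero n := ⟨hy, fun h => hD ((he.mem_iff hy).2 h)⟩

variable [IsManifold 𝓘(ℂ, Cn n) ω M]

theorem re_sesq_coeff_edgeMix (hN : IsDivisorNorm n D N) (he : IsAdapted D e)
    (hH : ContDiffOn ℝ ∞ H e.target) (hpos : ∀ z ∈ e.target, 0 < H z)
    (hNH : ∀ z ∈ e.target, N (e.symm z) = ‖z 0‖ ^ 2 * H z) (τ τ' a : ℝ)
    (hy : y ∈ e.target ∩ offZero n) (v : Cn n) :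
    (sesq (coeff (edgeMix ω₀ N τ τ' a 0) e y) v v).re = (sesq (coeff ω₀ e y) v v).re
      + (a * τ * (Real.exp (τ * logN H y) * (levi (logN H) v v y).re)
      + a * τ ^ 2 * (Real.exp (τ * logN H y) * ‖del (logN H) v y‖ ^ 2)) := by
  rw [sesq_coeff_edgeMix hN he hH hpos hNH _ _ _ _ hy, Complex.add_re, Complex.add_re,
    Complex.re_ofReal_mul, Complex.mul_conj, ← Complex.ofReal_mul, Complex.ofReal_re,
    Complex.normSq_eq_norm_sq]
  simp only [expDiff]
  ring

theorem re_sesq_coeff_ddc_rpow (hN : IsDivisorNorm n D N) (he : IsAdapted D e)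
    (hH : ContDiffOn ℝ ∞ H e.target) (hpos : ∀ z ∈ e.target, 0 < H z)
    (hNH : ∀ z ∈ e.target, N (e.symm z) = ‖z 0‖ ^ 2 * H z) (σ : ℝ)
    (hy : y ∈ e.target ∩ offZero n) (v : Cn n) :
    (sesq (coeff (ddc fun x => N x ^ σ) e y) v v).re = Real.exp (σ * logN H y) *
      (σ * (levi (logN H) v v y).re + σ ^ 2 * ‖del (logN H) v y‖ ^ 2) := by
  rw [sesq_coeff_ddc_rpow hN he hH hpos hNH σ hy, Complex.re_ofReal_mul, Complex.add_re,
    Complex.re_ofReal_mul, Complex.mul_conj, ← Complex.ofReal_pow, ← Complex.ofReal_mul,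
    Complex.ofReal_re, Complex.normSq_eq_norm_sq]

theorem exists_levi_logN_le {U S : Set (Cn n)} (hU : IsOpen U) (hS : IsCompact S) (hSU : S ⊆ U)
    (hH : ContDiffOn ℝ ∞ H U) (hpos : ∀ z ∈ U, 0 < H z) :
    ∃ C : ℝ, 0 ≤ C ∧ ∀ y ∈ S ∩ offZero n, ∀ v, |(levi (logN H) v v y).re| ≤ C * ‖v‖ ^ 2 := by
  obtain ⟨C, hC, h⟩ := exists_levi_formBound hU hS hSU (contDiffOn_logH hH hpos)
  refine ⟨C, hC, fun y hy v => ?_⟩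
  rw [levi_logN hU hH hpos ⟨hSU hy.1, hy.2⟩, pow_two]
  exact (Complex.abs_re_le_norm _).trans ((h y hy.1).val v v)

/-- Off D this form is, up to sign, a curvature form of the line bundle and has no singularity along
D. In charts its coefficients are those of the Levi form of the smooth function log H, bounded on
compact sets. -/
theorem EdgeAtlas.exists_ddc_log_le (A : EdgeAtlas n D) (hN : IsDivisorNorm n D N)
    (hω₀ : IsKaehlerOn ω₀ univ) :
    ∃ C : ℝ, 0 < C ∧ ∀ x, x ∉ D → ∀ v : Cn n,
      |(formVal (ddc fun x => Real.log (N x)) x v v).re| ≤ C * (formVal ω₀ x v v).re := by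
  refine A.exists_form_le (fun x _ v => hω₀.formVal_nonneg (mem_univ x) v) fun i => ?_
  set e := A.chart i
  have he : IsAdapted D e := A.adapted i
  obtain ⟨H, hH, hpos, hNH⟩ := exists_factor hN he
  have hS := isCompact_chart_image e (A.core_compact i) (A.core_subset i)
  obtain ⟨C₁, h₁, B₁⟩ := exists_levi_logN_le e.open_target hS inter_subset_left hH hpos
  obtain ⟨C₂, h₂, B₂⟩ := hω₀.exists_normSq_le he.1 hS inter_subset_left
  refine ⟨C₁ * C₂, fun y hy hyK hyD v => ?_⟩
  have hyo := he.mem_target_inter hy hyD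
  rw [sesq_coeff_ddc_log hN he hNH hyo]
  calc _ ≤ C₁ * ‖v‖ ^ 2 := B₁ y ⟨⟨hy, hyK⟩, hyo.2⟩ v
    _ ≤ C₁ * (C₂ * (sesq (coeff ω₀ e y) v v).re) :=
      mul_le_mul_of_nonneg_left (B₂ y ⟨hy, hyK⟩ v) h₁
    _ = _ := by ring

theorem abs_levi_logN_le (hN : IsDivisorNorm n D N) (he : IsAdapted D e)
    (hNH : ∀ z ∈ e.target, N (e.symm z) = ‖z 0‖ ^ 2 * H z) {C : ℝ}
    (hC : ∀ x, x ∉ D → ∀ v : Cn n,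
      |(formVal (ddc fun x => Real.log (N x)) x v v).re| ≤ C * (formVal ω₀ x v v).re)
    (hy : y ∈ e.target) (hyD : e.symm y ∉ D) (v : Cn n) :
    |(levi (logN H) v v y).re| ≤ C * (sesq (coeff ω₀ e y) v v).re := by
  rw [← sesq_coeff_ddc_log hN he hNH (he.mem_target_inter hy hyD), sesq_coeff _ he.1 hy,
    sesq_coeff _ he.1 hy]
  exact hC _ hyD _

theorem abs_small_term_le {a τ x Λ Ω C R : ℝ} (ha : 0 ≤ a) (hτ : 0 ≤ τ) (hτ1 : τ ≤ 1) (hx : 0 ≤ x)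
    (hΩ : 0 ≤ Ω) (hxR : x ≤ R) (hΛ : |Λ| ≤ C * Ω) (h : a * (R * C) ≤ 1 / 2) :
    |a * τ * (x * Λ)| ≤ 1 / 2 * Ω := by
  rw [abs_mul (a * τ), abs_mul x, abs_of_nonneg (mul_nonneg ha hτ), abs_of_nonneg hx]
  calc a * τ * (x * |Λ|) ≤ a * 1 * (R * (C * Ω)) := by gcongr; exact hx.trans hxR
    _ = a * (R * C) * Ω := by ring
    _ ≤ _ := mul_le_mul_of_nonneg_right h hΩ

/-- The form `ω₀ + a dd^c |s|^{2τ}` is an edge-cone metric for small `a`. -/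
theorem exists_isEdgeConeKaehler [T2Space M] [CompactSpace M] (hN : IsDivisorNorm n D N)
    (hω₀ : IsKaehlerOn ω₀ univ) {τ τ' : ℝ} (hτ : 0 < τ) (hττ' : τ < τ') (hτ1 : τ < 1) :
    ∃ a₀ : ℝ, 0 < a₀ ∧ ∀ a, 0 < a → a < a₀ → IsEdgeConeKaehler D τ (edgeMix ω₀ N τ τ' a 0) := by
  obtain ⟨A⟩ := exists_edgeAtlas hN
  obtain ⟨C, hC, hlog⟩ := A.exists_ddc_log_le hN hω₀
  obtain ⟨t₀, ht₀⟩ := hN.exists_log_le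
  set R := Real.exp (τ * t₀) with hR
  have hR0 : 0 < R := Real.exp_pos _
  -- Here R bounds |s|^{2τ} and C bounds ±dd^c log |s|² by ω₀, so below this value the Levi term is
  -- at most half of ω₀.
  refine ⟨1 / (2 * (R * C)), by positivity, fun a ha haa => ?_⟩
  have hsmall : a * (R * C) ≤ 1 / 2 := by
    rw [lt_div_iff₀ (by positivity)] at haa
    linarith
  have hΩ : ∀ (e : OpenPartialHomeomorph M (Cn n)) (y v : Cn n), IsAdapted D e → y ∈ e.target →
      0 ≤ (sesq (coeff ω₀ e y) v v).re := by
    intro e y v he hy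
    rw [sesq_coeff _ he.1 hy]
    exact hω₀.formVal_nonneg (mem_univ _) _
  -- Up to half of ω₀, the form is ω₀ plus the nonnegative rank one term. Positivity and both
  -- comparisons with the model follow from this.
  have key : ∀ (e : OpenPartialHomeomorph M (Cn n)) (H : Cn n → ℝ) (y v : Cn n), IsAdapted D e →
      ContDiffOn ℝ ∞ H e.target → (∀ z ∈ e.target, 0 < H z) →
      (∀ z ∈ e.target, N (e.symm z) = ‖z 0‖ ^ 2 * H z) → y ∈ e.target → e.symm y ∉ D →
      |(sesq (coeff (edgeMix ω₀ N τ τ' a 0) e y) v v).re - (sesq (coeff ω₀ e y) v v).re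
        - a * τ ^ 2 * (Real.exp (τ * logN H y) * ‖del (logN H) v y‖ ^ 2)|
        ≤ 1 / 2 * (sesq (coeff ω₀ e y) v v).re := by
    intro e H y v he hH hpos hNH hy hyD
    rw [re_sesq_coeff_edgeMix hN he hH hpos hNH τ τ' a (he.mem_target_inter hy hyD)]
    have h1 : Real.exp (τ * logN H y) ≤ R := by
      rw [hR, Real.exp_le_exp, logN, ← hNH y hy]
      exact mul_le_mul_of_nonneg_left (ht₀ _ hyD) hτ.le
    have h2 := abs_small_term_le ha.le hτ.le hτ1.le (Real.exp_nonneg _) (hΩ e y v he hy) h1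
      (abs_levi_logN_le hN he hNH hlog hy hyD v) hsmall
    convert h2 using 2
    ring
  refine isEdgeConeKaehler_edgeMix hN hω₀ hτ hττ' hτ1 ha (fun x hx v hv => ?_)
    fun e he K hKe hK => ?_
  · obtain ⟨e, y, u, he, hy, rfl, rfl⟩ := A.exists_chart_vector x v
    obtain ⟨H, hH, hpos, hNH⟩ := exists_factor hN he
    have hu : u ≠ 0 := by
      rintro rfl
      simp at hv
    have h1 := (abs_le.1 (key e H y u he hH hpos hNH hy hx)).1
    have h2 := hω₀.sesq_pos he.1 hy (mem_univ _) hu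
    rw [← sesq_coeff _ he.1 hy]
    have h3 : 0 ≤ a * τ ^ 2 * (Real.exp (τ * logN H y) * ‖del (logN H) u y‖ ^ 2) := by positivity
    linarith
  · obtain ⟨H, hH, hpos, hNH⟩ := exists_factor hN he
    have hS := isCompact_chart_image e hK hKe
    obtain ⟨C₁, h₁, B₁⟩ := exists_model_le_edgeSq e.open_target hS inter_subset_left hH hpos hτ
    obtain ⟨C₂, h₂, B₂⟩ := hω₀.exists_normSq_le he.1 hS inter_subset_left
    obtain ⟨C₃, h₃, B₃⟩ := hω₀.exists_le_normSq he.1 hS inter_subset_left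
    obtain ⟨C₄, h₄, B₄⟩ :=
      exists_edgeSq_le_model e.open_target hS inter_subset_left hH hpos hτ hτ1
    set c₁ := C₁ * (2 * C₂ + 1 / (a * τ ^ 2)) with hc₁
    set c₂ := (2 * C₃ + a * τ ^ 2) * C₄ with hc₂
    have hc₁0 : 0 ≤ c₁ := by positivity
    have hc₂0 : 0 ≤ c₂ := by positivity
    refine ⟨c₁ + c₂ + 1, by positivity, fun y hy hyK hyD v => ?_⟩
    have hyS : y ∈ (e.target ∩ e.symm ⁻¹' K) ∩ offZero n :=
      ⟨⟨hy, hyK⟩, (he.mem_target_inter hy hyD).2⟩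
    have h5 := abs_le.1 (key e H y v he hH hpos hNH hy hyD)
    have hm := B₁ y hyS v
    have he4 := B₄ y hyS v
    have h2 := B₂ y hyS.1 v
    have h3 := B₃ y hyS.1 v
    have hΩ0 := hΩ e y v he hy
    rw [edgeSq] at hm he4
    set X := (sesq (coeff (edgeMix ω₀ N τ τ' a 0) e y) v v).re
    set Ω := (sesq (coeff ω₀ e y) v v).re
    set m := (sesq (modelEdge τ y) v v).re
    set P := Real.exp (τ * logN H y) * ‖del (logN H) v y‖ ^ 2
    have hP0 : 0 ≤ P := by positivity
    have haτ : 0 < a * τ ^ 2 := by positivity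
    have hX0 : 0 ≤ X := by linarith [mul_nonneg haτ.le hP0]
    have hm0 : 0 ≤ C₄ * m := by linarith [sq_nonneg ‖v‖]
    have l1 : m ≤ c₁ * X := by
      have i1 : Ω ≤ 2 * X := by linarith [mul_nonneg haτ.le hP0]
      have i2 : P ≤ 1 / (a * τ ^ 2) * X := by
        rw [one_div, ← div_eq_inv_mul, le_div_iff₀ haτ]
        linarith
      have i3 := mul_le_mul_of_nonneg_left i1 h₂.le
      have i4 := mul_le_mul_of_nonneg_left (show ‖v‖ ^ 2 + P ≤ (2 * C₂ + 1 / (a * τ ^ 2)) * X by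
        linarith) h₁
      rw [hc₁, mul_assoc]
      exact hm.trans i4
    have l2 : X ≤ c₂ * m := by
      have i1 : X ≤ 2 * Ω + a * τ ^ 2 * P := by linarith
      have i2 : 0 ≤ 2 * C₃ * P := by positivity
      have i3 : 0 ≤ a * τ ^ 2 * ‖v‖ ^ 2 := by positivity
      have i4 := mul_le_mul_of_nonneg_left he4 (show 0 ≤ 2 * C₃ + a * τ ^ 2 by positivity)
      rw [hc₂]
      linarith
    have hm1 : 0 ≤ m := by
      rw [show m = _ from sesq_modelEdge τ y v]
      positivity
    constructor
    · rw [inv_mul_le_iff₀ (by positivity)]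
      linarith [mul_nonneg hc₂0 hX0]
    · linarith [mul_nonneg hc₁0 hm1]

/-- Domination of `dd^c |s|^{2τ'}` by an edge-cone metric of angle `τ < τ'`. -/
theorem EdgeAtlas.exists_ddc_rpow_le [CompactSpace M] (A : EdgeAtlas n D)
    (hN : IsDivisorNorm n D N) {g : FormField n M} {τ τ' : ℝ} (hτ : 0 < τ) (hττ' : τ < τ')
    (hτ' : τ' < 1) (hg : IsEdgeConeKaehler D τ g) :
    ∃ C : ℝ, 0 < C ∧ ∀ x, x ∉ D → ∀ v : Cn n,
      |(formVal (ddc fun x => N x ^ τ') x v v).re| ≤ C * (formVal g x v v).re := by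
  refine A.exists_form_le (fun x hx v => hg.kaehler.formVal_nonneg hx v) fun i => ?_
  set e := A.chart i
  have he : IsAdapted D e := A.adapted i
  obtain ⟨H, hH, hpos, hNH⟩ := exists_factor hN he
  have hS := isCompact_chart_image e (A.core_compact i) (A.core_subset i)
  obtain ⟨C₁, h₁, B₁⟩ := exists_levi_logN_le e.open_target hS inter_subset_left hH hpos
  obtain ⟨C₂, h₂, B₂⟩ :=
    exists_edgeSq_le_model e.open_target hS inter_subset_left hH hpos hτ (hττ'.trans hτ')
  obtain ⟨C₃, h₃, B₃⟩ := hg.model_equiv e he _ (A.core_subset i) (A.core_compact i)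
  obtain ⟨t₀, ht₀⟩ := hN.exists_log_le
  have hτ'0 := hτ.trans hττ'
  set R := Real.exp (τ' * t₀)
  set R' := Real.exp ((τ' - τ) * t₀)
  have hR : 0 < R := Real.exp_pos _
  have hR' : 0 < R' := Real.exp_pos _
  refine ⟨(R * C₁ + R') * C₂ * C₃, fun y hy hyK hyD v => ?_⟩
  have hyo := he.mem_target_inter hy hyD
  have hyS : y ∈ (e.target ∩ e.symm ⁻¹' A.core i) ∩ offZero n := ⟨⟨hy, hyK⟩, hyo.2⟩
  have hl : logN H y ≤ t₀ := by
    rw [logN, ← hNH y hy]; exact ht₀ _ hyD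
  have hE1 : Real.exp (τ' * logN H y) ≤ R :=
    Real.exp_le_exp.2 (mul_le_mul_of_nonneg_left hl hτ'0.le)
  have hE2 : Real.exp (τ' * logN H y) ≤ R' * Real.exp (τ * logN H y) :=
    exp_mul_le_exp_mul hττ'.le hl
  rw [re_sesq_coeff_ddc_rpow hN he hH hpos hNH τ' hyo]
  have hL := B₁ y hyS v
  have hM := B₂ y hyS v
  have hG := (B₃ y hy hyK hyD v).1
  rw [inv_mul_le_iff₀ h₃] at hG
  rw [edgeSq] at hM
  set E := Real.exp (τ' * logN H y)
  set E₀ := Real.exp (τ * logN H y)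
  set p := ‖del (logN H) v y‖ ^ 2
  set Λ := (levi (logN H) v v y).re
  set m := (sesq (modelEdge τ y) v v).re
  have hE0 : 0 ≤ E := Real.exp_nonneg _
  have hE00 : 0 ≤ E₀ := Real.exp_nonneg _
  have hp : 0 ≤ p := by positivity
  calc |E * (τ' * Λ + τ' ^ 2 * p)| ≤ E * (|Λ| + p) := by
        rw [abs_mul, abs_of_nonneg hE0]
        refine mul_le_mul_of_nonneg_left ((abs_add_le _ _).trans (add_le_add ?_ ?_)) hE0
        · rw [abs_mul, abs_of_pos hτ'0]
          exact mul_le_of_le_one_left (abs_nonneg _) hτ'.le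
        · rw [abs_of_nonneg (by positivity)]
          exact mul_le_of_le_one_left hp (pow_le_one₀ hτ'0.le hτ'.le)
    -- The same exponential is bounded in two ways: by a constant against the Levi form, and by R'
    -- e^{τφ}, using τ < τ', against the singular term.
    _ ≤ R * (C₁ * ‖v‖ ^ 2) + R' * E₀ * p := by
        rw [mul_add]
        exact add_le_add (mul_le_mul hE1 hL (abs_nonneg _) hR.le)
          (mul_le_mul_of_nonneg_right hE2 hp)
    _ ≤ (R * C₁ + R') * (‖v‖ ^ 2 + E₀ * p) := by
        have i1 : 0 ≤ R * C₁ * (E₀ * p) := by positivity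
        have i2 : 0 ≤ R' * ‖v‖ ^ 2 := by positivity
        linarith
    _ ≤ (R * C₁ + R') * (C₂ * (C₃ * (sesq (coeff g e y) v v).re)) := by
        refine mul_le_mul_of_nonneg_left (hM.trans (mul_le_mul_of_nonneg_left hG h₂)) (by positivity)
    _ = _ := by ring

end Comparison

/-! ### The lower bound of the bisectional curvature -/

section Curvature

variable {n : ℕ} {M : Type*} [TopologicalSpace M] [ChartedSpace (Cn n) M] {D : Set M}
  {N : M → ℝ} {e : OpenPartialHomeomorph M (Cn n)} {ω₀ g g' : FormField n M}

/-- Two-sided bounds under a small perturbation by a dominated form. -/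
theorem formVal_edgeMix_bounds {τ τ' a c C : ℝ}
    (hC : ∀ x, x ∉ D → ∀ v : Cn n, |(formVal (ddc fun x => N x ^ τ') x v v).re|
      ≤ C * (formVal (edgeMix ω₀ N τ τ' a 0) x v v).re)
    (hg : IsKaehlerOn (edgeMix ω₀ N τ τ' a 0) Dᶜ) (hc : 0 ≤ c) (hcC : c * C ≤ 1 / 2) {x : M}
    (hx : x ∉ D) (v : Cn n) :
    1 / 2 * (formVal (edgeMix ω₀ N τ τ' a 0) x v v).re
        ≤ (formVal (edgeMix ω₀ N τ τ' a c) x v v).re ∧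
      (formVal (edgeMix ω₀ N τ τ' a c) x v v).re
        ≤ 2 * (formVal (edgeMix ω₀ N τ τ' a 0) x v v).re := by
  have h0 := hg.formVal_nonneg hx v
  have h1 := mul_le_mul_of_nonneg_left (hC x hx v) hc
  have h2 := mul_le_mul_of_nonneg_right hcC h0
  rw [formVal_edgeMix ω₀ N τ τ' a c, Complex.sub_re, Complex.re_ofReal_mul]
  have h3 := abs_le.1 (show |c * (formVal (ddc fun x => N x ^ τ') x v v).re|
    ≤ 1 / 2 * (formVal (edgeMix ω₀ N τ τ' a 0) x v v).re by
      rw [abs_mul, abs_of_nonneg hc]; linarith)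
  constructor <;> linarith [h3.1, h3.2]

variable [NeZero n] [IsManifold 𝓘(ℂ, Cn n) ω M]

/-- In an adapted chart and over a compact set, the curvature estimate in terms of the metric. -/
theorem exists_discHessian_le [CompactSpace M] (hN : IsDivisorNorm n D N)
    (hω₀ : IsKaehlerOn ω₀ univ) {τ τ' a c : ℝ} (hτ : 0 < τ) (hττ' : τ < τ') (hτ' : τ' < 1)
    (ha : 0 < a) (hc : 0 < c) {t₀ : ℝ} (ht₀ : ∀ x, x ∉ D → Real.log (N x) ≤ t₀)
    (hct : c * τ' ^ 2 * Real.exp ((τ' - τ) * t₀) ≤ a * τ ^ 2 / 2)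
    (hg : IsEdgeConeKaehler D τ (edgeMix ω₀ N τ τ' a c)) (he : IsAdapted D e) {K : Set M}
    (hKe : K ⊆ e.source) (hK : IsCompact K) :
    ∃ C : ℝ, 0 ≤ C ∧ ∀ y ∈ e.target, e.symm y ∈ K → e.symm y ∉ D → ∀ v w : Cn n, ∃ b,
      discHessian (coeff (edgeMix ω₀ N τ τ' a c) e) y v w b
        ≤ C * ((sesq (coeff (edgeMix ω₀ N τ τ' a c) e y) v v).re
          * (sesq (coeff (edgeMix ω₀ N τ τ' a c) e y) w w).re) := by
  obtain ⟨H, hH, hpos, hNH⟩ := exists_factor hN he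
  have hS := isCompact_chart_image e hK hKe
  have hl : ∀ y ∈ e.target, e.symm y ∉ D → logN H y ≤ t₀ := fun y hy hyD => by
    rw [logN, ← hNH y hy]; exact ht₀ _ hyD
  obtain ⟨C₁, h₁, B₁⟩ := discHessian_edge_le e.open_target hS inter_subset_left hH hpos ha hc hτ
    hττ' hτ' (g := coeff (edgeMix ω₀ N τ τ' a c) e) (fun α β => hω₀.contDiffOn_coeff he.1 α β)
    -- The smallness of c, stated at the upper bound t₀ of log N, gives c τ'² e^{τ't} ≤ a τ²
    -- e^{τt}/2 for all t ≤ t₀.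
    (fun y hy v w => sesq_coeff_edgeMix hN he hH hpos hNH τ τ' a c hy v w) (by
      intro z hz
      have hzD : e.symm z ∉ D := fun h => hz.2 ((he.mem_iff hz.1.1).1 h)
      have h1 := mul_le_mul_of_nonneg_left
        (exp_mul_le_exp_mul hττ'.le (hl z hz.1.1 hzD)) (show 0 ≤ c * τ' ^ 2 by positivity)
      have h2 := mul_le_mul_of_nonneg_right hct (Real.exp_nonneg (τ * logN H z))
      linarith)
  obtain ⟨C₂, h₂, B₂⟩ :=
    exists_edgeSq_le_model e.open_target hS inter_subset_left hH hpos hτ (hττ'.trans hτ')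
  obtain ⟨C₃, h₃, B₃⟩ := hg.model_equiv e he K hKe hK
  refine ⟨C₁ * (C₂ * C₃) ^ 2, by positivity, fun y hy hyK hyD v w => ?_⟩
  have hyS : y ∈ (e.target ∩ e.symm ⁻¹' K) ∩ offZero n :=
    ⟨⟨hy, hyK⟩, (he.mem_target_inter hy hyD).2⟩
  have hle : ∀ v, edgeSq τ H v y ≤ C₂ * C₃ * (sesq (coeff (edgeMix ω₀ N τ τ' a c) e y) v v).re := by
    intro v
    have h4 := (B₃ y hy hyK hyD v).1
    rw [inv_mul_le_iff₀ h₃] at h4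
    calc _ ≤ C₂ * (sesq (modelEdge τ y) v v).re := B₂ y hyS v
      _ ≤ C₂ * (C₃ * (sesq (coeff (edgeMix ω₀ N τ τ' a c) e y) v v).re) :=
        mul_le_mul_of_nonneg_left h4 h₂
      _ = _ := by ring
  obtain ⟨b, hb⟩ := B₁ y hyS v w
  refine ⟨b, hb.trans ?_⟩
  have h5 : edgeSq τ H v y * edgeSq τ H w y
      ≤ (C₂ * C₃ * (sesq (coeff (edgeMix ω₀ N τ τ' a c) e y) v v).re)
        * (C₂ * C₃ * (sesq (coeff (edgeMix ω₀ N τ τ' a c) e y) w w).re) :=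
    mul_le_mul (hle v) (hle w) (edgeSq_nonneg _ _) ((edgeSq_nonneg _ _).trans (hle v))
  calc _ ≤ C₁ * ((C₂ * C₃ * (sesq (coeff (edgeMix ω₀ N τ τ' a c) e y) v v).re)
        * (C₂ * C₃ * (sesq (coeff (edgeMix ω₀ N τ τ' a c) e y) w w).re)) :=
        mul_le_mul_of_nonneg_left h5 h₁
    _ = _ := by ring

/-- A bound for the Hessian along suitable discs in finitely many charts bounds the bisectional
curvature from below. -/
theorem EdgeAtlas.bisectionalBoundedBelow (A : EdgeAtlas n D) (hD : IsClosed D)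
    (hg : IsKaehlerOn g Dᶜ)
    (h : ∀ i, ∃ C : ℝ, 0 ≤ C ∧ ∀ y ∈ (A.chart i).target, (A.chart i).symm y ∈ A.core i →
      (A.chart i).symm y ∉ D → ∀ v w : Cn n, ∃ b, discHessian (coeff g (A.chart i)) y v w b
        ≤ C * ((sesq (coeff g (A.chart i) y) v v).re * (sesq (coeff g (A.chart i) y) w w).re)) :
    BisectionalBoundedBelow D g := by
  choose C hC0 hC using h
  refine ⟨∑ i, C i, fun e he y hy hyD v w => ?_⟩
  obtain ⟨i, hi⟩ := A.exists_mem_core (e.symm y)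
  set e' := A.chart i
  have he' : e' ∈ holoCharts n M := (A.adapted i).1
  have hyo : y ∈ overlap e e' := ⟨hy, A.core_subset i hi⟩
  have hDo := hD.isOpen_compl
  have hW : IsOpen (overlap e e' ∩ (e.target ∩ e.symm ⁻¹' Dᶜ)) :=
    isOpen_overlap.inter (isOpen_chart_inter e hDo)
  have hyW : y ∈ overlap e e' ∩ (e.target ∩ e.symm ⁻¹' Dᶜ) := ⟨hyo, hy, hyD⟩
  have hm : MapsTo (trans e e') (overlap e e' ∩ (e.target ∩ e.symm ⁻¹' Dᶜ))
      (e'.target ∩ e'.symm ⁻¹' Dᶜ) := by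
    intro z hz
    refine ⟨(trans_mem hz.1).1, ?_⟩
    rw [mem_preimage, symm_trans hz.1]
    exact hz.2.2
  have hy' := (hm hyW).1
  have hsy : e'.symm (trans e e' y) = e.symm y := symm_trans hyo
  set J := fderiv ℂ (trans e e') y with hJ
  obtain ⟨b', hb'⟩ := hC i (trans e e' y) hy' (by rwa [hsy]) (by rwa [hsy]) (J v) (J w)
  -- The vector b is determined by requiring that the transformed vector Jb + Φ''(v, w) be the good
  -- vector b' of the chart `e'`.
  obtain ⟨b, hb⟩ := fderiv_trans_surjective he he' hyo
    (b' - fderiv ℂ (fun z => fderiv ℂ (trans e e') z v) y w)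
  have h1 := discHessian_pullback (g := coeff g e) (g' := coeff g e') hW
    (isOpen_chart_inter e' hDo) ((contDiffOn_trans he he').mono inter_subset_left) hm
    (fun α β => hg.smooth e' he' α β)
    (fun z hz α β => hg.isClosedHermitian.coeff_conj hz.2 α β)
    (fun z hz v w => sesq_coeff_trans g he he' hz.1 v w) hyW v w b
  rw [hb, sub_add_cancel] at h1
  have h2 := neg_discHessian_le_bisectional (isOpen_chart_inter e hDo)
    (fun α β => hg.smooth e he α β) (fun z hz α β => hg.isClosedHermitian.coeff_conj hz.2 α β)
    ⟨hy, hyD⟩ (posDef_of_sesq_pos (fun α β => hg.isClosedHermitian.coeff_conj hyD α β)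
      fun v hv => hg.sesq_pos he hy hyD hv) v w b
  have h3 := sesq_coeff_trans g he he' hyo v v
  have h4 := sesq_coeff_trans g he he' hyo w w
  rw [← hJ] at h3 h4
  rw [h1] at h2
  rw [← h3, ← h4] at hb'
  have h5 : C i ≤ ∑ i, C i := Finset.single_le_sum (fun i _ => hC0 i) (Finset.mem_univ i)
  have h6 : ∀ v, 0 ≤ (sesq (coeff g e y) v v).re := by
    intro v
    rw [sesq_coeff _ he hy]
    exact hg.formVal_nonneg hyD _
  have h7 := mul_le_mul_of_nonneg_right h5 (mul_nonneg (h6 v) (h6 w))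
  linarith

/-- The perturbed metric is an edge-cone metric, uniformly equivalent to the original one, and its
bisectional curvature is bounded from below. -/
theorem exists_good_metric [T2Space M] [CompactSpace M] (hN : IsDivisorNorm n D N)
    (hω₀ : IsKaehlerOn ω₀ univ) {τ τ' a : ℝ} (hτ : 0 < τ) (hττ' : τ < τ') (hτ' : τ' < 1)
    (ha : 0 < a) (hg : IsEdgeConeKaehler D τ (edgeMix ω₀ N τ τ' a 0)) :
    ∃ c₀ : ℝ, 0 < c₀ ∧ ∀ c, 0 < c → c < c₀ →
      IsEdgeConeKaehler D τ (edgeMix ω₀ N τ τ' a c) ∧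
      UniformlyEquivalent D (edgeMix ω₀ N τ τ' a c) (edgeMix ω₀ N τ τ' a 0) ∧
      BisectionalBoundedBelow D (edgeMix ω₀ N τ τ' a c) := by
  obtain ⟨A⟩ := exists_edgeAtlas hN
  obtain ⟨C, hC, hdom⟩ := A.exists_ddc_rpow_le hN hτ hττ' hτ' hg
  obtain ⟨t₀, ht₀⟩ := hN.exists_log_le
  have hτ'0 := hτ.trans hττ'
  set R := Real.exp ((τ' - τ) * t₀)
  have hR : 0 < R := Real.exp_pos _
  -- The first bound keeps the perturbation below half of ω_τ, which yields the equivalence with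
  -- constant 2. The second keeps F'' at least half of its first exponential, as the curvature
  -- estimate requires.
  refine ⟨min (1 / (2 * C)) (a * τ ^ 2 / (2 * (τ' ^ 2 * R))), by positivity, fun c hc hcc => ?_⟩
  have hc1 : c * C ≤ 1 / 2 := by
    have := hcc.trans_le (min_le_left _ _)
    rw [lt_div_iff₀ (by positivity)] at this
    linarith
  have hc2 : c * τ' ^ 2 * R ≤ a * τ ^ 2 / 2 := by
    have := hcc.trans_le (min_le_right _ _)
    rw [lt_div_iff₀ (by positivity)] at this
    linarith
  have hb := fun x (hx : x ∉ D) v => formVal_edgeMix_bounds hdom hg.kaehler hc.le hc1 hx v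
  have hedge : IsEdgeConeKaehler D τ (edgeMix ω₀ N τ τ' a c) := by
    refine isEdgeConeKaehler_edgeMix hN hω₀ hτ hττ' (hττ'.trans hτ') ha (fun x hx v hv => ?_)
      fun e he K hKe hK => ?_
    · have h1 : 0 < (formVal (edgeMix ω₀ N τ τ' a 0) x v v).re := hg.kaehler.pos x hx v hv
      linarith [(hb x hx v).1]
    · obtain ⟨C₁, h₁, B₁⟩ := hg.model_equiv e he K hKe hK
      refine ⟨2 * C₁, by positivity, fun y hy hyK hyD v => ?_⟩
      obtain ⟨l, u⟩ := B₁ y hy hyK hyD v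
      have h1 := hb _ hyD (jac e y v)
      rw [← sesq_coeff _ he.1 hy, ← sesq_coeff _ he.1 hy] at h1
      rw [inv_mul_le_iff₀ h₁] at l
      refine ⟨?_, by linarith [h1.2]⟩
      rw [inv_mul_le_iff₀ (by positivity)]
      have := mul_le_mul_of_nonneg_left h1.1 h₁.le
      linarith
  refine ⟨hedge, ⟨2, by norm_num, fun x hx v => ?_⟩, ?_⟩
  · obtain ⟨l, u⟩ := hb x hx v
    rw [one_div] at l
    exact ⟨l, u⟩
  · exact A.bisectionalBoundedBelow hN.isClosed hedge.kaehler fun i =>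
      exists_discHessian_le hN hω₀ hτ hττ' hτ' ha hc ht₀ hc2 hedge (A.adapted i) (A.core_subset i)
        (A.core_compact i)

end Curvature

/-! ### Hölder functions of `(ξ, z₂, …, z_n)` -/

theorem norm_basisVec {n : ℕ} (α : Fin n) : ‖basisVec α‖ = 1 := by simp [basisVec]

section Holder

variable {n : ℕ} [NeZero n] {τ θ : ℝ} {S T U : Set (Cn n)} {f g : Cn n → ℂ}

/-- The function `f` and its Hölder quotients on `S` are bounded by `C`. -/
structure EdgeHolderWith (τ θ C : ℝ) (S : Set (Cn n)) (f : Cn n → ℂ) : Prop where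
  bound : ∀ x ∈ S, ‖f x‖ ≤ C
  holder : ∀ x ∈ S, ∀ y ∈ S, ‖f x - f y‖ ≤ C * dist (xiCoord τ x) (xiCoord τ y) ^ θ

/-- The bounded functions on `S` which are `θ`-Hölder with respect to `(ξ, z₂, …, z_n)`. -/
def EdgeHolder (τ θ : ℝ) (S : Set (Cn n)) (f : Cn n → ℂ) : Prop :=
  ∃ C : ℝ, 0 ≤ C ∧ EdgeHolderWith τ θ C S f

theorem EdgeHolderWith.mono {C : ℝ} (h : EdgeHolderWith τ θ C S f) (hT : T ⊆ S) :
    EdgeHolderWith τ θ C T f :=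
  ⟨fun x hx => h.bound x (hT hx), fun x hx y hy => h.holder x (hT hx) y (hT hy)⟩

theorem EdgeHolderWith.congr {C : ℝ} (h : EdgeHolderWith τ θ C S f) (hfg : EqOn g f S) :
    EdgeHolderWith τ θ C S g :=
  ⟨fun x hx => by rw [hfg hx]; exact h.bound x hx,
    fun x hx y hy => by rw [hfg hx, hfg hy]; exact h.holder x hx y hy⟩

theorem EdgeHolderWith.const_mul {C : ℝ} (h : EdgeHolderWith τ θ C S f) (a : ℂ) :
    EdgeHolderWith τ θ (‖a‖ * C) S fun x => a * f x := by
  refine ⟨fun x hx => ?_, fun x hx y hy => ?_⟩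
  · rw [norm_mul]
    exact mul_le_mul_of_nonneg_left (h.bound x hx) (norm_nonneg _)
  · rw [← mul_sub, norm_mul, mul_assoc]
    exact mul_le_mul_of_nonneg_left (h.holder x hx y hy) (norm_nonneg _)

theorem EdgeHolderWith.holderNormOn_le {C : ℝ} (h : EdgeHolderWith τ θ C S f) (hC : 0 ≤ C)
    (hθ : 0 ≤ θ) : holderNormOn τ θ S f ≤ ENNReal.ofReal (2 * C) := by
  rw [two_mul, ENNReal.ofReal_add hC hC]
  refine add_le_add (iSup₂_le fun x hx => ?_)
    -- In product form the Hölder inequality needs no separate treatment of x = y.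
    (iSup₂_le fun x hx => iSup₂_le fun y hy => ENNReal.div_le_of_le_mul ?_)
  · rw [← ofReal_norm]
    exact ENNReal.ofReal_le_ofReal (h.bound x hx)
  · rw [← ofReal_norm, edist_dist, ENNReal.ofReal_rpow_of_nonneg dist_nonneg hθ,
      ← ENNReal.ofReal_mul hC]
    exact ENNReal.ofReal_le_ofReal (h.holder x hx y hy)

theorem edgeHolder_const (c : ℂ) : EdgeHolder τ θ S fun _ => c := by
  refine ⟨‖c‖, norm_nonneg _, fun x _ => le_rfl, fun x _ y _ => ?_⟩
  rw [sub_self, norm_zero]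
  positivity

theorem EdgeHolder.add (hf : EdgeHolder τ θ S f) (hg : EdgeHolder τ θ S g) :
    EdgeHolder τ θ S fun x => f x + g x := by
  obtain ⟨C, hC, h⟩ := hf
  obtain ⟨C', hC', h'⟩ := hg
  refine ⟨C + C', by positivity, fun x hx => (norm_add_le _ _).trans
    (add_le_add (h.bound x hx) (h'.bound x hx)), fun x hx y hy => ?_⟩
  rw [add_sub_add_comm, add_mul]
  exact (norm_add_le _ _).trans (add_le_add (h.holder x hx y hy) (h'.holder x hx y hy))

theorem EdgeHolder.mul (hf : EdgeHolder τ θ S f) (hg : EdgeHolder τ θ S g) :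
    EdgeHolder τ θ S fun x => f x * g x := by
  obtain ⟨C, hC, h⟩ := hf
  obtain ⟨C', hC', h'⟩ := hg
  refine ⟨2 * (C * C'), by positivity, fun x hx => ?_, fun x hx y hy => ?_⟩
  · rw [norm_mul]
    have := mul_le_mul (h.bound x hx) (h'.bound x hx) (norm_nonneg _) hC
    linarith [mul_nonneg hC hC']
  · have e : f x * g x - f y * g y = f x * (g x - g y) + (f x - f y) * g y := by ring
    rw [e]
    refine (norm_add_le _ _).trans ?_
    rw [norm_mul, norm_mul]
    have h1 := mul_le_mul (h.bound x hx) (h'.holder x hx y hy) (norm_nonneg _) hC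
    have h2 := mul_le_mul (h.holder x hx y hy) (h'.bound y hy) (norm_nonneg _) (by positivity)
    linarith

theorem EdgeHolder.conj (hf : EdgeHolder τ θ S f) : EdgeHolder τ θ S fun x => conj (f x) := by
  obtain ⟨C, hC, h⟩ := hf
  refine ⟨C, hC, fun x hx => ?_, fun x hx y hy => ?_⟩
  · rw [RCLike.norm_conj]; exact h.bound x hx
  · rw [← map_sub, RCLike.norm_conj]; exact h.holder x hx y hy

/-- Bernoulli's inequality at b/a, that is, the tangent line of the convex function t^s at a lies
below its graph. -/
theorem rpow_sub_rpow_le_mul {a b s : ℝ} (hb : 0 ≤ b) (hba : b ≤ a) (hs : 1 ≤ s) :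
    a ^ s - b ^ s ≤ s * a ^ (s - 1) * (a - b) := by
  rcases (hb.trans hba).eq_or_lt with ha | ha
  · have : b = 0 := le_antisymm (ha ▸ hba) hb
    rw [this, ← ha]; simp
  have h1 := one_add_mul_self_le_rpow_one_add (s := b / a - 1) (by
    have : 0 ≤ b / a := by positivity
    linarith) hs
  have h2 : (1 + (b / a - 1)) ^ s = b ^ s / a ^ s := by
    rw [add_sub_cancel, Real.div_rpow hb ha.le]
  have h3 : a ^ s = a ^ (s - 1) * a := by
    rw [← Real.rpow_add_one ha.ne', sub_add_cancel]
  have h4 : 0 < a ^ s := Real.rpow_pos_of_pos ha _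
  rw [h2, le_div_iff₀ h4] at h1
  have h5 : s * a ^ (s - 1) * (a - b) = - (s * (b / a - 1)) * a ^ s := by
    rw [h3]; field_simp; ring
  rw [h5]
  linarith

theorem rpow_sub_rpow_le_rpow {a b q : ℝ} (hb : 0 ≤ b) (hba : b ≤ a) (hq : 0 ≤ q) (hq1 : q ≤ 1) :
    a ^ q - b ^ q ≤ (a - b) ^ q := by
  have := Real.rpow_add_le_add_rpow (sub_nonneg.2 hba) hb hq hq1
  rw [sub_add_cancel] at this
  linarith

/-- The coordinate `ξ`. -/
def xi (τ : ℝ) (z : Cn n) : ℂ := ((‖z 0‖ ^ (τ - 1) : ℝ) : ℂ) * z 0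

theorem xiCoord_eq (z : Cn n) : xiCoord τ z = z + (xi τ z - z 0) • basisVec 0 := by
  ext α
  by_cases hα : α = 0
  · subst hα; simp [xiCoord, xi, basisVec]
  · simp [xiCoord, basisVec, hα]

theorem norm_xi (hτ : 0 < τ) (z : Cn n) : ‖xi τ z‖ = ‖z 0‖ ^ τ := by
  rw [xi, norm_mul, Complex.norm_real, Real.norm_of_nonneg (by positivity)]
  rcases (norm_nonneg (z 0)).eq_or_lt with h | h
  · rw [← h, mul_zero, Real.zero_rpow hτ.ne']
  · rw [← Real.rpow_add_one h.ne', sub_add_cancel]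

theorem eq_mul_xi (hτ : 0 < τ) (z : Cn n) : z 0 = ((‖xi τ z‖ ^ (1 / τ - 1) : ℝ) : ℂ) * xi τ z := by
  rcases (norm_nonneg (z 0)).eq_or_lt with h | h
  · have : z 0 = 0 := norm_eq_zero.1 h.symm
    simp [xi, this]
  · rw [norm_xi hτ, xi, ← mul_assoc, ← Complex.ofReal_mul, ← Real.rpow_mul h.le, ← Real.rpow_add h]
    have : τ * (1 / τ - 1) + (τ - 1) = 0 := by field_simp; ring
    rw [this, Real.rpow_zero, Complex.ofReal_one, one_mul]

theorem norm_xi_sub_le (x y : Cn n) : ‖xi τ x - xi τ y‖ ≤ dist (xiCoord τ x) (xiCoord τ y) := by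
  have h := PiLp.norm_apply_le (xiCoord τ x - xiCoord τ y) 0
  rw [dist_eq_norm]
  have e : (xiCoord τ x - xiCoord τ y) 0 = xi τ x - xi τ y := by simp [xiCoord, xi]
  rwa [e] at h

/-- Splitting off |u|^m (u - w), the remainder (|u|^m - |w|^m)|w| is at most |u|^{m+1} - |w|^{m+1}.
The constant is 1 + (m + 1). -/
theorem norm_rpow_mul_sub_le {u w : ℂ} {m : ℝ} (hm : 0 ≤ m) (h : ‖w‖ ≤ ‖u‖) :
    ‖((‖u‖ ^ m : ℝ) : ℂ) * u - ((‖w‖ ^ m : ℝ) : ℂ) * w‖ ≤ (m + 2) * ‖u‖ ^ m * ‖u - w‖ := by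
  have e : ((‖u‖ ^ m : ℝ) : ℂ) * u - ((‖w‖ ^ m : ℝ) : ℂ) * w
      = ((‖u‖ ^ m : ℝ) : ℂ) * (u - w) + ((‖u‖ ^ m - ‖w‖ ^ m : ℝ) : ℂ) * w := by
    push_cast; ring
  have h0 := norm_nonneg w
  have hmono : ‖w‖ ^ m ≤ ‖u‖ ^ m := Real.rpow_le_rpow h0 h hm
  rw [e]
  refine (norm_add_le _ _).trans ?_
  rw [norm_mul, norm_mul, Complex.norm_real, Complex.norm_real,
    Real.norm_of_nonneg (by positivity), Real.norm_of_nonneg (sub_nonneg.2 hmono)]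
  have h1 : (‖u‖ ^ m - ‖w‖ ^ m) * ‖w‖ ≤ ‖u‖ ^ (m + 1) - ‖w‖ ^ (m + 1) := by
    rw [Real.rpow_add_one' (norm_nonneg u) (by positivity), Real.rpow_add_one' h0 (by positivity)]
    have := mul_le_mul_of_nonneg_left h (Real.rpow_nonneg (norm_nonneg u) m)
    linarith
  have h2 := rpow_sub_rpow_le_mul h0 h (show 1 ≤ m + 1 by linarith)
  rw [add_sub_cancel_right] at h2
  have h3 : ‖u‖ - ‖w‖ ≤ ‖u - w‖ := norm_sub_norm_le u w
  have h4 := mul_le_mul_of_nonneg_left h3 (show 0 ≤ (m + 1) * ‖u‖ ^ m by positivity)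
  linarith

/-- On a compact set the coordinates are Lipschitz functions of `(ξ, z₂, …, z_n)`. -/
theorem exists_norm_sub_le (hS : IsCompact S) (hτ : 0 < τ) (hτ1 : τ < 1) :
    ∃ C : ℝ, 0 ≤ C ∧ ∀ x ∈ S, ∀ y ∈ S, ‖x - y‖ ≤ C * dist (xiCoord τ x) (xiCoord τ y) := by
  have hm : 0 ≤ 1 / τ - 1 := by
    rw [sub_nonneg, le_div_iff₀ hτ]; linarith
  obtain ⟨B, hB, h⟩ := exists_rpow_norm_le (S := S) hS (q := 1 - τ) (by linarith)
  -- With m = 1/τ - 1 ≥ 0 one has z₁ = |ξ|^m ξ, and |ξ|^m = |z₁|^{1-τ} is bounded by B on S. So z₁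
  -- is a Lipschitz function of ξ, although ξ is not one of z₁.
  set L := (1 / τ - 1 + 2) * B with hL
  have hL0 : 0 ≤ L := by positivity
  have key : ∀ x ∈ S, ∀ y ∈ S, ‖xi τ y‖ ≤ ‖xi τ x‖ → ‖x 0 - y 0‖ ≤ L * ‖xi τ x - xi τ y‖ := by
    intro x hx y hy hxy
    have h1 := norm_rpow_mul_sub_le hm hxy
    rw [← eq_mul_xi hτ, ← eq_mul_xi hτ] at h1
    have h2 : ‖xi τ x‖ ^ (1 / τ - 1) ≤ B := by
      rw [norm_xi hτ, ← Real.rpow_mul (norm_nonneg _)]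
      have : τ * (1 / τ - 1) = 1 - τ := by field_simp
      rw [this]
      exact h x hx
    refine h1.trans (mul_le_mul_of_nonneg_right ?_ (norm_nonneg _))
    exact mul_le_mul_of_nonneg_left h2 (by positivity)
  have key' : ∀ x ∈ S, ∀ y ∈ S, ‖x 0 - y 0‖ ≤ L * ‖xi τ x - xi τ y‖ := by
    intro x hx y hy
    rcases le_total ‖xi τ y‖ ‖xi τ x‖ with hxy | hxy
    · exact key x hx y hy hxy
    · rw [norm_sub_rev, norm_sub_rev (xi τ x)]
      exact key y hy x hx hxy
  refine ⟨2 + L, by positivity, fun x hx y hy => ?_⟩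
  have h1 := norm_xi_sub_le (τ := τ) x y
  have h2 := (key' x hx y hy).trans (mul_le_mul_of_nonneg_left h1 hL0)
  have e : x - y = (xiCoord τ x - xiCoord τ y)
      + ((x 0 - y 0) - (xi τ x - xi τ y)) • basisVec 0 := by
    rw [xiCoord_eq, xiCoord_eq, sub_smul (x 0 - y 0), sub_smul, sub_smul, sub_smul, sub_smul]
    abel
  rw [e]
  refine (norm_add_le _ _).trans ?_
  rw [norm_smul, norm_basisVec, mul_one, ← dist_eq_norm]
  have h3 := norm_sub_le (x 0 - y 0) (xi τ x - xi τ y)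
  linarith

theorem exists_dist_xiCoord_le (hS : IsCompact S) (hτ : 0 < τ) :
    ∃ R : ℝ, 0 ≤ R ∧ ∀ x ∈ S, ∀ y ∈ S, dist (xiCoord τ x) (xiCoord τ y) ≤ R := by
  obtain ⟨B, hB, h⟩ := exists_rpow_norm_le (S := S) hS (q := τ) hτ.le
  obtain ⟨B', hB', h'⟩ := exists_bound_of_smooth (f := id) hS subset_rfl continuousOn_id
  have key : ∀ x ∈ S, ‖xiCoord τ x‖ ≤ 2 * B' + B := by
    intro x hx
    rw [xiCoord_eq]
    refine (norm_add_le _ _).trans ?_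
    rw [norm_smul, norm_basisVec, mul_one]
    have h1 := norm_sub_le (xi τ x) (x 0)
    rw [norm_xi hτ] at h1
    have h2 := PiLp.norm_apply_le x 0
    have h3 : ‖x‖ ≤ B' := h' x hx
    have h4 := h x hx
    linarith
  refine ⟨2 * (2 * B' + B), by positivity, fun x hx y hy => ?_⟩
  rw [dist_eq_norm]
  have := norm_sub_le (xiCoord τ x) (xiCoord τ y)
  have h1 := key x hx
  have h2 := key y hy
  linarith

theorem le_rpow_mul_rpow {d R : ℝ} (hd : 0 ≤ d) (hdR : d ≤ R) (hθ1 : θ ≤ 1) :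
    d ≤ R ^ (1 - θ) * d ^ θ := by
  have h1 : d = d ^ (1 - θ) * d ^ θ := by
    rw [← Real.rpow_add' hd (by simp), sub_add_cancel, Real.rpow_one]
  calc d = d ^ (1 - θ) * d ^ θ := h1
    _ ≤ _ := mul_le_mul_of_nonneg_right (Real.rpow_le_rpow hd hdR (by linarith))
      (Real.rpow_nonneg hd _)

/-- Smooth functions are Hölder on compact sets. -/
theorem edgeHolder_of_smooth (hU : IsOpen U) (hS : IsCompact S) (hSU : S ⊆ U)
    (hf : ContDiffOn ℝ ∞ f U) (hτ : 0 < τ) (hτ1 : τ < 1) (hθ1 : θ < 1) :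
    EdgeHolder τ θ S f := by
  obtain ⟨B, hB, hb⟩ := exists_bound_of_smooth hS hSU hf.continuousOn
  obtain ⟨C, hC, hc⟩ := exists_norm_sub_le hS hτ hτ1
  obtain ⟨R, hR, hr⟩ := exists_dist_xiCoord_le hS hτ
  have hl : LocallyLipschitzOn S f := by
    intro x hx
    obtain ⟨K, t, ht, hK⟩ := ((hf.contDiffAt (hU.mem_nhds (hSU hx))).of_le
      (by simp)).exists_lipschitzOnWith
    exact ⟨K, t, nhdsWithin_le_nhds ht, hK⟩
  obtain ⟨K, hK⟩ := hl.exists_lipschitzOnWith_of_compact hS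
  refine ⟨B + K * (C * R ^ (1 - θ)), by positivity, fun x hx => ?_, fun x hx y hy => ?_⟩
  · have : 0 ≤ (K : ℝ) * (C * R ^ (1 - θ)) := by positivity
    linarith [hb x hx]
  · have h1 := hK.dist_le_mul x hx y hy
    rw [dist_eq_norm, dist_eq_norm] at h1
    have hd : 0 ≤ dist (xiCoord τ x) (xiCoord τ y) := dist_nonneg
    have h2 := le_rpow_mul_rpow hd (hr x hx y hy) hθ1.le
    have h3 : 0 ≤ B * dist (xiCoord τ x) (xiCoord τ y) ^ θ := by positivity
    calc _ ≤ (K : ℝ) * ‖x - y‖ := h1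
      _ ≤ K * (C * (R ^ (1 - θ) * dist (xiCoord τ x) (xiCoord τ y) ^ θ)) := by
        refine mul_le_mul_of_nonneg_left ((hc x hx y hy).trans ?_) K.2
        exact mul_le_mul_of_nonneg_left h2 hC
      _ ≤ _ := by linarith

/-- The function `|z₁|^q` is Hölder on compact sets for `q ≥ τθ`. -/
theorem edgeHolder_rpow (hS : IsCompact S) {q : ℝ} (hτ : 0 < τ) (hθ : 0 < θ) (hθ1 : θ < 1)
    (hq : τ * θ ≤ q) : EdgeHolder τ θ S fun z => ((‖z 0‖ ^ q : ℝ) : ℂ) := by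
  have hτθ : 0 < τ * θ := mul_pos hτ hθ
  obtain ⟨B, hB, hb⟩ := exists_rpow_norm_le (S := S) hS (q := q) (hτθ.le.trans hq)
  obtain ⟨B', hB', hb'⟩ := exists_rpow_norm_le (S := S) hS (q := q - τ * θ) (by linarith)
  -- Then |z₁|^q = (|ξ|^θ)^s with s ≥ 1: the power s is Lipschitz on bounded sets, and |ξ|^θ is
  -- θ-Hölder in ξ.
  set s := q / (τ * θ) with hs
  have hs1 : 1 ≤ s := (one_le_div hτθ).2 hq
  have key : ∀ x ∈ S, ∀ y ∈ S, ‖xi τ y‖ ≤ ‖xi τ x‖ →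
      |‖x 0‖ ^ q - ‖y 0‖ ^ q| ≤ s * B' * dist (xiCoord τ x) (xiCoord τ y) ^ θ := by
    intro x hx y hy hxy
    have e : ∀ z : Cn n, ‖z 0‖ ^ q = (‖xi τ z‖ ^ θ) ^ s := by
      intro z
      rw [norm_xi hτ, ← Real.rpow_mul (norm_nonneg _), ← Real.rpow_mul (norm_nonneg _), hs]
      congr 1; field_simp
    have h0 : 0 ≤ ‖xi τ y‖ ^ θ := by positivity
    have h1 : ‖xi τ y‖ ^ θ ≤ ‖xi τ x‖ ^ θ := Real.rpow_le_rpow (norm_nonneg _) hxy hθ.le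
    have h2 := rpow_sub_rpow_le_mul h0 h1 hs1
    have h3 := rpow_sub_rpow_le_rpow (norm_nonneg _) hxy hθ.le hθ1.le
    have h4 : (‖xi τ x‖ - ‖xi τ y‖) ^ θ ≤ dist (xiCoord τ x) (xiCoord τ y) ^ θ :=
      Real.rpow_le_rpow (sub_nonneg.2 hxy)
        ((norm_sub_norm_le _ _).trans (norm_xi_sub_le x y)) hθ.le
    have h5 : (‖xi τ x‖ ^ θ) ^ (s - 1) ≤ B' := by
      rw [norm_xi hτ, ← Real.rpow_mul (norm_nonneg _), ← Real.rpow_mul (norm_nonneg _)]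
      have : τ * θ * (s - 1) = q - τ * θ := by rw [hs]; field_simp
      rw [this]
      exact hb' x hx
    rw [e, e, abs_of_nonneg (sub_nonneg.2 (Real.rpow_le_rpow h0 h1 (by linarith)))]
    refine h2.trans (mul_le_mul (mul_le_mul_of_nonneg_left h5 (by linarith)) (h3.trans h4)
      (sub_nonneg.2 h1) (by positivity))
  refine ⟨B + s * B', by positivity, fun x hx => ?_, fun x hx y hy => ?_⟩
  · rw [Complex.norm_real, Real.norm_of_nonneg (by positivity)]
    have : 0 ≤ s * B' := by positivity
    linarith [hb x hx]
  · rw [← Complex.ofReal_sub, Complex.norm_real, Real.norm_eq_abs]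
    have h3 : 0 ≤ B * dist (xiCoord τ x) (xiCoord τ y) ^ θ := by positivity
    rcases le_total ‖xi τ y‖ ‖xi τ x‖ with hxy | hxy
    · linarith [key x hx y hy hxy]
    · have := key y hy x hx hxy
      rw [abs_sub_comm, dist_comm] at this
      linarith

/-- All factors are smooth functions, or powers of |z₁| with exponent at least τθ, or products, sums
and conjugates of these. The binding condition comes from |z₁|^{2σ-2τ}. -/
theorem edgeHolder_powerExpr (hU : IsOpen U) (hS : IsCompact S) (hSU : S ⊆ U) {H : Cn n → ℝ}
    (hH : ContDiffOn ℝ ∞ H U) (hpos : ∀ z ∈ U, 0 < H z) {σ : ℝ} (hτ : 0 < τ) (hτ1 : τ < 1)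
    (hθ : 0 < θ) (hθ1 : θ < 1) (hσ : τ * θ ≤ 2 * σ - 2 * τ) (α β : Fin n) :
    EdgeHolder τ θ S (powerExpr τ σ H α β) := by
  have hsm : ∀ {f : Cn n → ℂ}, ContDiffOn ℝ ∞ f U → EdgeHolder τ θ S f := fun hf =>
    edgeHolder_of_smooth hU hS hSU hf hτ hτ1 hθ1
  have hL := contDiffOn_logH hH hpos
  have hk : ∀ α, EdgeHolder τ θ S (kappa τ α) := by
    intro α
    by_cases hα : α = 0
    · have : kappa (n := n) τ α = fun z => z 0 / (τ : ℂ) := funext fun z => if_pos hα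
      rw [this]
      exact hsm ((contDiff_coord 0).contDiffOn.div_const _)
    · have : kappa (n := n) τ α = fun z => ((‖z 0‖ ^ τ : ℝ) : ℂ) := funext fun z => if_neg hα
      rw [this]
      exact edgeHolder_rpow hS hτ hθ hθ1 (mul_le_of_le_one_right hτ.le hθ1.le)
  have hr : ∀ α, EdgeHolder τ θ S (rho τ H α) := fun α =>
    ((hk α).mul (hsm (contDiffOn_del hU hL _))).add (edgeHolder_const _)
  have hHσ : EdgeHolder τ θ S fun z => ((H z ^ σ : ℝ) : ℂ) :=
    hsm (contDiffOn_ofReal (hH.rpow_const_of_ne fun z hz => (hpos z hz).ne'))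
  exact (hHσ.mul (edgeHolder_rpow hS hτ hθ hθ1 hσ)).mul
    (((edgeHolder_const _).mul (((hk α).mul (hk β).conj).mul (hsm (contDiffOn_levi hU hL _ _)))).add
      ((edgeHolder_const _).mul ((hr α).mul (hr β).conj)))

end Holder

/-! ### The Hölder norm of the perturbation. -/

section HolderForms

variable {n : ℕ} [NeZero n] {M : Type*} [TopologicalSpace M] [ChartedSpace (Cn n) M] {D : Set M}
  {N : M → ℝ} {ω₀ : FormField n M}

/-- The perturbation is linear in c, so its norm is c times that of a fixed form and smallness needs
only finiteness. -/
theorem edgeCoeff_edgeMix_sub (ω₀ : FormField n M) (N : M → ℝ) (τ τ' a c : ℝ)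
    (e : OpenPartialHomeomorph M (Cn n)) (z : Cn n) (α β : Fin n) :
    edgeCoeff τ (coeff (edgeMix ω₀ N τ τ' a c - edgeMix ω₀ N τ τ' a 0) e) z α β
      = (-c : ℂ) * edgeCoeff τ (coeff (ddc fun x => N x ^ τ') e) z α β := by
  simp only [edgeCoeff_apply, coeff_sub, coeff_edgeMix, Matrix.add_apply, Matrix.sub_apply,
    Matrix.smul_apply, smul_eq_mul]
  push_cast
  ring

variable [IsManifold 𝓘(ℂ, Cn n) ω M]

theorem EdgeAtlas.exists_edgeHolderWith (A : EdgeAtlas n D) (hN : IsDivisorNorm n D N) {τ τ' θ : ℝ}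
    (hτ : 0 < τ) (hτ1 : τ < 1) (hθ : 0 < θ) (hθ1 : θ < 1) (hσ : τ * θ ≤ 2 * τ' - 2 * τ) :
    ∃ B : ℝ, 0 ≤ B ∧ ∀ i α β, EdgeHolderWith τ θ B
      {y | y ∈ (A.chart i).target ∧ (A.chart i).symm y ∈ A.core i \ D}
      (fun y => edgeCoeff τ (coeff (ddc fun x => N x ^ τ') (A.chart i)) y α β) := by
  have h : ∀ p : Fin A.size × Fin n × Fin n, ∃ B : ℝ, 0 ≤ B ∧ EdgeHolderWith τ θ B
      {y | y ∈ (A.chart p.1).target ∧ (A.chart p.1).symm y ∈ A.core p.1 \ D}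
      (fun y => edgeCoeff τ (coeff (ddc fun x => N x ^ τ') (A.chart p.1)) y p.2.1 p.2.2) := by
    rintro ⟨i, α, β⟩
    have he := A.adapted i
    obtain ⟨H, hH, hpos, hNH⟩ := exists_factor hN he
    have hS := isCompact_chart_image (A.chart i) (A.core_compact i) (A.core_subset i)
    obtain ⟨B, hB, h⟩ := edgeHolder_powerExpr (A.chart i).open_target hS inter_subset_left hH hpos
      hτ hτ1 hθ hθ1 hσ α β
    refine ⟨B, hB, (h.mono fun y hy => ⟨hy.1, hy.2.1⟩).congr fun y hy => ?_⟩
    exact edgeCoeff_ddc_rpow hN he hH hpos hNH hτ τ' (he.mem_target_inter hy.1 hy.2.2) α β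
  choose B hB h using h
  refine ⟨∑ p, B p, Finset.sum_nonneg fun p _ => hB p, fun i α β => ?_⟩
  have hle : B (i, α, β) ≤ ∑ p, B p :=
    Finset.single_le_sum (fun p _ => hB p) (Finset.mem_univ (i, α, β))
  have h1 := h (i, α, β)
  exact ⟨fun x hx => (h1.bound x hx).trans hle, fun x hx y hy => (h1.holder x hx y hy).trans
    (mul_le_mul_of_nonneg_right hle (Real.rpow_nonneg dist_nonneg _))⟩

/-- The perturbation is small in `C^θ_τ`. -/
theorem EdgeAtlas.exists_edgeHolderNorm_lt (A : EdgeAtlas n D) (hN : IsDivisorNorm n D N)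
    {τ τ' a θ ε : ℝ} (hτ : 0 < τ) (hττ' : τ < τ') (hτ1 : τ < 1) (hθ : 0 < θ) (hθ1 : θ < 1)
    (hθτ : θ ≤ 2 * (τ' / τ - 1)) (hε : 0 < ε) :
    ∃ c₁ : ℝ, 0 < c₁ ∧ ∀ c, 0 < c → c < c₁ →
      MemEdgeHolder A τ θ (edgeMix ω₀ N τ τ' a c - edgeMix ω₀ N τ τ' a 0) ∧
      edgeHolderNorm A τ θ (edgeMix ω₀ N τ τ' a c - edgeMix ω₀ N τ τ' a 0) < ENNReal.ofReal ε := by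
  -- The assumption on θ is exactly the Hölder condition for |z₁|^{2τ'-2τ}.
  have hσ : τ * θ ≤ 2 * τ' - 2 * τ := by
    have := mul_le_mul_of_nonneg_left hθτ hτ.le
    have e : τ * (2 * (τ' / τ - 1)) = 2 * τ' - 2 * τ := by field_simp
    linarith
  obtain ⟨B, hB, h⟩ := A.exists_edgeHolderWith hN hτ hτ1 hθ hθ1 hσ
  refine ⟨ε / (2 * B + 1), by positivity, fun c hc hcc => ?_⟩
  have hcB : 2 * (c * B) < ε := by
    rw [lt_div_iff₀ (by positivity)] at hcc
    linarith
  have hnorm : edgeHolderNorm A τ θ (edgeMix ω₀ N τ τ' a c - edgeMix ω₀ N τ τ' a 0)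
      < ENNReal.ofReal ε := by
    refine lt_of_le_of_lt ?_ ((ENNReal.ofReal_lt_ofReal_iff hε).2 hcB)
    refine iSup_le fun i => iSup_le fun α => iSup_le fun β => ?_
    have h1 := (h i α β).const_mul (-c : ℂ)
    rw [norm_neg, Complex.norm_real, Real.norm_of_nonneg hc.le] at h1
    refine (h1.congr fun y _ => ?_).holderNormOn_le (by positivity) hθ.le
    exact edgeCoeff_edgeMix_sub ω₀ N τ τ' a c (A.chart i) y α β
  refine ⟨⟨hnorm.trans ENNReal.ofReal_lt_top, fun i y hy hy0 α hα => ?_⟩, hnorm⟩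
  have he := A.adapted i
  obtain ⟨H, hH, hpos, hNH⟩ := exists_factor hN he
  have key : ∀ α β, Tendsto (fun z => edgeCoeff τ
      (coeff (edgeMix ω₀ N τ τ' a c - edgeMix ω₀ N τ τ' a 0) (A.chart i)) z α β)
      (𝓝[offZero n] y) (𝓝 0) := by
    intro α β
    have h1 := (tendsto_edgeCoeff_ddc_rpow hN he hH hpos hNH hτ hττ'.le hy α β).const_mul (-c : ℂ)
    rw [powerExpr_of_zero hττ' hy0, mul_zero] at h1
    exact h1.congr fun z => (edgeCoeff_edgeMix_sub ω₀ N τ τ' a c (A.chart i) z α β).symm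
  exact ⟨key 0 α, key α 0⟩

end HolderForms

end EdgeCone

end

open EdgeCone in
theorem proposition1p3 {n : ℕ} [NeZero n]
    {M : Type*} [TopologicalSpace M] [T2Space M] [CompactSpace M]
    [ChartedSpace (Cn n) M] [IsManifold 𝓘(ℂ, Cn n) ω M]
    {L : M → Type*} [TopologicalSpace (Bundle.TotalSpace ℂ L)] [∀ x, AddCommGroup (L x)]
    [∀ x, Module ℂ (L x)] [∀ x, TopologicalSpace (L x)] [FiberBundle ℂ L] [VectorBundle ℂ ℂ L]
    [ContMDiffVectorBundle ω ℂ L 𝓘(ℂ, Cn n)]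
    (ω₀ : FormField n M) (hω₀ : IsKaehlerOn ω₀ univ)
    (h : HermitianMetric n L)
    (s : ∀ x, L x) (hs : IsHolomorphicSection n s)
    (D : Set M) (hD : VanishesSimplyAlong n s D)
    (τ τ' : ℝ) (hτ : 0 < τ) (hττ' : τ < τ') (hτ' : τ' < 1) :
    (∃ 𝔞₀ : ℝ, 0 < 𝔞₀ ∧ ∀ 𝔞 : ℝ, 0 < 𝔞 → 𝔞 < 𝔞₀ →
      IsEdgeConeKaehler D τ (edgeForm ω₀ h s τ 𝔞)) ∧
    ∀ 𝔞 : ℝ, 0 < 𝔞 → IsEdgeConeKaehler D τ (edgeForm ω₀ h s τ 𝔞) →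
      (∃ 𝔠₀ : ℝ, 0 < 𝔠₀ ∧ ∀ 𝔠 : ℝ, 0 < 𝔠 → 𝔠 < 𝔠₀ →
        IsEdgeConeKaehler D τ (goodForm ω₀ h s τ τ' 𝔞 𝔠) ∧
        UniformlyEquivalent D (goodForm ω₀ h s τ τ' 𝔞 𝔠) (edgeForm ω₀ h s τ 𝔞) ∧
        BisectionalBoundedBelow D (goodForm ω₀ h s τ τ' 𝔞 𝔠)) ∧
      (∀ θ : ℝ, 0 < θ → θ < 1 → θ ≤ 2 * (τ' / τ - 1) → ∀ A : EdgeAtlas n D,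
        ∀ ε : ℝ, 0 < ε → ∃ 𝔠₁ : ℝ, 0 < 𝔠₁ ∧ ∀ 𝔠 : ℝ, 0 < 𝔠 → 𝔠 < 𝔠₁ →
          MemEdgeHolder A τ θ (goodForm ω₀ h s τ τ' 𝔞 𝔠 - edgeForm ω₀ h s τ 𝔞) ∧
          edgeHolderNorm A τ θ (goodForm ω₀ h s τ τ' 𝔞 𝔠 - edgeForm ω₀ h s τ 𝔞)
            < ENNReal.ofReal ε) := by
  have hN := isDivisorNorm h hs hD
  set N : M → ℝ := fun x => (h.form x (s x) (s x)).re with hNdef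
  have hedge : ∀ a, edgeForm ω₀ h s τ a = edgeMix ω₀ N τ τ' a 0 := fun a =>
    (edgeMix_zero ω₀ N τ τ' a).symm
  have hgood : ∀ a c, goodForm ω₀ h s τ τ' a c = edgeMix ω₀ N τ τ' a c := fun a c => rfl
  have hτ1 := hττ'.trans hτ'
  simp only [hedge, hgood]
  exact ⟨exists_isEdgeConeKaehler hN hω₀ hτ hττ' hτ1, fun a ha hg =>
    ⟨exists_good_metric hN hω₀ hτ hττ' hτ' ha hg, fun θ hθ hθ1 hθτ A ε hε =>
      A.exists_edgeHolderNorm_lt hN hτ hττ' hτ1 hθ hθ1 hθτ hε⟩⟩
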